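/- Conventions. $\eta=\mathrm{diag}(1,-1,-1,-1)$, $\omega_m(k)=\sqrt{m^2+|k|^2}$, $p=(\omega_m(k),k)$, $d\alpha_m(k)=(2\pi)^{-3}\,d^3k/(2\omega_m(k))$, $D_m^{(+)}(x)=i\int e^{-ip\cdot x}\,d\alpha_m(k)$, and $\hat f(k)=\int e^{ip\cdot x}f(x)\,d^4x$ is the Fourier transform of a test function on the upper mass shell. All fields are free fields smeared with complex test functions: Schwartz functions on $\mathbb R^4$ in the massive case, and Schwartz functions whose Fourier transform vanishes in a neighbourhood of $p=0$ in the massless case. For a list of fields with given two-point functions, $n$-point functions are defined by Wick's theorem, and $\mathcal H$ is the span of the vectors $\varphi_1(f_1)\cdots\varphi_n(f_n)\Omega$ with the sesquilinear form $\langle\varphi_1(f_1)\cdots\varphi_n(f_n)\Omega,\chi_1(g_1)\cdots\chi_l(g_l)\Omega\rangle=\langle\Omega,\varphi_n(f_n)^\dagger\cdots\varphi_1(f_1)^\dagger\chi_1(g_1)\cdots\chi_l(g_l)\Omega\rangle$, modulo the null vectors of this form. The conjugation of smeared fields is $v_\mu(f)^\dagger=v_\mu(\bar f)$, $u(f)^\dagger=u(\bar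 f)$, $\tilde u(f)^\dagger=-\tilde u(\bar f)$, $\Phi(f)^\dagger=\Phi(\bar f)$. The Fock space $\mathcal F(\mathfrak h)$ is the (algebraic) symmetric Fock space of a one-particle pre-Hilbert space $\mathfrak h$, the span of the products $\psi_1\vee\cdots\vee\psi_n$, whose scalar products are permanents; $a^\dagger(\psi),a(\psi)$ are its creation and annihilation operators. $[\cdot,\cdot]$ is the graded commutator. **Massless case.** Let $\mathcal H$ be generated by the massless fields $v_\mu$ (Bose) and $u,\tilde u$ (Fermi), with non-zero two-point functions $\langle\Omega,v_\mu(x)v_\nu(y)\Omega\rangle=i\eta_{\mu\nu}D_0^{(+)}(x-y)$, $\langle\Omega,u(x)\tilde u(y)\Omega\rangle=-iD_0^{(+)}(x-y)=-\langle\Omega,\tilde u(x)u(y)\Omega\rangle$. There is exactly one linear operator $Q$ on $\mathcal H$ with $$Q\Omega=0,\quad [Q,v_\mu]=i\partial_\mu u,\quad [Q,u]=0,\quad [Q,\tilde u]=-i\partial_\mu v^\mu .$$ It satisfies $Q^2=0$. The form $\langle\cdot,\cdot\rangle$ is positive semidefinite on $\mathrm{Ker}\,Q$, and its null vectors there (those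 with $\langle\Psi,\Psi\rangle=0$) are exactly $\mathrm{Ran}\,Q$. Let $\mathfrak h$ be the space of the functions $\psi:\mathbb R^3\to\mathbb C^3$ on the light cone whose components are of the form $\psi_j=\hat f_j$ with test functions $f_j$, and which contain only the helicities $\pm1$ (that is, $\Sigma^2\psi=\psi$ for the helicity operator $(\Sigma\psi)(k)=i\frac{k}{|k|}\times\psi(k)$), with $\langle\psi,\varphi\rangle=\int\sum_j\overline{\psi_j}\varphi_j\,d\alpha_0$. Then there is a linear isomorphism $\Theta:\mathrm{Ker}\,Q/\mathrm{Ran}\,Q\to\mathcal F(\mathfrak h)$ onto the Fock space of photons (mass $0$, helicity $\pm1$) which preserves the scalar products, maps the class of $\Omega$ to the Fock vacuum and, for all test functions $f_\mu$ such that $\partial^\mu f_\mu$ has vanishing Fourier transform on the light cone (both halves), satisfies: $\int f_\mu v^\mu$ leaves $\mathrm{Ker}\,Q$ invariant and $\Theta[\int f_\mu v^\mu\,\Psi]=(a^\dagger(\psi_f)+a(\psi_{\bar f}))\Theta[\Psi]$ for $\Psi\in\mathrm{Ker}\,Q$, where $(\psi_f)_j=\hat f_j+\frac{k_j}{|k|}\hat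 f_0$, and $\psi_f,\psi_{\bar f}\in\mathfrak h$. Moreover $\mathfrak h$ is dense in the Hilbert space of all $\alpha_0$-square-integrable $\psi:\mathbb R^3\to\mathbb C^3$ with helicities $\pm1$. **Massive case.** Let $m>0$ and let $\mathcal H$ be generated by the fields $v_\mu,\Phi$ (Bose) and $u,\tilde u$ (Fermi) of mass $m$, with the two-point functions above ($D_m^{(+)}$ in place of $D_0^{(+)}$) and $\langle\Omega,\Phi(x)\Phi(y)\Omega\rangle=-iD_m^{(+)}(x-y)$. There is exactly one linear operator $Q$ on $\mathcal H$ with $$Q\Omega=0,\quad [Q,v_\mu]=i\partial_\mu u,\quad [Q,u]=0,\quad [Q,\tilde u]=-i(\partial_\mu v^\mu+m\Phi),\quad [Q,\Phi]=imu .$$ It satisfies $Q^2=0$. The form is positive semidefinite on $\mathrm{Ker}\,Q$, and its null vectors there are exactly $\mathrm{Ran}\,Q$. Let $\mathfrak h$ be the space of the functions $\psi:\mathbb R^3\to\mathbb C^4$ on the mass shell with $\psi_\mu=\hat f_\mu$ for test functions $f_\mu$ and $p^\mu\psi_\mu=0$, with $\langle\psi,\varphi\rangle=-\int\eta^{\mu\nu}\overline{\psi_\mu}\varphi_\nu\,d\alpha_m$.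 Then there is a linear isomorphism $\Theta:\mathrm{Ker}\,Q/\mathrm{Ran}\,Q\to\mathcal F(\mathfrak h)$ onto the Fock space of particles of mass $m$ and spin $1$ which preserves the scalar products, maps the class of $\Omega$ to the Fock vacuum and, for all test functions $f_\mu,g$ such that $\partial^\mu f_\mu-mg$ has vanishing Fourier transform on the mass shell (both sheets), satisfies: $\int(f_\mu v^\mu+g\Phi)$ leaves $\mathrm{Ker}\,Q$ invariant and $\Theta[\int(f_\mu v^\mu+g\Phi)\Psi]=(a^\dagger(\psi_{f,g})+a(\psi_{\bar f,\bar g}))\Theta[\Psi]$ for $\Psi\in\mathrm{Ker}\,Q$, where $(\psi_{f,g})_\mu$ is the restriction to the mass shell of the Fourier transform of $f_\mu+\frac1m\partial_\mu g$, and $\psi_{f,g},\psi_{\bar f,\bar g}\in\mathfrak h$. Moreover $\mathfrak h$ is dense in the Hilbert space of all measurable $\psi:\mathbb R^3\to\mathbb C^4$ with $p^\mu\psi_\mu=0$ and $-\int\eta^{\mu\nu}\overline{\psi_\mu}\psi_\nu\,d\alpha_m<\infty$. -/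

import Mathlib

open scoped SchwartzMap ComplexConjugate LineDeriv FourierTransform
open MeasureTheory Filter

noncomputable section

namespace GaugeCharge

/-! ### Spaces of words modulo the null vectors of a sesquilinear form

Given an alphabet `α` and a kernel `K : α → α → ℂ`, the free vector space on `α` carries the
sesquilinear form with Gram matrix `K` (antilinear in the first variable). Dividing by its null
vectors gives a space with a nondegenerate sesquilinear form. -/

section GNS

variable {α : Type}

/-- The sesquilinear form `∑ conj (a w) * b w' * K w w'` on the free vector space over `α`. -/
def preForm (K : α → α → ℂ) : (α →₀ ℂ) →ₗ⋆[ℂ] (α →₀ ℂ) →ₗ[ℂ] ℂ :=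
  LinearMap.mk₂'ₛₗ (starRingEnd ℂ) (RingHom.id ℂ)
    (fun a b => a.sum fun w c => conj c * b.sum fun w' d => d * K w w')
    (fun a a' b => by
      apply Finsupp.sum_add_index'
      · intro w; simp
      · intro w c c'; rw [map_add, add_mul])
    (fun c a b => by
      rw [Finsupp.sum_smul_index' (by intro w; simp), Finsupp.smul_sum]
      simp only [smul_eq_mul, map_mul, mul_assoc])
    (fun a b b' => by
      have h : ∀ w, (b + b').sum (fun w' d => d * K w w') =
          b.sum (fun w' d => d * K w w') + b'.sum (fun w' d => d * K w w') := by
        intro w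
        apply Finsupp.sum_add_index'
        · intro w'; simp
        · intro w' c c'; rw [add_mul]
      simp only [h, mul_add, Finsupp.sum_add])
    (fun c a b => by
      have h : ∀ w, (c • b).sum (fun w' d => d * K w w') =
          c * b.sum (fun w' d => d * K w w') := by
        intro w
        rw [Finsupp.sum_smul_index' (by intro w'; simp), Finsupp.mul_sum]
        simp only [smul_eq_mul, mul_assoc]
      simp only [h, RingHom.id_apply, smul_eq_mul, Finsupp.mul_sum]
      exact Finsupp.sum_congr fun w _ => Finsupp.sum_congr fun w' _ => by ring)

theorem preForm_single (K : α → α → ℂ) (w w' : α) (c d : ℂ) :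
    preForm K (Finsupp.single w c) (Finsupp.single w' d) = conj c * (d * K w w') := by
  simp [preForm, LinearMap.mk₂'ₛₗ_apply]

/-- Two linear maps are formally adjoint as soon as they are so on words. -/
theorem preForm_adjoint {K : α → α → ℂ} {S T : (α →₀ ℂ) →ₗ[ℂ] (α →₀ ℂ)}
    (h : ∀ w w', preForm K (S (Finsupp.single w 1)) (Finsupp.single w' 1) =
      preForm K (Finsupp.single w 1) (T (Finsupp.single w' 1))) (a b : α →₀ ℂ) :
    preForm K (S a) b = preForm K a (T b) := by
  have hs : ∀ (w : α) (c : ℂ), Finsupp.single w c = c • Finsupp.single w (1 : ℂ) := by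
    intro w c; simp
  induction a using Finsupp.induction_linear with
  | zero => simp
  | add a a' ha ha' => simp [ha, ha']
  | single w c =>
    induction b using Finsupp.induction_linear with
    | zero => simp
    | add b b' hb hb' => simp only [map_add, hb, hb']
    | single w' d =>
      rw [hs w c, hs w' d]
      simp only [map_smul, map_smulₛₗ, LinearMap.smul_apply, h]

/-- The null vectors of the form. -/
def nullSpace (K : α → α → ℂ) : Submodule ℂ (α →₀ ℂ) where
  carrier := {b | ∀ a, preForm K a b = 0 ∧ preForm K b a = 0}
  zero_mem' := by intro a; simp
  add_mem' := by
    intro b b' hb hb' a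
    simp [(hb a).1, (hb a).2, (hb' a).1, (hb' a).2]
  smul_mem' := by
    intro c b hb a
    simp [(hb a).1, (hb a).2]

/-- The span of the words, modulo the null vectors. -/
abbrev WordSpace (K : α → α → ℂ) : Type := (α →₀ ℂ) ⧸ nullSpace K

/-- The vector given by a word. -/
def WordSpace.word (K : α → α → ℂ) (w : α) : WordSpace K :=
  (nullSpace K).mkQ (Finsupp.single w 1)

/-- The sesquilinear form on the quotient. -/
def WordSpace.form (K : α → α → ℂ) : WordSpace K →ₗ⋆[ℂ] WordSpace K →ₗ[ℂ] ℂ :=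
  (nullSpace K).liftQ
    { toFun := fun a => (nullSpace K).liftQ (preForm K a) (fun _ hb => (hb a).1)
      map_add' := by
        intro a a'
        apply Submodule.linearMap_qext
        apply LinearMap.ext
        intro b
        change preForm K (a + a') b = preForm K a b + preForm K a' b
        rw [map_add, LinearMap.add_apply]
      map_smul' := by
        intro c a
        apply Submodule.linearMap_qext
        apply LinearMap.ext
        intro b
        change preForm K (c • a) b = conj c • preForm K a b
        rw [map_smulₛₗ, LinearMap.smul_apply] }
    (by
      intro a ha
      rw [LinearMap.mem_ker]
      apply Submodule.linearMap_qext
      apply LinearMap.ext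
      intro b
      exact (ha b).2)

/-- A linear map on the free vector space that has a formal adjoint descends to the quotient. -/
def WordSpace.op {K : α → α → ℂ} (S T : (α →₀ ℂ) →ₗ[ℂ] (α →₀ ℂ))
    (h₁ : ∀ a b, preForm K (S a) b = preForm K a (T b))
    (h₂ : ∀ a b, preForm K (T a) b = preForm K a (S b)) : WordSpace K →ₗ[ℂ] WordSpace K :=
  (nullSpace K).mapQ (nullSpace K) S (by
    intro b hb a
    exact ⟨by rw [← h₂]; exact (hb _).1, by rw [h₁]; exact (hb _).2⟩)

end GNS

/-! ### Free fields with Bose or Fermi statistics, from their two-point functions -/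

/-- The data of a family of free fields: the smeared field symbols, their statistics, the
conjugation `†`, and the vacuum two-point function `⟨Ω, x y Ω⟩`. -/
structure FreeFields where
  Sym : Type
  odd : Sym → Bool
  adj : Sym → Sym
  adj_adj : ∀ x, adj (adj x) = x
  twoPoint : Sym → Sym → ℂ

namespace FreeFields

variable (F : FreeFields)

/-- The `n`-point function `⟨Ω, x₁ ⋯ xₙ Ω⟩` given by the Wick theorem: the first field is contracted
with each of the other ones, with the sign from moving the partner past the fields in between. -/
def wick : List F.Sym → ℂ
  | [] => 1
  | x :: w => ∑ i : Fin w.length,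
      (if F.odd x then (-1 : ℂ) ^ ((w.take i).countP F.odd) else 1) *
        F.twoPoint x w[i] * wick (w.eraseIdx i)
termination_by w => w.length
decreasing_by
  have := i.isLt
  simp [List.length_eraseIdx]

/-- `⟨x₁ ⋯ xₙ Ω, y₁ ⋯ yₘ Ω⟩ = ⟨Ω, xₙ† ⋯ x₁† y₁ ⋯ yₘ Ω⟩`. -/
def wordKernel (w w' : List F.Sym) : ℂ := F.wick ((w.map F.adj).reverse ++ w')

/-- The space of Fock type generated by the fields: it is spanned by the vectors `x₁ ⋯ xₙ Ω`, which
are identified when they have the same scalar products with all such vectors. -/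
abbrev Space : Type := WordSpace F.wordKernel

/-- The sesquilinear form of `F.Space`. -/
def form : F.Space →ₗ⋆[ℂ] F.Space →ₗ[ℂ] ℂ := WordSpace.form F.wordKernel

/-- The vacuum `Ω`. -/
def vacuum : F.Space := WordSpace.word F.wordKernel []

/-- Left multiplication of words by a symbol. -/
def cons {S : Type} (x : S) : (List S →₀ ℂ) →ₗ[ℂ] (List S →₀ ℂ) :=
  Finsupp.lmapDomain ℂ ℂ (fun w => x :: w)

theorem cons_adjoint (x : F.Sym) (a b : List F.Sym →₀ ℂ) :
    preForm F.wordKernel (cons x a) b = preForm F.wordKernel a (cons (F.adj x) b) := by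
  apply preForm_adjoint
  intro w w'
  simp [cons, preForm_single, wordKernel]

/-- The field operator: `x · (x₁ ⋯ xₙ Ω) = x x₁ ⋯ xₙ Ω`. -/
def op (x : F.Sym) : F.Space →ₗ[ℂ] F.Space :=
  WordSpace.op (cons x) (cons (F.adj x)) (F.cons_adjoint x) (by
    intro a b
    rw [F.cons_adjoint, F.adj_adj])

end FreeFields

/-! ### The Bose Fock space over a one-particle space -/

/-- A one-particle space, presented by its wave functions and their scalar products. -/
structure OneParticle where
  Wave : Type
  inner : Wave → Wave → ℂ
  conj_inner : ∀ ψ φ, conj (inner ψ φ) = inner φ ψ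

namespace OneParticle

variable (P : OneParticle)

/-- The scalar product of `ψ₁ ∨ ⋯ ∨ ψₙ` and `φ₁ ∨ ⋯ ∨ φₘ`: it is `0` for `n ≠ m`, and the permanent
`∑ σ, ∏ i, ⟨ψᵢ, φ_σ(i)⟩` for `n = m` (here expanded along the first row). -/
def permKernel : List P.Wave → List P.Wave → ℂ
  | [], [] => 1
  | [], _ :: _ => 0
  | ψ :: w, w' => ∑ i : Fin w'.length, P.inner ψ w'[i] * permKernel w (w'.eraseIdx i)

/-- The (algebraic) symmetric Fock space: the span of the symmetric products `ψ₁ ∨ ⋯ ∨ ψₙ`,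
determined by their scalar products. -/
abbrev Fock : Type := WordSpace P.permKernel

/-- The scalar product of the Fock space. -/
def form : P.Fock →ₗ⋆[ℂ] P.Fock →ₗ[ℂ] ℂ := WordSpace.form P.permKernel

/-- The Fock vacuum. -/
def vacuum : P.Fock := WordSpace.word P.permKernel []

/-- `ψ₁ ∨ ⋯ ∨ ψₙ ↦ ∑ i, ⟨ψ, ψᵢ⟩ ψ₁ ∨ ⋯ ∨ ψ̂ᵢ ∨ ⋯ ∨ ψₙ`. -/
def preAnnihilate (ψ : P.Wave) : (List P.Wave →₀ ℂ) →ₗ[ℂ] (List P.Wave →₀ ℂ) :=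
  Finsupp.linearCombination ℂ fun w =>
    ∑ i : Fin w.length, Finsupp.single (w.eraseIdx i) (P.inner ψ w[i])

/-- Expansion of the permanent along the first column. -/
theorem permKernel_cons (φ : P.Wave) : ∀ w w' : List P.Wave, P.permKernel w (φ :: w') =
    ∑ i : Fin w.length, P.inner w[i] φ * P.permKernel (w.eraseIdx i) w' := by
  intro w
  induction w with
  | nil => intro w'; simp [permKernel]
  | cons ψ w ih =>
    intro w'
    have e1 : P.permKernel (ψ :: w) (φ :: w') = P.inner ψ φ * P.permKernel w w' +
        ∑ i : Fin w'.length, P.inner ψ w'[i] * P.permKernel w (φ :: w'.eraseIdx i) := by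
      rw [permKernel]
      exact (Fin.sum_univ_succ (n := w'.length) _).trans (by simp)
    have e2 : ∑ i : Fin (ψ :: w).length, P.inner (ψ :: w)[i] φ *
        P.permKernel ((ψ :: w).eraseIdx i) w' = P.inner ψ φ * P.permKernel w w' +
        ∑ i : Fin w.length, P.inner w[i] φ * P.permKernel (ψ :: w.eraseIdx i) w' :=
      (Fin.sum_univ_succ (n := w.length) _).trans (by simp)
    rw [e1, e2]
    congr 1
    simp only [ih, permKernel, Finset.mul_sum]
    rw [Finset.sum_comm]
    refine Finset.sum_congr rfl fun i _ => Finset.sum_congr rfl fun j _ => ?_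
    ring

theorem annihilate_adjoint (ψ : P.Wave) (a b : List P.Wave →₀ ℂ) :
    preForm P.permKernel (P.preAnnihilate ψ a) b =
      preForm P.permKernel a (FreeFields.cons ψ b) := by
  apply preForm_adjoint
  intro w w'
  simp [FreeFields.cons, preAnnihilate, preForm_single, permKernel_cons, P.conj_inner]

theorem create_adjoint (ψ : P.Wave) (a b : List P.Wave →₀ ℂ) :
    preForm P.permKernel (FreeFields.cons ψ a) b =
      preForm P.permKernel a (P.preAnnihilate ψ b) := by
  apply preForm_adjoint
  intro w w'
  simp [FreeFields.cons, preAnnihilate, preForm_single, permKernel]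

/-- The creation operator `a†(ψ)`. -/
def create (ψ : P.Wave) : P.Fock →ₗ[ℂ] P.Fock :=
  WordSpace.op (FreeFields.cons ψ) (P.preAnnihilate ψ) (P.create_adjoint ψ)
    (P.annihilate_adjoint ψ)

/-- The annihilation operator `a(ψ)`, antilinear in `ψ`. -/
def annihilate (ψ : P.Wave) : P.Fock →ₗ[ℂ] P.Fock :=
  WordSpace.op (P.preAnnihilate ψ) (FreeFields.cons ψ) (P.annihilate_adjoint ψ)
    (P.create_adjoint ψ)

end OneParticle

/-! ### Test functions, mass shells and the Pauli-Villars distribution -/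

/-- Space-time `ℝ⁴`, with `x 0` the time. -/
abbrev Spacetime : Type := EuclideanSpace ℝ (Fin 4)

/-- The space of spatial momenta `ℝ³`. -/
abbrev Momentum : Type := EuclideanSpace ℝ (Fin 3)

/-- Complex Schwartz functions on space-time. -/
abbrev TestFun : Type := 𝓢(Spacetime, ℂ)

/-- The diagonal `1, -1, -1, -1` of the Minkowski metric. -/
def eta (μ : Fin 4) : ℝ := if μ = 0 then 1 else -1

/-- The partial derivative `∂_μ f = ∂f / ∂x^μ`. -/
def partialD (μ : Fin 4) (f : TestFun) : TestFun := ∂_{EuclideanSpace.single μ (1 : ℝ)} f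

/-- The complex conjugate test function. -/
def conjTest (f : TestFun) : TestFun :=
  SchwartzMap.postcompCLM (𝕜 := ℝ) (Complex.conjCLE : ℂ →L[ℝ] ℂ) f

theorem conjTest_apply (f : TestFun) (x : Spacetime) : conjTest f x = conj (f x) := rfl

theorem conjTest_conjTest (f : TestFun) : conjTest (conjTest f) = f := by
  ext x; simp [conjTest_apply]

theorem conjTest_neg (f : TestFun) : conjTest (-f) = -conjTest f := by
  ext x; simp [conjTest_apply]

/-- `ω(k) = √(m² + |k|²)`. -/
def energy (m : ℝ) (k : Momentum) : ℝ := √(m ^ 2 + ‖k‖ ^ 2)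

/-- The contravariant components `p^μ = (ω(k), k)` of the momentum on the upper mass shell. -/
def shellPoint (m : ℝ) (k : Momentum) : Fin 4 → ℝ := Fin.cons (energy m k) fun j => k j

/-- The Minkowski product `p · x` of `p = (ω(k), k)` with `x`. -/
def shellDot (m : ℝ) (k : Momentum) (x : Spacetime) : ℝ := ∑ μ, eta μ * shellPoint m k μ * x μ

/-- The Fourier transform `∫ e^{i p·x} f(x) d⁴x` on the upper mass shell. -/
def posFT (m : ℝ) (f : TestFun) (k : Momentum) : ℂ :=
  ∫ x : Spacetime, Complex.exp (Complex.I * (shellDot m k x : ℂ)) * f x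

/-- The Fourier transform `∫ e^{-i p·x} f(x) d⁴x` on the lower mass shell. -/
def negFT (m : ℝ) (f : TestFun) (k : Momentum) : ℂ :=
  ∫ x : Spacetime, Complex.exp (-(Complex.I * (shellDot m k x : ℂ))) * f x

/-- `f` vanishes on both mass shells, that is, it smears every solution of the wave equation
(Klein-Gordon equation) of mass `m` to zero. -/
def VanishesOnShell (m : ℝ) (f : TestFun) : Prop :=
  ∀ k, posFT m f k = 0 ∧ negFT m f k = 0

/-- The invariant measure `(2π)⁻³ d³k / (2 ω(k))` on the upper mass shell. -/
def shellMeasure (m : ℝ) : Measure Momentum :=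
  volume.withDensity fun k => ENNReal.ofReal (((2 * Real.pi) ^ 3)⁻¹ / (2 * energy m k))

/-- The smeared positive frequency part of the Pauli-Villars distribution of mass `m`,
`∫∫ f(x) D_m⁽⁺⁾(x - y) g(y) d⁴x d⁴y`, with
`D_m⁽⁺⁾(x) = i (2π)⁻³ ∫ e^{-i p·x} d³k / (2 ω(k))`. -/
def pauliVillarsPos (m : ℝ) (f g : TestFun) : ℂ :=
  Complex.I * ∫ k, negFT m f k * posFT m g k ∂(shellMeasure m)

/-- A space of test functions stable under derivatives and complex conjugation. -/
structure TestSpace where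
  carrier : Submodule ℂ TestFun
  partial_mem : ∀ μ, ∀ f ∈ carrier, partialD μ f ∈ carrier
  conj_mem : ∀ f ∈ carrier, conjTest f ∈ carrier

/-- All Schwartz test functions. -/
def allTest : TestSpace where
  carrier := ⊤
  partial_mem := fun _ _ _ => trivial
  conj_mem := fun _ _ => trivial

theorem fourier_conjTest (f : TestFun) (ξ : Spacetime) :
    𝓕 (conjTest f) ξ = conj (𝓕 f (-ξ)) := by
  rw [SchwartzMap.fourier_coe, SchwartzMap.fourier_coe, Real.fourier_eq, Real.fourier_eq,
    ← integral_conj]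
  congr 1
  ext x
  simp [conjTest_apply, Circle.smul_def, Real.fourierChar_apply, ← Complex.exp_conj,
    Complex.conj_ofNat]

/-- The Schwartz test functions whose Fourier transform vanishes near the point `p = 0`. -/
def infraredTest : TestSpace where
  carrier :=
    { carrier := {f | ∀ᶠ ξ in nhds (0 : Spacetime), 𝓕 f ξ = 0}
      zero_mem' := by simp [FourierTransform.fourier_zero]
      add_mem' := by
        intro f g hf hg
        filter_upwards [hf, hg] with ξ h h'
        simp [FourierTransform.fourier_add, h, h']
      smul_mem' := by
        intro c f hf
        filter_upwards [hf] with ξ h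
        simp [FourierTransform.fourier_smul, h] }
  partial_mem := by
    intro μ f hf
    filter_upwards [hf] with ξ h
    rw [partialD, SchwartzMap.fourier_lineDerivOp_eq]
    have hg : (fun x : Spacetime => inner ℝ x (EuclideanSpace.single μ (1 : ℝ))).HasTemperateGrowth := by
      fun_prop
    simp only [smul_apply]
    rw [SchwartzMap.smulLeftCLM_apply_apply hg, h, smul_zero, smul_zero]
  conj_mem := by
    intro f hf
    have h : Tendsto (fun ξ : Spacetime => -ξ) (nhds 0) (nhds 0) := by
      simpa using (continuous_neg (G := Spacetime)).tendsto 0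
    filter_upwards [h.eventually hf] with ξ hξ
    rw [fourier_conjTest, hξ, map_zero]

namespace TestSpace

variable (T : TestSpace)

/-- The test functions belonging to `T`. -/
abbrev Fun : Type := T.carrier

/-- `∂_μ` on `T`. -/
def pd (μ : Fin 4) (f : T.Fun) : T.Fun := ⟨partialD μ f, T.partial_mem μ f f.2⟩

/-- Complex conjugation on `T`. -/
def bar (f : T.Fun) : T.Fun := ⟨conjTest f, T.conj_mem f f.2⟩

theorem bar_bar (f : T.Fun) : T.bar (T.bar f) = f := Subtype.ext (conjTest_conjTest f)

theorem bar_neg (f : T.Fun) : T.bar (-f) = -T.bar f := Subtype.ext (conjTest_neg f)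

/-- The divergence `∂^μ f_μ` of a covector-valued test function. -/
def div (f : Fin 4 → T.Fun) : T.Fun := ∑ μ, (eta μ : ℂ) • T.pd μ (f μ)

end TestSpace

/-! ### The massless fields `v_μ, u, ũ` -/

/-- The smeared massless fields `v_μ(f)`, `u(f)`, `ũ(f)`. -/
inductive MasslessSym : Type
  | v (μ : Fin 4) (f : infraredTest.Fun)
  | u (f : infraredTest.Fun)
  | uTilde (f : infraredTest.Fun)

/-- The massless fields: `v_μ` Bose, `u` and `ũ` Fermi; `v_μ† = v_μ`, `u† = u`, `ũ† = -ũ`;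
`⟨Ω, v_μ v_ν Ω⟩ = i η_{μν} D⁽⁺⁾` and `⟨Ω, u ũ Ω⟩ = -i D⁽⁺⁾`, hence `⟨Ω, ũ u Ω⟩ = i D⁽⁺⁾`
by hermiticity (equivalently, from the anticommutator `[u(x), ũ(y)] = -i D(x - y)`). -/
def massless : FreeFields where
  Sym := MasslessSym
  odd
    | .v _ _ => false
    | .u _ => true
    | .uTilde _ => true
  adj
    | .v μ f => .v μ (infraredTest.bar f)
    | .u f => .u (infraredTest.bar f)
    | .uTilde f => .uTilde (-infraredTest.bar f)
  adj_adj := by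
    rintro (⟨μ, f⟩ | f | f) <;> simp [TestSpace.bar_bar, TestSpace.bar_neg]
  twoPoint
    | .v μ f, .v ν g => if μ = ν then Complex.I * (eta μ : ℂ) * pauliVillarsPos 0 f g else 0
    | .u f, .uTilde g => -Complex.I * pauliVillarsPos 0 f g
    | .uTilde f, .u g => Complex.I * pauliVillarsPos 0 f g
    | _, _ => 0

namespace Massless

/-- The space `𝓗` generated by `v_μ, u, ũ` out of the vacuum. -/
abbrev H : Type := massless.Space

/-- The operator `v_μ(f)`. -/
def v (μ : Fin 4) (f : infraredTest.Fun) : H →ₗ[ℂ] H := massless.op (MasslessSym.v μ f)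

/-- The operator `u(f)`. -/
def u (f : infraredTest.Fun) : H →ₗ[ℂ] H := massless.op (MasslessSym.u f)

/-- The operator `ũ(f)`. -/
def uTilde (f : infraredTest.Fun) : H →ₗ[ℂ] H := massless.op (MasslessSym.uTilde f)

/-- The operator `∫ f_μ(x) v^μ(x)`. -/
def vSmeared (f : Fin 4 → infraredTest.Fun) : H →ₗ[ℂ] H := ∑ μ, (eta μ : ℂ) • v μ (f μ)

/-- The operator `(∂_μ u)(f) = -u(∂_μ f)`. -/
def du (μ : Fin 4) (f : infraredTest.Fun) : H →ₗ[ℂ] H := -u (infraredTest.pd μ f)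

/-- The operator `(∂_μ v^μ)(f) = -∑ η^{μμ} v_μ(∂_μ f)`. -/
def divV (f : infraredTest.Fun) : H →ₗ[ℂ] H :=
  -∑ μ, (eta μ : ℂ) • v μ (infraredTest.pd μ f)

/-- The defining relations of the gauge charge: `Q Ω = 0` and
`[Q, v_μ] = i ∂_μ u`, `[Q, u] = 0`, `[Q, ũ] = -i ∂_μ v^μ` (graded commutators). -/
structure IsGaugeCharge (Q : H →ₗ[ℂ] H) : Prop where
  vacuum : Q massless.vacuum = 0
  comm_v : ∀ μ f, Q ∘ₗ v μ f - v μ f ∘ₗ Q = Complex.I • du μ f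
  comm_u : ∀ f, Q ∘ₗ u f + u f ∘ₗ Q = 0
  comm_uTilde : ∀ f, Q ∘ₗ uTilde f + uTilde f ∘ₗ Q = -Complex.I • divV f

end Massless

/-! ### Photons: mass zero and helicity `±1` -/

/-- The helicity operator `S · k / |k|` on vector wave functions: `ψ(k) ↦ i (k / |k|) × ψ(k)`. -/
def helicityOp (ψ : Momentum → Fin 3 → ℂ) : Momentum → Fin 3 → ℂ := fun k =>
  Complex.I • crossProduct (fun j => ((k j / ‖k‖ : ℝ) : ℂ)) (ψ k)

/-- Only the helicities `±1` occur in `ψ` (equivalently, `ψ(k) ⟂ k`). -/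
def HasHelicityOne (ψ : Momentum → Fin 3 → ℂ) : Prop := helicityOp (helicityOp ψ) = ψ

/-- The density of the scalar product of vector wave functions. -/
def vecInner (ψ φ : Momentum → Fin 3 → ℂ) (k : Momentum) : ℂ := ∑ j, conj (ψ k j) * φ k j

/-- The one-particle space of the photon: wave functions `ψ : ℝ³ → ℂ³` on the light cone of
helicity `±1`, given on the cone by test functions, with the scalar product
`∫ ∑ j, conj (ψ_j) φ_j` with respect to the invariant measure. -/
def photon : OneParticle where
  Wave := {ψ : Momentum → Fin 3 → ℂ // HasHelicityOne ψ ∧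
    ∃ f : Fin 3 → infraredTest.Fun, ∀ k j, ψ k j = posFT 0 (f j) k}
  inner ψ φ := ∫ k, vecInner ψ.1 φ.1 k ∂(shellMeasure 0)
  conj_inner ψ φ := by
    rw [← integral_conj]
    simp [vecInner, mul_comm]

/-- `ψ` is the representative with zero time component (radiation gauge) of the restriction of the
covector `f_μ` to the light cone: `ψ_j = f_j + k_j f_0 / |k| = f_j - p_j f_0 / p_0`. -/
def IsRadiationPart (f : Fin 4 → infraredTest.Fun) (ψ : photon.Wave) : Prop :=
  ∀ k j, ψ.1 k j = posFT 0 (f j.succ) k + (k j / ‖k‖ : ℝ) * posFT 0 (f 0) k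

/-! ### The massive fields `v_μ, u, ũ, Φ` -/

/-- The smeared massive fields `v_μ(f)`, `u(f)`, `ũ(f)`, `Φ(f)`. -/
inductive MassiveSym : Type
  | v (μ : Fin 4) (f : allTest.Fun)
  | u (f : allTest.Fun)
  | uTilde (f : allTest.Fun)
  | Phi (f : allTest.Fun)

/-- The massive fields: `v_μ` and `Φ` Bose, `u` and `ũ` Fermi; `v_μ† = v_μ`, `u† = u`, `ũ† = -ũ`,
`Φ† = Φ`; `⟨Ω, v_μ v_ν Ω⟩ = i η_{μν} D⁽⁺⁾`, `⟨Ω, u ũ Ω⟩ = -i D⁽⁺⁾` (hence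
`⟨Ω, ũ u Ω⟩ = i D⁽⁺⁾`), and `⟨Ω, Φ Φ Ω⟩ = -i D⁽⁺⁾`. -/
def massive (m : ℝ) : FreeFields where
  Sym := MassiveSym
  odd
    | .v _ _ => false
    | .u _ => true
    | .uTilde _ => true
    | .Phi _ => false
  adj
    | .v μ f => .v μ (allTest.bar f)
    | .u f => .u (allTest.bar f)
    | .uTilde f => .uTilde (-allTest.bar f)
    | .Phi f => .Phi (allTest.bar f)
  adj_adj := by
    rintro (⟨μ, f⟩ | f | f | f) <;> simp [TestSpace.bar_bar, TestSpace.bar_neg]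
  twoPoint
    | .v μ f, .v ν g => if μ = ν then Complex.I * (eta μ : ℂ) * pauliVillarsPos m f g else 0
    | .u f, .uTilde g => -Complex.I * pauliVillarsPos m f g
    | .uTilde f, .u g => Complex.I * pauliVillarsPos m f g
    | .Phi f, .Phi g => -Complex.I * pauliVillarsPos m f g
    | _, _ => 0

namespace Massive

variable (m : ℝ)

/-- The space `𝓗` generated by `v_μ, u, ũ, Φ` out of the vacuum. -/
abbrev H : Type := (massive m).Space

/-- The operator `v_μ(f)`. -/
def v (μ : Fin 4) (f : allTest.Fun) : H m →ₗ[ℂ] H m := (massive m).op (MassiveSym.v μ f)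

/-- The operator `u(f)`. -/
def u (f : allTest.Fun) : H m →ₗ[ℂ] H m := (massive m).op (MassiveSym.u f)

/-- The operator `ũ(f)`. -/
def uTilde (f : allTest.Fun) : H m →ₗ[ℂ] H m := (massive m).op (MassiveSym.uTilde f)

/-- The operator `Φ(f)`. -/
def Phi (f : allTest.Fun) : H m →ₗ[ℂ] H m := (massive m).op (MassiveSym.Phi f)

/-- The operator `∫ f_μ(x) v^μ(x)`. -/
def vSmeared (f : Fin 4 → allTest.Fun) : H m →ₗ[ℂ] H m := ∑ μ, (eta μ : ℂ) • v m μ (f μ)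

/-- The operator `(∂_μ u)(f) = -u(∂_μ f)`. -/
def du (μ : Fin 4) (f : allTest.Fun) : H m →ₗ[ℂ] H m := -u m (allTest.pd μ f)

/-- The operator `(∂_μ v^μ)(f) = -∑ η^{μμ} v_μ(∂_μ f)`. -/
def divV (f : allTest.Fun) : H m →ₗ[ℂ] H m :=
  -∑ μ, (eta μ : ℂ) • v m μ (allTest.pd μ f)

/-- The defining relations of the gauge charge: `Q Ω = 0` and `[Q, v_μ] = i ∂_μ u`, `[Q, u] = 0`,
`[Q, ũ] = -i (∂_μ v^μ + m Φ)`, `[Q, Φ] = i m u` (graded commutators). -/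
structure IsGaugeCharge (Q : H m →ₗ[ℂ] H m) : Prop where
  vacuum : Q (massive m).vacuum = 0
  comm_v : ∀ μ f, Q ∘ₗ v m μ f - v m μ f ∘ₗ Q = Complex.I • du m μ f
  comm_u : ∀ f, Q ∘ₗ u m f + u m f ∘ₗ Q = 0
  comm_uTilde : ∀ f, Q ∘ₗ uTilde m f + uTilde m f ∘ₗ Q =
    -Complex.I • (divV m f + (m : ℂ) • Phi m f)
  comm_Phi : ∀ f, Q ∘ₗ Phi m f - Phi m f ∘ₗ Q = (Complex.I * (m : ℂ)) • u m f

end Massive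

/-! ### Massive particles of spin one -/

/-- The transversality condition `p^μ ψ_μ(p) = 0` on the mass shell: in the rest frame
`p = (m, 0, 0, 0)` only the three spatial components, of spin one, remain. -/
def IsTransverse (m : ℝ) (ψ : Momentum → Fin 4 → ℂ) : Prop :=
  ∀ k, ∑ μ, (shellPoint m k μ : ℂ) * ψ k μ = 0

/-- The density `-η^{μν} conj (ψ_μ) φ_ν` of the invariant scalar product. -/
def minkInner (ψ φ : Momentum → Fin 4 → ℂ) (k : Momentum) : ℂ :=
  -∑ μ, (eta μ : ℂ) * (conj (ψ k μ) * φ k μ)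

/-- The one-particle space of mass `m` and spin one: transverse covector wave functions on the mass
shell, given there by test functions, with the scalar product `∫ -η^{μν} conj (ψ_μ) φ_ν`
with respect to the invariant measure. -/
def spinOne (m : ℝ) : OneParticle where
  Wave := {ψ : Momentum → Fin 4 → ℂ // IsTransverse m ψ ∧
    ∃ f : Fin 4 → allTest.Fun, ∀ k μ, ψ k μ = posFT m (f μ) k}
  inner ψ φ := ∫ k, minkInner ψ.1 φ.1 k ∂(shellMeasure m)
  conj_inner ψ φ := by
    rw [← integral_conj]
    simp [minkInner, mul_comm]

/-- `ψ` is the restriction of the covector `f_μ + ∂_μ h / m` to the mass shell. -/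
def IsUnitaryPart (m : ℝ) (f : Fin 4 → allTest.Fun) (h : allTest.Fun)
    (ψ : (spinOne m).Wave) : Prop :=
  ∀ k μ, ψ.1 k μ =
    posFT m ((f μ + (m : ℂ)⁻¹ • allTest.pd μ h : allTest.Fun) : TestFun) k

/-- The cohomology `Ker Q / Ran Q` (`Ran Q` is intersected with `Ker Q`, in which it is contained
when `Q² = 0`). -/
abbrev Cohomology {V : Type} [AddCommGroup V] [Module ℂ V] (Q : V →ₗ[ℂ] V) : Type :=
  LinearMap.ker Q ⧸ (LinearMap.range Q).submoduleOf (LinearMap.ker Q)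

/-- The class in `Ker Q / Ran Q` of an element of `Ker Q`. -/
def cls {V : Type} [AddCommGroup V] [Module ℂ V] (Q : V →ₗ[ℂ] V) (Ψ : LinearMap.ker Q) :
    Cohomology Q :=
  ((LinearMap.range Q).submoduleOf (LinearMap.ker Q)).mkQ Ψ

end GaugeCharge

end

open scoped SchwartzMap ComplexConjugate LineDeriv FourierTransform
open MeasureTheory Filter

noncomputable section

namespace GaugeCharge

/-! ### Generalities on spaces of words -/

section Words

variable {α β : Type}

/-! The theorem is the quartet mechanism (Kugo–Ojima), carried out algebraically. The field space is
identified with a Fock space over "letters": multiplets of test functions for the Bose fields, pairs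
of test functions for the ghosts, with an indefinite, parity-preserving scalar product on the mass
shell. Letters are mere labels; a linear relation between them means an equality of all their scalar
products, which is enough for creation and annihilation operators (`create_combination`,
`annihilate_combination`). A field acts as a†(x) + a(x†), Wick's theorem becomes the computation of
its vacuum expectation values (`form_vacuum_vec`), and cyclicity of the vacuum (`range_preMap`)
gives the isometry `Represents.equiv`.

In this picture the prescribed commutators say exactly that Q is the second quantization of an odd
one-particle operator q (`isGaugeCharge_iff`). This gives existence and uniqueness, and Q is
symmetric because q is. The operator q sends the second ghost to the Bose multiplet along a gauge
direction e, and a Bose multiplet to the first ghost through its pairing with e. Here e is the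
momentum p in the massless case and (p, -im) in the massive case. It is a null vector of the Bose
form on the shell, whence q² = 0 and Q² = 0. A conjugate null direction l with ⟨e, l⟩ = 1 gives a
homotopy r of the same kind. The anticommutator qr + rq is the projection onto the span of e, l and
both ghosts, and it vanishes on the physical states, which are orthogonal to e and l: helicities ±1,
respectively spin 1.

After second quantization N = QR + RQ counts the unphysical particles. On vectors with a positive
number of them N is invertible and commutes with Q, so closed vectors there are exact. Hence Ker Q
is the physical Fock space plus Ran Q (`ker_charge`). Since Q is symmetric with square zero, Ran Q
is orthogonal to Ker Q, and the form on Ker Q is that of the physical Fock space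
(`form_decomposition`). That form is positive definite: the one-particle product is an integral of
squares of amplitudes, and removing one particle reduces positivity to words of smaller length
(`preForm_lower`). A gauge invariant field creates a letter orthogonal to e, which differs from a
physical letter by a q-exact one; this gives its action on the cohomology (`iso_field`).

The analytic input is that restrictions of test functions to the shell are square integrable, that
1/|k|² acts on the infrared-regular test functions, and that smooth functions with compact support
away from k = 0 are such restrictions. The last fact yields density, after a pointwise projection
(massless) or a pointwise boost to the rest frame (massive). -/

theorem words_ext {M : Type*} [AddCommMonoid M] [Module ℂ M] {S T : (α →₀ ℂ) →ₗ[ℂ] M}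
    (h : ∀ w, S (Finsupp.single w 1) = T (Finsupp.single w 1)) : S = T := by
  apply Finsupp.lhom_ext'
  intro w
  apply LinearMap.ext_ring
  exact h w

theorem preForm_conj {K : α → α → ℂ} (hK : ∀ w w', conj (K w w') = K w' w) (a b : α →₀ ℂ) :
    conj (preForm K a b) = preForm K b a := by
  have hs : ∀ (w : α) (c : ℂ), Finsupp.single w c = c • Finsupp.single w (1 : ℂ) := by
    intro w c; simp
  induction a using Finsupp.induction_linear with
  | zero => simp
  | add a a' ha ha' => simp [ha, ha']
  | single w c =>
    induction b using Finsupp.induction_linear with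
    | zero => simp
    | add b b' hb hb' => simp only [map_add, hb, hb', LinearMap.add_apply]
    | single w' d =>
      simp only [preForm_single, map_mul, hK, Complex.conj_conj]
      ring

theorem preForm_left_eq_zero {K : α → α → ℂ} {b : α →₀ ℂ}
    (h : ∀ w, preForm K (Finsupp.single w 1) b = 0) (a : α →₀ ℂ) : preForm K a b = 0 := by
  induction a using Finsupp.induction_linear with
  | zero => simp
  | add a a' ha ha' => simp [ha, ha']
  | single w c =>
    have : Finsupp.single w c = c • Finsupp.single w (1 : ℂ) := by simp
    rw [this, map_smulₛₗ, LinearMap.smul_apply, h, smul_zero]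

/-- The definition of `nullSpace` asks for orthogonality on both sides; for a hermitian kernel one
side, tested on words, suffices. -/
theorem mem_nullSpace_of_left {K : α → α → ℂ} (hK : ∀ w w', conj (K w w') = K w' w)
    {b : α →₀ ℂ} (h : ∀ w, preForm K (Finsupp.single w 1) b = 0) : b ∈ nullSpace K := by
  intro a
  have h' := preForm_left_eq_zero h a
  exact ⟨h', by rw [← preForm_conj hK, h', map_zero]⟩

theorem WordSpace.op_mk {K : α → α → ℂ} (S T : (α →₀ ℂ) →ₗ[ℂ] (α →₀ ℂ)) (h₁ h₂) (a : α →₀ ℂ) :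
    WordSpace.op (K := K) S T h₁ h₂ ((nullSpace K).mkQ a) = (nullSpace K).mkQ (S a) := rfl

theorem WordSpace.form_conj {K : α → α → ℂ} (hK : ∀ w w', conj (K w w') = K w' w)
    (Ψ Φ : WordSpace K) : conj (WordSpace.form K Ψ Φ) = WordSpace.form K Φ Ψ := by
  obtain ⟨a, rfl⟩ := (nullSpace K).mkQ_surjective Ψ
  obtain ⟨b, rfl⟩ := (nullSpace K).mkQ_surjective Φ
  exact preForm_conj hK a b

theorem WordSpace.eq_zero_of_form {K : α → α → ℂ} (hK : ∀ w w', conj (K w w') = K w' w)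
    {Ψ : WordSpace K} (h : ∀ Φ, WordSpace.form K Φ Ψ = 0) : Ψ = 0 := by
  obtain ⟨b, rfl⟩ := (nullSpace K).mkQ_surjective Ψ
  rw [Submodule.mkQ_apply, Submodule.Quotient.mk_eq_zero]
  exact mem_nullSpace_of_left hK fun w => h ((nullSpace K).mkQ (Finsupp.single w 1))

theorem WordSpace.eq_of_form {K : α → α → ℂ} (hK : ∀ w w', conj (K w w') = K w' w)
    {Ψ Ψ' : WordSpace K} (h : ∀ Φ, WordSpace.form K Φ Ψ = WordSpace.form K Φ Ψ') : Ψ = Ψ' := by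
  rw [← sub_eq_zero]
  refine WordSpace.eq_zero_of_form hK fun Φ => ?_
  rw [map_sub, h, sub_self]

theorem WordSpace.form_op {K : α → α → ℂ} (S T : (α →₀ ℂ) →ₗ[ℂ] (α →₀ ℂ)) (h₁ h₂)
    (Ψ Φ : WordSpace K) : WordSpace.form K (WordSpace.op S T h₁ h₂ Ψ) Φ =
      WordSpace.form K Ψ (WordSpace.op T S h₂ h₁ Φ) := by
  obtain ⟨a, rfl⟩ := (nullSpace K).mkQ_surjective Ψ
  obtain ⟨b, rfl⟩ := (nullSpace K).mkQ_surjective Φ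
  exact h₁ a b

/-- A submodule containing all words is everything. -/
theorem WordSpace.eq_top_of_word {K : α → α → ℂ} {S : Submodule ℂ (WordSpace K)}
    (h : ∀ w, WordSpace.word K w ∈ S) : S = ⊤ := by
  rw [eq_top_iff]
  rintro Ψ -
  obtain ⟨b, rfl⟩ := (nullSpace K).mkQ_surjective Ψ
  induction b using Finsupp.induction_linear with
  | zero => simp
  | add a b ha hb => rw [map_add]; exact S.add_mem ha hb
  | single w c =>
    have : Finsupp.single w c = c • Finsupp.single w (1 : ℂ) := by simp
    rw [this, map_smul]
    exact S.smul_mem c (h w)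

end Words

@[simp]
theorem cons_single {S : Type} (x : S) (w : List S) (c : ℂ) :
    FreeFields.cons x (Finsupp.single w c) = Finsupp.single (x :: w) c := by
  simp [FreeFields.cons]

theorem cons_apply_nil {S : Type} (x : S) (a : List S →₀ ℂ) : FreeFields.cons x a [] = 0 := by
  have : (Finsupp.lapply [] : (List S →₀ ℂ) →ₗ[ℂ] ℂ) ∘ₗ FreeFields.cons x = 0 :=
    words_ext fun w => by simp
  exact LinearMap.congr_fun this a

/-! ### The Fock space over one-particle letters with Bose or Fermi statistics -/

/-- One-particle states with their parity and their hermitian scalar products. -/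
structure Letters where
  L : Type
  odd : L → Bool
  inner : L → L → ℂ
  conj_inner : ∀ x y, conj (inner x y) = inner y x
  inner_eq_zero : ∀ x y, odd x ≠ odd y → inner x y = 0

/-- The sign from moving an object of parity `b` past another odd one. -/
def oddSign (b : Bool) : ℂ := if b then -1 else 1

/-- The sign from exchanging two objects. -/
def swapSign (a b : Bool) : ℂ := if a then oddSign b else 1

namespace Letters

open FreeFields (cons)

variable (A : Letters)

/-- The signed contraction of `x` with a word. -/
def annWord (x : A.L) : List A.L → (List A.L →₀ ℂ)
  | [] => 0
  | y :: w => Finsupp.single w (A.inner x y) +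
      swapSign (A.odd x) (A.odd y) • cons y (annWord x w)

/-- The annihilation operator on the free space over the words. -/
def preAnn (x : A.L) : (List A.L →₀ ℂ) →ₗ[ℂ] (List A.L →₀ ℂ) :=
  Finsupp.linearCombination ℂ (A.annWord x)

theorem preAnn_nil (x : A.L) : A.preAnn x (Finsupp.single [] 1) = 0 := by
  simp [preAnn, annWord]

theorem preAnn_cons (x y : A.L) (a : List A.L →₀ ℂ) : A.preAnn x (cons y a) =
    A.inner x y • a + swapSign (A.odd x) (A.odd y) • cons y (A.preAnn x a) := by
  have : A.preAnn x ∘ₗ cons y = A.inner x y • LinearMap.id +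
      swapSign (A.odd x) (A.odd y) • (cons y ∘ₗ A.preAnn x) :=
    words_ext fun w => by simp [preAnn, annWord]
  exact LinearMap.congr_fun this a

/-- Induction over words for identities between linear maps. -/
theorem words_induction {S : Type} {M : Type*} [AddCommMonoid M] [Module ℂ M]
    {B C : (List S →₀ ℂ) →ₗ[ℂ] M} (h₀ : B (Finsupp.single [] 1) = C (Finsupp.single [] 1))
    (h : ∀ x w, B (Finsupp.single w 1) = C (Finsupp.single w 1) →
      B (cons x (Finsupp.single w 1)) = C (cons x (Finsupp.single w 1))) : B = C := by
  refine words_ext fun w => ?_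
  induction w with
  | nil => exact h₀
  | cons x w ih => simpa using h x w ih

/-- Removing two letters from a word gives the same words in either order. The signs match because a
contraction is nonzero only between letters of equal parity. The identity already holds on the free
space, so no null vectors have to be controlled. -/
theorem preAnn_comm (x y : A.L) (a : List A.L →₀ ℂ) : A.preAnn x (A.preAnn y a) =
    swapSign (A.odd x) (A.odd y) • A.preAnn y (A.preAnn x a) := by
  have : A.preAnn x ∘ₗ A.preAnn y =
      swapSign (A.odd x) (A.odd y) • (A.preAnn y ∘ₗ A.preAnn x) := by
    refine words_induction (by simp [preAnn_nil]) fun z w ih => ?_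
    simp only [LinearMap.comp_apply, LinearMap.smul_apply] at ih ⊢
    simp only [preAnn_cons, map_add, map_smul, ih, smul_add, smul_smul]
    have hx : A.inner x z = swapSign (A.odd x) (A.odd y) * swapSign (A.odd y) (A.odd z) *
        A.inner x z := by
      by_cases h : A.odd x = A.odd z
      · rw [h]; cases A.odd z <;> cases A.odd y <;> simp [swapSign, oddSign]
      · rw [A.inner_eq_zero x z h, mul_zero]
    -- If the contraction does not vanish the parities of `y` and `z` agree, and the two equal signs
    -- cancel.
    have hy : swapSign (A.odd x) (A.odd y) * swapSign (A.odd x) (A.odd z) * A.inner y z =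
        A.inner y z := by
      by_cases h : A.odd y = A.odd z
      · rw [h]; cases A.odd z <;> cases A.odd x <;> simp [swapSign, oddSign]
      · rw [A.inner_eq_zero y z h, mul_zero]
    have e1 : swapSign (A.odd x) (A.odd y) * (swapSign (A.odd x) (A.odd z) * A.inner y z) =
        A.inner y z := by rw [← mul_assoc, hy]
    have e2 : swapSign (A.odd y) (A.odd z) * A.inner x z =
        swapSign (A.odd x) (A.odd y) * A.inner x z := by
      by_cases h : A.odd x = A.odd z
      · rw [h]; cases A.odd z <;> cases A.odd y <;> simp [swapSign, oddSign]
      · rw [A.inner_eq_zero x z h, mul_zero, mul_zero]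
    rw [e1, e2]
    module
  exact LinearMap.congr_fun this a

/-- The linear functional `⟨x₁ ⋯ xₙ, ·⟩`. -/
def superEval : List A.L → (List A.L →₀ ℂ) →ₗ[ℂ] ℂ
  | [] => Finsupp.lapply []
  | x :: w => superEval w ∘ₗ A.preAnn x

/-- The scalar products of the (anti)symmetric products of letters. -/
def kernel (w w' : List A.L) : ℂ := A.superEval w (Finsupp.single w' 1)

/-- The Fock space. -/
abbrev Fock : Type := WordSpace A.kernel

theorem preForm_single_left (w : List A.L) (b : List A.L →₀ ℂ) :
    preForm A.kernel (Finsupp.single w 1) b = A.superEval w b := by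
  have : preForm A.kernel (Finsupp.single w 1) = A.superEval w :=
    words_ext fun w' => by simp [preForm_single, kernel]
  rw [this]

theorem preForm_nil_left (b : List A.L →₀ ℂ) :
    preForm A.kernel (Finsupp.single [] 1) b = b [] := by
  rw [preForm_single_left]; rfl

theorem preForm_cons_left (x : A.L) (a b : List A.L →₀ ℂ) :
    preForm A.kernel (cons x a) b = preForm A.kernel a (A.preAnn x b) := by
  apply preForm_adjoint
  intro w w'
  rw [cons_single, preForm_single_left, preForm_single_left]
  rfl

/-- The kernel is defined by stripping letters from its left argument, so `preForm_cons_left` is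
immediate; this converse adjointness is the expansion along the first column and needs an induction
over the left word. -/
theorem preForm_preAnn_left (x : A.L) (a b : List A.L →₀ ℂ) :
    preForm A.kernel (A.preAnn x a) b = preForm A.kernel a (cons x b) := by
  apply preForm_adjoint
  intro w w'
  -- Annihilation turns the right-hand word into a combination of words, so the induction has to run
  -- over arbitrary vectors.
  generalize Finsupp.single w' (1 : ℂ) = b
  induction w generalizing b with
  | nil => rw [preAnn_nil, map_zero, LinearMap.zero_apply, preForm_nil_left, cons_apply_nil]
  | cons y w ih =>
    rw [← cons_single y, preAnn_cons, preForm_cons_left, preAnn_cons]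
    simp only [map_add, map_smulₛₗ, LinearMap.add_apply, LinearMap.smul_apply, preForm_cons_left,
      ih, A.conj_inner, smul_eq_mul, RingHom.id_apply]
    congr 2
    cases A.odd y <;> cases A.odd x <;> simp [swapSign, oddSign]

/-- Hermiticity follows from the two adjointness relations: letters are moved from one side to the
other until only vacuum components remain. -/
theorem kernel_conj (w w' : List A.L) : conj (A.kernel w w') = A.kernel w' w := by
  suffices h : ∀ b, conj (preForm A.kernel (Finsupp.single w 1) b) =
      preForm A.kernel b (Finsupp.single w 1) by
    simpa [preForm_single] using h (Finsupp.single w' 1)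
  intro b
  induction w generalizing b with
  | nil =>
    induction b using Finsupp.induction_linear with
    | zero => simp
    | add a b ha hb => simp [ha, hb]
    | single w c =>
      cases w with
      | nil => simp [preForm_single, kernel, superEval]
      | cons x w =>
        have : Finsupp.single (x :: w) c = cons x (Finsupp.single w c) := by simp
        rw [this, preForm_cons_left, preAnn_nil, preForm_nil_left, cons_apply_nil]
        simp
  | cons x w ih => rw [← cons_single, preForm_cons_left, ih, preForm_preAnn_left]

/-- The scalar product. -/
def form : A.Fock →ₗ⋆[ℂ] A.Fock →ₗ[ℂ] ℂ := WordSpace.form A.kernel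

/-- The vacuum. -/
def vacuum : A.Fock := WordSpace.word A.kernel []

/-- The creation operator. -/
def create (x : A.L) : A.Fock →ₗ[ℂ] A.Fock :=
  WordSpace.op (cons x) (A.preAnn x) (A.preForm_cons_left x) (A.preForm_preAnn_left x)

/-- The annihilation operator. -/
def annihilate (x : A.L) : A.Fock →ₗ[ℂ] A.Fock :=
  WordSpace.op (A.preAnn x) (cons x) (A.preForm_preAnn_left x) (A.preForm_cons_left x)

theorem eq_of_form {Ψ Ψ' : A.Fock} (h : ∀ Φ, A.form Φ Ψ = A.form Φ Ψ') : Ψ = Ψ' :=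
  WordSpace.eq_of_form A.kernel_conj h

theorem form_create (x : A.L) (Ψ Φ : A.Fock) :
    A.form (A.create x Ψ) Φ = A.form Ψ (A.annihilate x Φ) := WordSpace.form_op _ _ _ _ Ψ Φ

theorem form_annihilate (x : A.L) (Ψ Φ : A.Fock) :
    A.form (A.annihilate x Ψ) Φ = A.form Ψ (A.create x Φ) := WordSpace.form_op _ _ _ _ Ψ Φ

theorem annihilate_vacuum (x : A.L) : A.annihilate x A.vacuum = 0 :=
  congrArg (nullSpace A.kernel).mkQ (A.preAnn_nil x)

theorem annihilate_create (x y : A.L) (Ψ : A.Fock) : A.annihilate x (A.create y Ψ) =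
    A.inner x y • Ψ + swapSign (A.odd x) (A.odd y) • A.create y (A.annihilate x Ψ) := by
  obtain ⟨a, rfl⟩ := (nullSpace A.kernel).mkQ_surjective Ψ
  exact congrArg (nullSpace A.kernel).mkQ (A.preAnn_cons x y a)

theorem annihilate_annihilate (x y : A.L) (Ψ : A.Fock) : A.annihilate x (A.annihilate y Ψ) =
    swapSign (A.odd x) (A.odd y) • A.annihilate y (A.annihilate x Ψ) := by
  obtain ⟨a, rfl⟩ := (nullSpace A.kernel).mkQ_surjective Ψ
  exact congrArg (nullSpace A.kernel).mkQ (A.preAnn_comm x y a)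

/-- A submodule containing the vacuum and stable under the creation operators is everything. -/
theorem eq_top_of_create {S : Submodule ℂ A.Fock} (h₀ : A.vacuum ∈ S)
    (h : ∀ x, ∀ Ψ ∈ S, A.create x Ψ ∈ S) : S = ⊤ := by
  refine WordSpace.eq_top_of_word fun w => ?_
  induction w with
  | nil => exact h₀
  | cons x w ih =>
    have := h x _ ih
    rwa [WordSpace.word, create, WordSpace.op_mk, cons_single] at this

theorem hom_ext {M : Type*} [AddCommGroup M] [Module ℂ M] {B C : A.Fock →ₗ[ℂ] M}
    (h₀ : B A.vacuum = C A.vacuum)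
    (h : ∀ x Ψ, B Ψ = C Ψ → B (A.create x Ψ) = C (A.create x Ψ)) : B = C := by
  have : LinearMap.eqLocus B C = ⊤ := A.eq_top_of_create h₀ h
  exact LinearMap.eqLocus_eq_top.mp this

/-- Annihilation operators depend on the scalar products only. -/
theorem annihilate_combination {ι : Type*} (s : Finset ι) (c : ι → ℂ) (y : ι → A.L) (x : A.L)
    (hp : ∀ i ∈ s, A.odd (y i) = A.odd x)
    (h : ∀ t, A.inner t x = ∑ i ∈ s, c i * A.inner t (y i)) :
    A.annihilate x = ∑ i ∈ s, conj (c i) • A.annihilate (y i) := by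
  have h' : ∀ t, A.inner x t = ∑ i ∈ s, conj (c i) * A.inner (y i) t := by
    intro t
    rw [← A.conj_inner, h, map_sum]
    simp [A.conj_inner]
  -- An annihilation operator is determined by its vanishing on the vacuum and by its graded
  -- commutators with the creation operators, which involve only scalar products.
  refine A.hom_ext (by simp [annihilate_vacuum]) fun t Ψ ih => ?_
  rw [LinearMap.sum_apply] at ih ⊢
  rw [annihilate_create, ih, h', Finset.sum_smul, map_sum, Finset.smul_sum,
    ← Finset.sum_add_distrib]
  refine Finset.sum_congr rfl fun i hi => ?_
  rw [LinearMap.smul_apply, LinearMap.smul_apply, annihilate_create, hp i hi, map_smul]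
  module

/-- Creation operators depend on the scalar products only. -/
theorem create_combination {ι : Type*} (s : Finset ι) (c : ι → ℂ) (y : ι → A.L) (x : A.L)
    (hp : ∀ i ∈ s, A.odd (y i) = A.odd x)
    (h : ∀ t, A.inner t x = ∑ i ∈ s, c i * A.inner t (y i)) :
    A.create x = ∑ i ∈ s, c i • A.create (y i) := by
  -- By nondegeneracy the relation for creation operators is the adjoint of the one for annihilation
  -- operators.
  refine LinearMap.ext fun Ψ => A.eq_of_form fun Φ => ?_
  rw [← form_annihilate, A.annihilate_combination s c y x hp h]
  simp [form_annihilate]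

end Letters

namespace Letters

open FreeFields (cons)

variable (A : Letters)

/-! ### Free fields as sums of creation and annihilation operators -/

/-- The free fields `F` are represented on the Fock space over `A` by assigning to each field the
letter it creates from the vacuum. -/
structure Represents (F : FreeFields) where
  letter : F.Sym → A.L
  odd_letter : ∀ x, A.odd (letter x) = F.odd x
  odd_adj : ∀ x, F.odd (F.adj x) = F.odd x
  twoPoint_eq : ∀ x y, F.twoPoint x y = A.inner (letter (F.adj x)) (letter y)
  span : ∀ x : A.L, ∃ (κ : Type) (s : Finset κ) (c : κ → ℂ) (y : κ → F.Sym),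
    (∀ i ∈ s, F.odd (y i) = A.odd x) ∧
    ∀ t, A.inner t x = ∑ i ∈ s, c i * A.inner t (letter (y i))

namespace Represents

variable {A} {F : FreeFields} (ℓ : A.Represents F)

/-- The field operator `a†(x) + a(x†)`. -/
def field (x : F.Sym) : A.Fock →ₗ[ℂ] A.Fock :=
  A.create (ℓ.letter x) + A.annihilate (ℓ.letter (F.adj x))

theorem form_field (x : F.Sym) (Ψ Φ : A.Fock) :
    A.form (ℓ.field x Ψ) Φ = A.form Ψ (ℓ.field (F.adj x) Φ) := by
  simp only [field, LinearMap.add_apply, map_add, form_create, form_annihilate, F.adj_adj]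
  rw [add_comm]

/-- The vector `x₁ ⋯ xₙ Ω`. -/
def vec : List F.Sym → A.Fock
  | [] => A.vacuum
  | x :: w => ℓ.field x (vec w)

/-- The graded commutator is a number: the creation part of the field contributes the scalar
product, and the annihilation parts graded-commute. -/
theorem annihilate_field (y : A.L) (x : F.Sym) (Ψ : A.Fock) : A.annihilate y (ℓ.field x Ψ) =
    A.inner y (ℓ.letter x) • Ψ +
      swapSign (A.odd y) (F.odd x) • ℓ.field x (A.annihilate y Ψ) := by
  simp only [field, LinearMap.add_apply, map_add, annihilate_create, smul_add]
  rw [annihilate_annihilate, ℓ.odd_letter, ℓ.odd_letter, ℓ.odd_adj]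
  abel

theorem annihilate_vec (y : A.L) (w : List F.Sym) : A.annihilate y (ℓ.vec w) =
    ∑ i : Fin w.length, ((if A.odd y then (-1 : ℂ) ^ ((w.take i).countP F.odd) else 1) *
      A.inner y (ℓ.letter w[i])) • ℓ.vec (w.eraseIdx i) := by
  induction w with
  | nil => simp [vec, annihilate_vacuum]
  | cons x w ih =>
    refine Eq.trans ?_ (Fin.sum_univ_succ (n := w.length) _).symm
    rw [vec, annihilate_field, ih]
    simp only [map_sum, map_smul, Finset.smul_sum, smul_smul]
    congr 1
    · simp
    · refine Finset.sum_congr rfl fun i _ => ?_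
      simp only [Fin.val_succ, List.take_succ_cons, List.countP_cons, Fin.getElem_fin,
        List.getElem_cons_succ, List.eraseIdx_cons_succ, vec, swapSign, oddSign]
      congr 1
      cases A.odd y <;> cases F.odd x <;> simp [pow_succ]

/-- This is Wick's theorem. Against the vacuum only the annihilation part of the first field
survives, and moving it to the right through the other fields produces one contraction with each of
them, as in the recursion of `wick`. -/
theorem form_vacuum_vec (w : List F.Sym) : A.form A.vacuum (ℓ.vec w) = F.wick w := by
  match w with
  | [] =>
    rw [FreeFields.wick]
    change preForm A.kernel (Finsupp.single [] 1) (Finsupp.single [] 1) = 1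
    rw [preForm_nil_left]; simp
  | x :: w =>
    rw [FreeFields.wick, vec, field, LinearMap.add_apply, map_add, ← form_annihilate,
      annihilate_vacuum, map_zero, LinearMap.zero_apply, zero_add, annihilate_vec, map_sum]
    refine Finset.sum_congr rfl fun i _ => ?_
    rw [map_smul, form_vacuum_vec (w.eraseIdx i), ℓ.odd_letter, ℓ.odd_adj, ℓ.twoPoint_eq,
      smul_eq_mul]
termination_by w.length
decreasing_by
  have := i.isLt
  simp [List.length_eraseIdx]

theorem form_vec_vec (w w' : List F.Sym) :
    A.form (ℓ.vec w) (ℓ.vec w') = F.wordKernel w w' := by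
  induction w generalizing w' with
  | nil => simpa [FreeFields.wordKernel, vec] using ℓ.form_vacuum_vec w'
  | cons x w ih =>
    rw [vec, form_field]
    simpa [FreeFields.wordKernel, vec] using ih (F.adj x :: w')

/-- The representing map on the free space over the words. -/
def preMap : (List F.Sym →₀ ℂ) →ₗ[ℂ] A.Fock := Finsupp.linearCombination ℂ ℓ.vec

theorem preMap_single (w : List F.Sym) : ℓ.preMap (Finsupp.single w 1) = ℓ.vec w := by
  simp [preMap]

theorem form_preMap (a b : List F.Sym →₀ ℂ) :
    A.form (ℓ.preMap a) (ℓ.preMap b) = preForm F.wordKernel a b := by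
  have hs : ∀ (w : List F.Sym) (c : ℂ), Finsupp.single w c = c • Finsupp.single w (1 : ℂ) := by
    intro w c; simp
  induction a using Finsupp.induction_linear with
  | zero => simp
  | add a a' ha ha' => simp [ha, ha']
  | single w c =>
    induction b using Finsupp.induction_linear with
    | zero => simp
    | add b b' hb hb' => simp only [map_add, hb, hb']
    | single w' d =>
      rw [hs w c, hs w' d]
      simp only [map_smul, map_smulₛₗ, LinearMap.smul_apply, preMap_single, form_vec_vec,
        preForm_single, map_one, one_mul]

theorem preMap_cons (x : F.Sym) (a : List F.Sym →₀ ℂ) :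
    ℓ.preMap (cons x a) = ℓ.field x (ℓ.preMap a) := by
  have : ℓ.preMap ∘ₗ cons x = ℓ.field x ∘ₗ ℓ.preMap :=
    words_ext fun w => by simp [preMap_single, vec]
  exact LinearMap.congr_fun this a

theorem annihilate_mem_range (y : A.L) (a : List F.Sym →₀ ℂ) :
    A.annihilate y (ℓ.preMap a) ∈ LinearMap.range ℓ.preMap := by
  induction a using Finsupp.induction_linear with
  | zero => simp
  | add a b ha hb => rw [map_add, map_add]; exact Submodule.add_mem _ ha hb
  | single w c =>
    have : Finsupp.single w c = c • Finsupp.single w (1 : ℂ) := by simp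
    rw [this, map_smul, map_smul, preMap_single, annihilate_vec]
    refine Submodule.smul_mem _ _ (Submodule.sum_mem _ fun i _ => Submodule.smul_mem _ _ ?_)
    exact ⟨_, ℓ.preMap_single _⟩

/-- Cyclicity of the vacuum: a creation operator is a field minus an annihilation operator,
annihilation operators preserve the span of the field vectors, and by `span` every letter is a
combination of letters of fields. -/
theorem range_preMap : LinearMap.range ℓ.preMap = ⊤ := by
  refine A.eq_top_of_create ⟨_, ℓ.preMap_single []⟩ ?_
  rintro x _ ⟨a, rfl⟩
  obtain ⟨κ, s, c, z, hs, hx⟩ := ℓ.span x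
  rw [A.create_combination s c (fun i => ℓ.letter (z i)) x
    (fun i hi => (ℓ.odd_letter _).trans (hs i hi)) hx,
    LinearMap.sum_apply]
  refine Submodule.sum_mem _ fun i _ => Submodule.smul_mem _ _ ?_
  have : A.create (ℓ.letter (z i)) (ℓ.preMap a) =
      ℓ.preMap (cons (z i) a) - A.annihilate (ℓ.letter (F.adj (z i))) (ℓ.preMap a) := by
    rw [preMap_cons, field, LinearMap.add_apply, add_sub_cancel_right]
  rw [this]
  exact Submodule.sub_mem _ ⟨_, rfl⟩ (ℓ.annihilate_mem_range _ a)

/-- The map is isometric and onto a space with nondegenerate form, so it kills exactly the null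
vectors of the Wick form. -/
theorem ker_preMap : LinearMap.ker ℓ.preMap = nullSpace F.wordKernel := by
  ext b
  rw [LinearMap.mem_ker]
  constructor
  · intro h a
    rw [← ℓ.form_preMap, ← ℓ.form_preMap, h]
    simp
  · intro h
    refine A.eq_of_form fun Φ => ?_
    obtain ⟨a, rfl⟩ : Φ ∈ LinearMap.range ℓ.preMap := by rw [ℓ.range_preMap]; trivial
    rw [form_preMap, (h a).1, map_zero]

/-- The space generated by the fields is the Fock space over the letters. -/
def equiv : F.Space ≃ₗ[ℂ] A.Fock :=
  (Submodule.quotEquivOfEq _ _ ℓ.ker_preMap.symm).trans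
    (ℓ.preMap.quotKerEquivOfSurjective (LinearMap.range_eq_top.mp ℓ.range_preMap))

theorem equiv_vacuum : ℓ.equiv F.vacuum = A.vacuum := ℓ.preMap_single []

theorem equiv_op (x : F.Sym) (Ψ : F.Space) : ℓ.equiv (F.op x Ψ) = ℓ.field x (ℓ.equiv Ψ) := by
  obtain ⟨a, rfl⟩ := (nullSpace F.wordKernel).mkQ_surjective Ψ
  exact ℓ.preMap_cons x a

theorem form_equiv (Ψ Φ : F.Space) : A.form (ℓ.equiv Ψ) (ℓ.equiv Φ) = F.form Ψ Φ := by
  obtain ⟨a, rfl⟩ := (nullSpace F.wordKernel).mkQ_surjective Ψ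
  obtain ⟨b, rfl⟩ := (nullSpace F.wordKernel).mkQ_surjective Φ
  exact ℓ.form_preMap a b

/-- Linear maps on the space of the fields are determined by the vacuum and recursively. -/
theorem space_hom_ext (F : FreeFields) {M : Type*} [AddCommGroup M] [Module ℂ M]
    {B C : F.Space →ₗ[ℂ] M} (h₀ : B F.vacuum = C F.vacuum)
    (h : ∀ x Ψ, B Ψ = C Ψ → B (F.op x Ψ) = C (F.op x Ψ)) : B = C := by
  have : LinearMap.eqLocus B C = ⊤ := by
    refine WordSpace.eq_top_of_word fun w => ?_
    induction w with
    | nil => exact h₀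
    | cons x w ih =>
      have := h x _ ih
      rwa [WordSpace.word, FreeFields.op, WordSpace.op_mk, cons_single] at this
  exact LinearMap.eqLocus_eq_top.mp this

end Represents
end Letters

open FreeFields (cons)

namespace Letters

variable (A : Letters)

/-! ### Second quantization of odd symmetric one-particle operators -/

/-- An odd symmetric operator on the one-particle states. -/
structure OddOp where
  map : A.L → A.L
  odd_map : ∀ x, A.odd (map x) = !A.odd x
  symm : ∀ x y, A.inner (map x) y = A.inner x (map y)

namespace OddOp

variable {A} (q : A.OddOp)

/-- The signed derivation extending `q` to words. -/
def derWord : List A.L → (List A.L →₀ ℂ)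
  | [] => 0
  | x :: w => Finsupp.single (q.map x :: w) 1 + oddSign (A.odd x) • cons x (derWord w)

/-- The second quantization of `q` on the free space over the words. -/
def der : (List A.L →₀ ℂ) →ₗ[ℂ] (List A.L →₀ ℂ) := Finsupp.linearCombination ℂ q.derWord

theorem der_nil : q.der (Finsupp.single [] 1) = 0 := by simp [der, derWord]

theorem der_cons (x : A.L) (a : List A.L →₀ ℂ) : q.der (cons x a) =
    cons (q.map x) a + oddSign (A.odd x) • cons x (q.der a) := by
  have : q.der ∘ₗ cons x = cons (q.map x) + oddSign (A.odd x) • (cons x ∘ₗ q.der) :=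
    words_ext fun w => by simp [der, derWord]
  exact LinearMap.congr_fun this a

theorem der_apply_nil (a : List A.L →₀ ℂ) : q.der a [] = 0 := by
  have : (Finsupp.lapply [] : (List A.L →₀ ℂ) →ₗ[ℂ] ℂ) ∘ₗ q.der = 0 := by
    refine words_ext fun w => ?_
    cases w with
    | nil => simp [der_nil]
    | cons x w =>
      rw [← cons_single, LinearMap.comp_apply, der_cons]
      simp [cons_apply_nil, -cons_single]
  exact LinearMap.congr_fun this a

/-- The graded commutator of a(y) with the second quantization of q is a(qy). Symmetry of q enters
where the derivation meets the contracted letter. -/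
theorem preAnn_der (y : A.L) (a : List A.L →₀ ℂ) : A.preAnn y (q.der a) =
    oddSign (A.odd y) • q.der (A.preAnn y a) + A.preAnn (q.map y) a := by
  have : A.preAnn y ∘ₗ q.der =
      oddSign (A.odd y) • (q.der ∘ₗ A.preAnn y) + A.preAnn (q.map y) := by
    refine words_induction (by simp [der_nil, preAnn_nil]) fun z w ih => ?_
    simp only [LinearMap.comp_apply, LinearMap.add_apply, LinearMap.smul_apply] at ih ⊢
    simp only [der_cons, preAnn_cons, map_add, map_smul, ih, smul_add, smul_smul, q.symm,
      q.odd_map]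
    have hy : oddSign (A.odd z) * A.inner y z = oddSign (A.odd y) * A.inner y z := by
      by_cases h : A.odd y = A.odd z
      · rw [h]
      · rw [A.inner_eq_zero y z h, mul_zero, mul_zero]
    have h1 : swapSign (A.odd y) (!A.odd z) =
        oddSign (A.odd y) * swapSign (A.odd y) (A.odd z) := by
      cases A.odd z <;> cases A.odd y <;> simp [swapSign, oddSign]
    have h2 : swapSign (!A.odd y) (A.odd z) =
        oddSign (A.odd z) * swapSign (A.odd y) (A.odd z) := by
      cases A.odd z <;> cases A.odd y <;> simp [swapSign, oddSign]
    rw [hy, h1, h2]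
    module
  exact LinearMap.congr_fun this a

theorem der_adjoint (a b : List A.L →₀ ℂ) :
    preForm A.kernel (q.der a) b = preForm A.kernel a (q.der b) := by
  apply preForm_adjoint
  intro w w'
  generalize Finsupp.single w' (1 : ℂ) = b
  induction w generalizing b with
  | nil => rw [der_nil, map_zero, LinearMap.zero_apply, preForm_nil_left, der_apply_nil]
  | cons x w ih =>
    rw [← cons_single x, der_cons, preForm_cons_left, preAnn_der]
    simp only [map_add, map_smulₛₗ, LinearMap.add_apply, LinearMap.smul_apply, preForm_cons_left,
      ih, smul_eq_mul, RingHom.id_apply]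
    rw [add_comm]
    congr 2
    cases A.odd x <;> simp [oddSign]

/-- The second quantization of `q`. -/
def op : A.Fock →ₗ[ℂ] A.Fock := WordSpace.op q.der q.der q.der_adjoint q.der_adjoint

theorem form_op (Ψ Φ : A.Fock) : A.form (q.op Ψ) Φ = A.form Ψ (q.op Φ) :=
  WordSpace.form_op _ _ _ _ Ψ Φ

theorem op_vacuum : q.op A.vacuum = 0 := congrArg (nullSpace A.kernel).mkQ q.der_nil

theorem op_create (x : A.L) (Ψ : A.Fock) : q.op (A.create x Ψ) =
    A.create (q.map x) Ψ + oddSign (A.odd x) • A.create x (q.op Ψ) := by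
  obtain ⟨a, rfl⟩ := (nullSpace A.kernel).mkQ_surjective Ψ
  exact congrArg (nullSpace A.kernel).mkQ (q.der_cons x a)

theorem annihilate_op (x : A.L) (Ψ : A.Fock) : A.annihilate x (q.op Ψ) =
    oddSign (A.odd x) • q.op (A.annihilate x Ψ) + A.annihilate (q.map x) Ψ := by
  obtain ⟨a, rfl⟩ := (nullSpace A.kernel).mkQ_surjective Ψ
  exact congrArg (nullSpace A.kernel).mkQ (q.preAnn_der x a)

end OddOp

/-- A letter without scalar products equals the empty linear combination. -/
theorem create_eq_zero {x : A.L} (h : ∀ t, A.inner t x = 0) : A.create x = 0 := by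
  simpa using A.create_combination (ι := Empty) ∅ (fun _ => 0) (fun _ => x) x (by simp)
    (by simpa using h)

theorem annihilate_eq_zero {x : A.L} (h : ∀ t, A.inner t x = 0) : A.annihilate x = 0 := by
  simpa using A.annihilate_combination (ι := Empty) ∅ (fun _ => 0) (fun _ => x) x (by simp)
    (by simpa using h)

theorem create_add {x y z : A.L} (hy : A.odd y = A.odd x) (hz : A.odd z = A.odd x)
    (h : ∀ t, A.inner t x = A.inner t y + A.inner t z) :
    A.create x = A.create y + A.create z := by
  simpa using A.create_combination (ι := Bool) Finset.univ (fun _ => 1)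
    (fun b => if b then y else z) x (by simp [hy, hz]) (by simpa using h)

end Letters

/-! ### Bose Fock spaces -/

namespace OneParticle

variable (P : OneParticle)

theorem preAnnihilate_nil (ψ : P.Wave) : P.preAnnihilate ψ (Finsupp.single [] 1) = 0 := by
  simp [preAnnihilate]

theorem preAnnihilate_cons (ψ φ : P.Wave) (a : List P.Wave →₀ ℂ) :
    P.preAnnihilate ψ (cons φ a) = P.inner ψ φ • a + cons φ (P.preAnnihilate ψ a) := by
  have : P.preAnnihilate ψ ∘ₗ cons φ =
      P.inner ψ φ • LinearMap.id + cons φ ∘ₗ P.preAnnihilate ψ := by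
    refine words_ext fun w => ?_
    simp only [LinearMap.comp_apply, cons_single, preAnnihilate, Finsupp.linearCombination_single,
      one_smul, LinearMap.add_apply, LinearMap.smul_apply, map_sum]
    exact (Fin.sum_univ_succ (n := w.length) _).trans (by simp)
  exact LinearMap.congr_fun this a

theorem permKernel_conj (w w' : List P.Wave) :
    conj (P.permKernel w w') = P.permKernel w' w := by
  induction w generalizing w' with
  | nil => cases w' <;> simp [permKernel]
  | cons ψ w ih => rw [permKernel, permKernel_cons]; simp [ih, P.conj_inner]

theorem form_conj (Ψ Φ : P.Fock) : conj (P.form Ψ Φ) = P.form Φ Ψ :=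
  WordSpace.form_conj P.permKernel_conj Ψ Φ

theorem preForm_nil_left (b : List P.Wave →₀ ℂ) :
    preForm P.permKernel (Finsupp.single [] 1) b = b [] := by
  have : preForm P.permKernel (Finsupp.single [] 1) = Finsupp.lapply [] := by
    refine words_ext fun w => ?_
    cases w <;> simp [preForm_single, permKernel]
  rw [this]; rfl

end OneParticle

namespace Letters

/-! ### Physical letters and quartets -/

/-- An odd symmetric operator `q` of square zero together with a contracting homotopy `r` outside
of the physical letters, which are identified with the states of `P`. -/
structure Quartet (A : Letters) (P : OneParticle) where
  q : A.OddOp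
  r : A.OddOp
  phys : P.Wave → A.L
  odd_phys : ∀ ψ, A.odd (phys ψ) = false
  inner_phys : ∀ ψ φ, A.inner (phys ψ) (phys φ) = P.inner ψ φ
  q_q : ∀ x t, A.inner t (q.map (q.map x)) = 0
  q_phys : ∀ ψ t, A.inner t (q.map (phys ψ)) = 0
  r_phys : ∀ ψ t, A.inner t (r.map (phys ψ)) = 0
  homotopy_odd : ∀ x, A.odd x = true → ∀ t,
    A.inner t x = A.inner t (q.map (r.map x)) + A.inner t (r.map (q.map x))
  split : ∀ x, A.odd x = false → ∃ ψ y, A.odd y = false ∧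
    (∀ t, A.inner t x = A.inner t (phys ψ) + A.inner t y) ∧
    ∀ t, A.inner t y = A.inner t (q.map (r.map y)) + A.inner t (r.map (q.map y))

namespace Quartet

variable {A : Letters} {P : OneParticle} (D : A.Quartet P)

/-- Letters on which the homotopy is effective. -/
def Unphysical (y : A.L) : Prop :=
  ∀ t, A.inner t y = A.inner t (D.q.map (D.r.map y)) + A.inner t (D.r.map (D.q.map y))

/-- A q-exact summand is invisible to physical letters: q is symmetric and annihilates them. -/
theorem inner_phys_of_split {x : A.L} {ψ : P.Wave} (h : ∀ t, A.inner t x =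
    A.inner t (D.phys ψ) + A.inner t (D.q.map (D.r.map x))) (φ : P.Wave) :
    A.inner x (D.phys φ) = P.inner ψ φ := by
  rw [← A.conj_inner, h, map_add, A.conj_inner, D.inner_phys, ← D.q.symm,
    ← A.conj_inner (D.r.map x), D.q_phys, map_zero, map_zero, add_zero]

/-- Both terms qry and rqy are orthogonal to physical letters, because q and r are symmetric and
kill these. -/
theorem inner_phys_unphysical {y : A.L} (h : D.Unphysical y) (φ : P.Wave) :
    A.inner y (D.phys φ) = 0 := by
  have e : ∀ t, A.inner (D.q.map (D.phys φ)) t = 0 := fun t => by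
    rw [← A.conj_inner, D.q_phys, map_zero]
  have e' : ∀ t, A.inner (D.r.map (D.phys φ)) t = 0 := fun t => by
    rw [← A.conj_inner, D.r_phys, map_zero]
  rw [← A.conj_inner, h, ← D.q.symm (D.phys φ), ← D.r.symm (D.phys φ), e, e', add_zero,
    map_zero]

/-- The embedding of the words in physical letters. -/
def preIncl : (List P.Wave →₀ ℂ) →ₗ[ℂ] (List A.L →₀ ℂ) :=
  Finsupp.lmapDomain ℂ ℂ (List.map D.phys)

theorem preIncl_nil : D.preIncl (Finsupp.single [] 1) = Finsupp.single [] 1 := by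
  simp [preIncl]

theorem preIncl_cons (ψ : P.Wave) (a : List P.Wave →₀ ℂ) :
    D.preIncl (cons ψ a) = cons (D.phys ψ) (D.preIncl a) := by
  have : D.preIncl ∘ₗ cons ψ = cons (D.phys ψ) ∘ₗ D.preIncl :=
    words_ext fun w => by simp [preIncl]
  exact LinearMap.congr_fun this a

theorem preIncl_apply_nil (a : List P.Wave →₀ ℂ) : D.preIncl a [] = a [] := by
  have : (Finsupp.lapply [] : (List A.L →₀ ℂ) →ₗ[ℂ] ℂ) ∘ₗ D.preIncl = Finsupp.lapply [] := by
    refine words_ext fun w => ?_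
    cases w <;> simp [preIncl]
  exact LinearMap.congr_fun this a

theorem preAnn_preIncl {x : A.L} {ψ : P.Wave} (hx : A.odd x = false)
    (h : ∀ φ, A.inner x (D.phys φ) = P.inner ψ φ) (a : List P.Wave →₀ ℂ) :
    A.preAnn x (D.preIncl a) = D.preIncl (P.preAnnihilate ψ a) := by
  have : A.preAnn x ∘ₗ D.preIncl = D.preIncl ∘ₗ P.preAnnihilate ψ := by
    refine words_induction ?_ fun z w ih => ?_
    · simp [preIncl_nil, preAnn_nil, OneParticle.preAnnihilate_nil]
    · simp only [LinearMap.comp_apply] at ih ⊢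
      rw [preIncl_cons, preAnn_cons, ih, OneParticle.preAnnihilate_cons, map_add, map_smul,
        preIncl_cons, h, hx]
      simp [swapSign]
  exact LinearMap.congr_fun this a

theorem preAnn_preIncl_eq_zero {x : A.L} (h : ∀ φ, A.inner x (D.phys φ) = 0)
    (a : List P.Wave →₀ ℂ) : A.preAnn x (D.preIncl a) = 0 := by
  have : A.preAnn x ∘ₗ D.preIncl = 0 := by
    refine words_induction ?_ fun z w ih => ?_
    · simp [preIncl_nil, preAnn_nil]
    · simp only [LinearMap.comp_apply, LinearMap.zero_apply] at ih ⊢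
      rw [preIncl_cons, preAnn_cons, ih, h]
      simp
  exact LinearMap.congr_fun this a

theorem preForm_preIncl (a b : List P.Wave →₀ ℂ) :
    preForm A.kernel (D.preIncl a) (D.preIncl b) = preForm P.permKernel a b := by
  have key : ∀ (w : List P.Wave) b, preForm A.kernel (D.preIncl (Finsupp.single w 1))
      (D.preIncl b) = preForm P.permKernel (Finsupp.single w 1) b := by
    intro w
    induction w with
    | nil =>
      intro b
      rw [preIncl_nil, preForm_nil_left, preIncl_apply_nil, OneParticle.preForm_nil_left]
    | cons ψ w ih =>
      intro b
      rw [← cons_single, preIncl_cons, preForm_cons_left,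
        D.preAnn_preIncl (D.odd_phys ψ) (D.inner_phys ψ), ih, OneParticle.create_adjoint]
  induction a using Finsupp.induction_linear with
  | zero => simp
  | add a a' ha ha' => simp [ha, ha']
  | single w c =>
    have : Finsupp.single w c = c • Finsupp.single w (1 : ℂ) := by simp
    rw [this, map_smul, map_smulₛₗ, map_smulₛₗ, LinearMap.smul_apply, LinearMap.smul_apply, key]

/-- On physical words every letter of the large Fock space acts either as zero or as a one-particle
state of `P`. This lets the inclusion of Fock spaces pass to the quotients by null vectors. -/
theorem inner_phys_cases (x : A.L) : (∀ φ, A.inner x (D.phys φ) = 0) ∨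
    A.odd x = false ∧ ∃ ψ, ∀ φ, A.inner x (D.phys φ) = P.inner ψ φ := by
  cases hx : A.odd x with
  | true => exact Or.inl fun φ => A.inner_eq_zero _ _ (by rw [hx, D.odd_phys]; simp)
  | false =>
    obtain ⟨ψ, y, -, h1, h2⟩ := D.split x hx
    refine Or.inr ⟨rfl, ψ, fun φ => ?_⟩
    rw [← A.conj_inner, h1, map_add, A.conj_inner, A.conj_inner, D.inner_phys,
      D.inner_phys_unphysical h2, add_zero]

/-- Null vectors have to be tested against all words, not just physical ones. Letters are stripped
one at a time: each gives zero or an annihilation operator of `P`, which maps null vectors to null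
vectors. -/
theorem preIncl_mem_nullSpace {b : List P.Wave →₀ ℂ} (hb : b ∈ nullSpace P.permKernel) :
    D.preIncl b ∈ nullSpace A.kernel := by
  refine mem_nullSpace_of_left A.kernel_conj fun w => ?_
  induction w generalizing b with
  | nil =>
    rw [preForm_nil_left, preIncl_apply_nil, ← OneParticle.preForm_nil_left]
    exact (hb _).1
  | cons x w ih =>
    rw [← cons_single, preForm_cons_left]
    rcases D.inner_phys_cases x with h | ⟨hx, ψ, h⟩
    · rw [D.preAnn_preIncl_eq_zero h, map_zero]
    · rw [D.preAnn_preIncl hx h]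
      refine ih fun a => ?_
      rw [← OneParticle.create_adjoint, OneParticle.annihilate_adjoint]
      exact hb _ |>.imp id fun _ => (hb _).2

/-- The embedding of the Fock space over the physical letters. -/
def incl : P.Fock →ₗ[ℂ] A.Fock :=
  (nullSpace P.permKernel).mapQ (nullSpace A.kernel) D.preIncl fun _ hb =>
    D.preIncl_mem_nullSpace hb

theorem incl_vacuum : D.incl P.vacuum = A.vacuum :=
  congrArg (nullSpace A.kernel).mkQ D.preIncl_nil

theorem incl_create (ψ : P.Wave) (Ψ : P.Fock) :
    D.incl (P.create ψ Ψ) = A.create (D.phys ψ) (D.incl Ψ) := by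
  obtain ⟨a, rfl⟩ := (nullSpace P.permKernel).mkQ_surjective Ψ
  exact congrArg (nullSpace A.kernel).mkQ (D.preIncl_cons ψ a)

theorem annihilate_incl {x : A.L} {ψ : P.Wave} (hx : A.odd x = false)
    (h : ∀ φ, A.inner x (D.phys φ) = P.inner ψ φ) (Ψ : P.Fock) :
    A.annihilate x (D.incl Ψ) = D.incl (P.annihilate ψ Ψ) := by
  obtain ⟨a, rfl⟩ := (nullSpace P.permKernel).mkQ_surjective Ψ
  exact congrArg (nullSpace A.kernel).mkQ (D.preAnn_preIncl hx h a)

theorem form_incl (Ψ Φ : P.Fock) : A.form (D.incl Ψ) (D.incl Φ) = P.form Ψ Φ := by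
  obtain ⟨a, rfl⟩ := (nullSpace P.permKernel).mkQ_surjective Ψ
  obtain ⟨b, rfl⟩ := (nullSpace P.permKernel).mkQ_surjective Φ
  exact D.preForm_preIncl a b

/-! ### The cohomology of the second quantization of `q` -/

/-- The gauge charge. -/
abbrev charge : A.Fock →ₗ[ℂ] A.Fock := D.q.op

/-- The square of an odd derivation is the even derivation induced by q², since the mixed terms
carry opposite signs. -/
theorem charge_charge : D.charge ∘ₗ D.charge = 0 := by
  refine A.hom_ext (by simp [OddOp.op_vacuum]) fun x Ψ h => ?_
  simp only [LinearMap.comp_apply, LinearMap.zero_apply] at h ⊢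
  rw [OddOp.op_create, map_add, map_smul, OddOp.op_create, OddOp.op_create, h,
    A.create_eq_zero (D.q_q x), D.q.odd_map]
  cases A.odd x <;> simp [oddSign]

theorem charge_charge_apply (Ψ : A.Fock) : D.charge (D.charge Ψ) = 0 :=
  LinearMap.congr_fun D.charge_charge Ψ

/-- The number of unphysical particles. -/
def number : A.Fock →ₗ[ℂ] A.Fock := D.q.op ∘ₗ D.r.op + D.r.op ∘ₗ D.q.op

/-- The cross terms cancel because q and r both reverse parity; the anticommutator is thus the
ordinary derivation induced by qr + rq. -/
theorem number_create (x : A.L) (Ψ : A.Fock) : D.number (A.create x Ψ) =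
    A.create (D.q.map (D.r.map x)) Ψ + A.create (D.r.map (D.q.map x)) Ψ +
      A.create x (D.number Ψ) := by
  simp only [number, LinearMap.add_apply, LinearMap.comp_apply, OddOp.op_create, map_add,
    map_smul, OddOp.odd_map]
  cases A.odd x <;> simp [oddSign] <;> abel

theorem number_create_unphysical {y : A.L} (h : D.Unphysical y) (Ψ : A.Fock) :
    D.number (A.create y Ψ) = A.create y Ψ + A.create y (D.number Ψ) := by
  have : A.create y = A.create (D.q.map (D.r.map y)) + A.create (D.r.map (D.q.map y)) :=
    A.create_add (by simp [OddOp.odd_map]) (by simp [OddOp.odd_map]) h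
  rw [number_create]
  simp only [this, LinearMap.add_apply]

theorem op_create_phys {s : A.OddOp} (hs : ∀ ψ t, A.inner t (s.map (D.phys ψ)) = 0) (ψ : P.Wave)
    (Ψ : A.Fock) : s.op (A.create (D.phys ψ) Ψ) = A.create (D.phys ψ) (s.op Ψ) := by
  rw [OddOp.op_create, A.create_eq_zero (hs ψ), D.odd_phys]
  simp [oddSign]

theorem number_create_phys (ψ : P.Wave) (Ψ : A.Fock) :
    D.number (A.create (D.phys ψ) Ψ) = A.create (D.phys ψ) (D.number Ψ) := by
  simp only [number, LinearMap.add_apply, LinearMap.comp_apply, map_add,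
    D.op_create_phys D.q_phys, D.op_create_phys D.r_phys]

/-- Linear maps on the physical Fock space are determined by the vacuum and recursively. -/
theorem _root_.GaugeCharge.OneParticle.hom_ext {P : OneParticle} {M : Type*} [AddCommGroup M]
    [Module ℂ M] {B C : P.Fock →ₗ[ℂ] M} (h₀ : B P.vacuum = C P.vacuum)
    (h : ∀ ψ Ψ, B Ψ = C Ψ → B (P.create ψ Ψ) = C (P.create ψ Ψ)) : B = C := by
  have : LinearMap.eqLocus B C = ⊤ := by
    refine WordSpace.eq_top_of_word fun w => ?_
    induction w with
    | nil => exact h₀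
    | cons x w ih =>
      have := h x _ ih
      rwa [WordSpace.word, OneParticle.create, WordSpace.op_mk, cons_single] at this
  exact LinearMap.eqLocus_eq_top.mp this

theorem op_incl {s : A.OddOp} (hs : ∀ ψ t, A.inner t (s.map (D.phys ψ)) = 0) (Ψ : P.Fock) :
    s.op (D.incl Ψ) = 0 := by
  have : s.op ∘ₗ D.incl = 0 := by
    refine OneParticle.hom_ext (by simp [incl_vacuum, OddOp.op_vacuum]) fun ψ Ψ h => ?_
    simp only [LinearMap.comp_apply, LinearMap.zero_apply] at h ⊢
    rw [incl_create, D.op_create_phys hs, h, map_zero]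
  exact LinearMap.congr_fun this Ψ

theorem charge_incl (Ψ : P.Fock) : D.charge (D.incl Ψ) = 0 := D.op_incl D.q_phys Ψ

theorem number_incl (Ψ : P.Fock) : D.number (D.incl Ψ) = 0 := by
  simp [number, D.op_incl D.q_phys, D.op_incl D.r_phys]

/-- The vectors containing a positive number of unphysical particles. -/
def excited : Submodule ℂ A.Fock :=
  ⨆ n : ℕ, LinearMap.ker (D.number - ((n : ℂ) + 1) • LinearMap.id)

theorem mem_excited {n : ℕ} {Ψ : A.Fock} (h : D.number Ψ = ((n : ℂ) + 1) • Ψ) :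
    Ψ ∈ D.excited :=
  Submodule.mem_iSup_of_mem n (by simp [h])

/-- Physical letters preserve the eigenspaces of N and unphysical ones raise the eigenvalue by one.
Every letter is a sum of both kinds, so the vacuum generates only vectors of N = 0 in the range of
the inclusion and eigenvectors of positive integer eigenvalue. -/
theorem range_incl_sup_excited : LinearMap.range D.incl ⊔ D.excited = ⊤ := by
  have hph : ∀ ψ, ∀ Ψ ∈ LinearMap.range D.incl ⊔ D.excited,
      A.create (D.phys ψ) Ψ ∈ LinearMap.range D.incl ⊔ D.excited := by
    intro ψ
    suffices h : LinearMap.range D.incl ⊔ D.excited ≤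
        (LinearMap.range D.incl ⊔ D.excited).comap (A.create (D.phys ψ)) from fun Ψ hΨ => h hΨ
    refine sup_le ?_ (iSup_le fun n => ?_)
    · rintro _ ⟨Φ, rfl⟩
      exact Submodule.mem_sup_left ⟨_, D.incl_create ψ Φ⟩
    · intro Ψ hΨ
      refine Submodule.mem_sup_right (D.mem_excited (n := n) ?_)
      have : D.number Ψ = ((n : ℂ) + 1) • Ψ := by simpa [sub_eq_zero] using hΨ
      rw [number_create_phys, this, map_smul]
  have hun : ∀ y, D.Unphysical y → ∀ Ψ ∈ LinearMap.range D.incl ⊔ D.excited,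
      A.create y Ψ ∈ LinearMap.range D.incl ⊔ D.excited := by
    intro y hy
    suffices h : LinearMap.range D.incl ⊔ D.excited ≤
        (LinearMap.range D.incl ⊔ D.excited).comap (A.create y) from fun Ψ hΨ => h hΨ
    refine sup_le ?_ (iSup_le fun n => ?_)
    · rintro _ ⟨Φ, rfl⟩
      refine Submodule.mem_sup_right (D.mem_excited (n := 0) ?_)
      rw [D.number_create_unphysical hy, number_incl]
      simp
    · intro Ψ hΨ
      refine Submodule.mem_sup_right (D.mem_excited (n := n + 1) ?_)
      have : D.number Ψ = ((n : ℂ) + 1) • Ψ := by simpa [sub_eq_zero] using hΨ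
      rw [D.number_create_unphysical hy, this, map_smul]
      push_cast
      module
  refine A.eq_top_of_create (Submodule.mem_sup_left ⟨_, D.incl_vacuum⟩) fun x Ψ hΨ => ?_
  cases hx : A.odd x with
  | true => exact hun x (D.homotopy_odd x hx) Ψ hΨ
  | false =>
    obtain ⟨ψ, y, hy, h1, h2⟩ := D.split x hx
    rw [A.create_add ((D.odd_phys ψ).trans hx.symm) (hy.trans hx.symm) h1, LinearMap.add_apply]
    exact Submodule.add_mem _ (hph ψ Ψ hΨ) (hun y h2 Ψ hΨ)

open Polynomial in
-- A nonzero constant coefficient expresses invertibility of N on the cyclic subspace of the vector.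
-- For an eigenvector the polynomial is X - (n + 1), and for sums one takes products.
theorem exists_polynomial {Ψ : A.Fock} (h : Ψ ∈ D.excited) :
    ∃ p : ℂ[X], p.coeff 0 ≠ 0 ∧ aeval D.number p Ψ = 0 := by
  induction h using Submodule.iSup_induction' with
  | mem n Ψ h =>
    refine ⟨X - C ((n : ℂ) + 1), ?_, ?_⟩
    · simpa using neg_ne_zero.mpr (Nat.cast_add_one_ne_zero (R := ℂ) n)
    · have : D.number Ψ = ((n : ℂ) + 1) • Ψ := by simpa [sub_eq_zero] using h
      simp [this, add_smul, Nat.cast_smul_eq_nsmul]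
  | zero => exact ⟨1, by simp⟩
  | add Ψ Φ _ _ hΨ hΦ =>
    obtain ⟨p, hp, hpΨ⟩ := hΨ
    obtain ⟨p', hp', hpΦ⟩ := hΦ
    refine ⟨p * p', by simpa [mul_coeff_zero] using ⟨hp, hp'⟩, ?_⟩
    have e : aeval D.number (p * p') Ψ = 0 := by
      rw [mul_comm, map_mul, Module.End.mul_apply, hpΨ, map_zero]
    rw [map_add, e, map_mul, Module.End.mul_apply, hpΦ, map_zero, add_zero]

open Polynomial in
-- For a closed vector NΨ = QRΨ. Writing the annihilating polynomial as p = X s + p(0) gives p(0) Ψ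
-- = -s(N) Q R Ψ = -Q s(N) R Ψ, because N commutes with Q.
theorem mem_range_of_excited {Ψ : A.Fock} (h : Ψ ∈ D.excited) (hQ : D.charge Ψ = 0) :
    Ψ ∈ LinearMap.range D.charge := by
  obtain ⟨p, hp, hpΨ⟩ := D.exists_polynomial h
  have hcomm : Commute (aeval D.number p.divX) D.charge := by
    -- Both products equal Q R Q, since Q² = 0.
    have hN : Commute D.number D.charge :=
      LinearMap.ext fun Φ => by simp [number, charge_charge_apply]
    rw [aeval_eq_sum_range]
    exact Commute.sum_left _ _ _ fun i _ => (hN.pow_left i).smul_left _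
  have hN : D.number Ψ = D.charge (D.r.op Ψ) := by simp [number, hQ]
  have e : D.charge (aeval D.number p.divX (D.r.op Ψ)) + p.coeff 0 • Ψ = 0 := by
    rw [← Module.End.mul_apply, ← hcomm.eq, Module.End.mul_apply, ← hN]
    rw [← p.divX_mul_X_add] at hpΨ
    simpa using hpΨ
  refine ⟨-(p.coeff 0)⁻¹ • aeval D.number p.divX (D.r.op Ψ), ?_⟩
  rw [map_smul, eq_neg_of_add_eq_zero_left e, smul_neg, neg_smul, neg_neg, inv_smul_smul₀ hp]

/-- The physical component of a closed vector is closed by itself, so the excited component is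
closed too and hence exact. -/
theorem ker_charge : LinearMap.ker D.charge = LinearMap.range D.incl ⊔ LinearMap.range D.charge := by
  apply le_antisymm
  · intro Ψ hΨ
    have : Ψ ∈ LinearMap.range D.incl ⊔ D.excited := by
      rw [D.range_incl_sup_excited]; trivial
    obtain ⟨_, ⟨Φ, rfl⟩, Ψ', h', rfl⟩ := Submodule.mem_sup.mp this
    refine Submodule.add_mem_sup ⟨Φ, rfl⟩ (D.mem_range_of_excited h' ?_)
    rw [LinearMap.mem_ker, map_add, charge_incl, zero_add] at hΨ
    exact hΨ
  · refine sup_le ?_ ?_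
    · rintro _ ⟨Φ, rfl⟩; exact D.charge_incl Φ
    · rintro _ ⟨Φ, rfl⟩; exact D.charge_charge_apply Φ

end Quartet
end Letters

open FreeFields (cons)

namespace OneParticle

variable (P : OneParticle)

/-! ### Positivity of the scalar product of the Fock space -/

theorem permKernel_eq_zero_of_length_ne : ∀ w w' : List P.Wave, w.length ≠ w'.length →
    P.permKernel w w' = 0
  | [], [], h => absurd rfl h
  | [], _ :: _, _ => rfl
  | ψ :: w, w', h => by
    rw [permKernel]
    refine Finset.sum_eq_zero fun i _ => ?_
    rw [permKernel_eq_zero_of_length_ne w _, mul_zero]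
    have := i.isLt
    simp only [List.length_cons] at h
    rw [List.length_eraseIdx]
    split <;> omega

theorem preAnnihilate_comm (ψ φ : P.Wave) (a : List P.Wave →₀ ℂ) :
    P.preAnnihilate ψ (P.preAnnihilate φ a) = P.preAnnihilate φ (P.preAnnihilate ψ a) := by
  have : P.preAnnihilate ψ ∘ₗ P.preAnnihilate φ = P.preAnnihilate φ ∘ₗ P.preAnnihilate ψ := by
    refine Letters.words_induction (by simp [preAnnihilate_nil]) fun z w ih => ?_
    simp only [LinearMap.comp_apply] at ih ⊢
    simp only [preAnnihilate_cons, map_add, map_smul, ih]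
    abel
  exact LinearMap.congr_fun this a

theorem preForm_cons_left (ψ : P.Wave) (w : List P.Wave) (b : List P.Wave →₀ ℂ) :
    preForm P.permKernel (Finsupp.single (ψ :: w) 1) b =
      preForm P.permKernel (Finsupp.single w 1) (P.preAnnihilate ψ b) := by
  rw [← cons_single, create_adjoint]

theorem preForm_perm {w w' : List P.Wave} (h : w.Perm w') (b : List P.Wave →₀ ℂ) :
    preForm P.permKernel (Finsupp.single w 1) b =
      preForm P.permKernel (Finsupp.single w' 1) b := by
  induction h generalizing b with
  | nil => rfl
  | cons x _ ih => rw [preForm_cons_left, preForm_cons_left, ih]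
  | swap x y l => simp only [preForm_cons_left, preAnnihilate_comm P x y]
  | trans _ _ h1 h2 => rw [h1, h2]

theorem permKernel_perm {w w' : List P.Wave} (h : w.Perm w') (v : List P.Wave) :
    P.permKernel w v = P.permKernel w' v := by
  simpa [preForm_single] using P.preForm_perm h (Finsupp.single v 1)

/-- Expansion of the permanent in all entries. -/
theorem sum_sum_permKernel (w w' : List P.Wave) :
    ∑ i : Fin w.length, ∑ j : Fin w'.length,
      P.inner w[i] w'[j] * P.permKernel (w.eraseIdx i) (w'.eraseIdx j) =
        w.length * P.permKernel w w' := by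
  have : ∀ i : Fin w.length, ∑ j : Fin w'.length,
      P.inner w[i] w'[j] * P.permKernel (w.eraseIdx i) (w'.eraseIdx j) = P.permKernel w w' := by
    intro i
    rw [← P.permKernel_perm (List.getElem_cons_eraseIdx_perm i.isLt) w', permKernel]
    rfl
  rw [Finset.sum_congr rfl fun i _ => this i]
  simp

/-- The scalar product is a superposition of the squares of the amplitudes `e j k`. -/
structure Amplitudes (X ι : Type) [MeasurableSpace X] [Fintype ι] where
  μ : Measure X
  e : ι → X → P.Wave → ℂ
  integrable : ∀ j ψ φ, Integrable (fun k => conj (e j k ψ) * e j k φ) μ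
  inner_eq : ∀ ψ φ, P.inner ψ φ = ∑ j, ∫ k, conj (e j k ψ) * e j k φ ∂μ

/-- Contraction of a word with a one-particle amplitude, normalized. -/
def lowerWord {W : Type} (a : W → ℂ) (w : List W) : List W →₀ ℂ :=
  ∑ i : Fin w.length, ((√(w.length : ℝ) : ℂ)⁻¹ * a w[i]) • Finsupp.single (w.eraseIdx i) 1

/-- Contraction with a one-particle amplitude, normalized. -/
def lower {W : Type} (a : W → ℂ) : (List W →₀ ℂ) →ₗ[ℂ] (List W →₀ ℂ) :=
  Finsupp.linearCombination ℂ (lowerWord a)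

namespace Amplitudes

variable {P} {X ι : Type} [MeasurableSpace X] [Fintype ι] (E : P.Amplitudes X ι)

theorem preForm_lower_single (j : ι) (k : X) (w w' : List P.Wave) :
    preForm P.permKernel (lower (E.e j k) (Finsupp.single w 1))
      (lower (E.e j k) (Finsupp.single w' 1)) =
    ∑ i : Fin w.length, ∑ l : Fin w'.length, ((√(w.length : ℝ) : ℂ)⁻¹ * (√(w'.length : ℝ) : ℂ)⁻¹ *
      P.permKernel (w.eraseIdx i) (w'.eraseIdx l)) *
        (conj (E.e j k w[i]) * E.e j k w'[l]) := by
  simp only [lower, Finsupp.linearCombination_single, one_smul, lowerWord, map_sum,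
    LinearMap.sum_apply, map_smul, map_smulₛₗ, LinearMap.smul_apply, preForm_single, smul_eq_mul]
  simp only [Finset.mul_sum]
  rw [Finset.sum_comm]
  refine Finset.sum_congr rfl fun i _ => Finset.sum_congr rfl fun l _ => ?_
  simp
  ring

/-- Taking one particle out of both arguments writes the form as an integral of forms on shorter
words. Summing over all removed pairs counts the permanent once per row, that is n times for words
of length n; the factor 1/√n in `lowerWord` on either side compensates this. The empty words have no
particle to remove and give the separate term. -/
theorem preForm_lower (a b : List P.Wave →₀ ℂ) :
    (∀ j, Integrable (fun k => preForm P.permKernel (lower (E.e j k) a) (lower (E.e j k) b)) E.μ) ∧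
      preForm P.permKernel a b = conj (a []) * b [] +
        ∑ j, ∫ k, preForm P.permKernel (lower (E.e j k) a) (lower (E.e j k) b) ∂E.μ := by
  have hs : ∀ (w : List P.Wave) (c : ℂ), Finsupp.single w c = c • Finsupp.single w (1 : ℂ) := by
    intro w c; simp
  induction a using Finsupp.induction_linear with
  | zero => simp
  | add a a' ha ha' =>
    simp only [map_add, LinearMap.add_apply, Finsupp.add_apply]
    refine ⟨fun j => (ha.1 j).add (ha'.1 j), ?_⟩
    rw [Finset.sum_congr rfl fun j _ => integral_add (ha.1 j) (ha'.1 j), Finset.sum_add_distrib,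
      ha.2, ha'.2]
    ring
  | single w c =>
    induction b using Finsupp.induction_linear with
    | zero => simp
    | add b b' hb hb' =>
      simp only [map_add, Finsupp.add_apply]
      refine ⟨fun j => (hb.1 j).add (hb'.1 j), ?_⟩
      rw [Finset.sum_congr rfl fun j _ => integral_add (hb.1 j) (hb'.1 j), Finset.sum_add_distrib,
        hb.2, hb'.2]
      ring
    | single w' d =>
      rw [hs w c, hs w' d]
      simp only [map_smul, map_smulₛₗ, LinearMap.smul_apply, E.preForm_lower_single,
        Finsupp.smul_apply, smul_eq_mul]
      have hi : ∀ j, ∀ i : Fin w.length, ∀ l : Fin w'.length, Integrable (fun k =>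
          ((√(w.length : ℝ) : ℂ)⁻¹ * (√(w'.length : ℝ) : ℂ)⁻¹ *
            P.permKernel (w.eraseIdx i) (w'.eraseIdx l)) *
              (conj (E.e j k w[i]) * E.e j k w'[l])) E.μ :=
        fun j i l => (E.integrable j _ _).const_mul _
      have hi' : ∀ j, ∀ i : Fin w.length, Integrable (fun k => ∑ l : Fin w'.length,
          ((√(w.length : ℝ) : ℂ)⁻¹ * (√(w'.length : ℝ) : ℂ)⁻¹ *
            P.permKernel (w.eraseIdx i) (w'.eraseIdx l)) *
              (conj (E.e j k w[i]) * E.e j k w'[l])) E.μ :=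
        fun j i => integrable_finsetSum _ fun l _ => hi j i l
      refine ⟨fun j => ((integrable_finsetSum _ fun i _ => hi' j i).const_mul _).const_mul _, ?_⟩
      -- Integrating the amplitudes restores the one-particle products, and the double sum becomes
      -- the expansion `sum_sum_permKernel`.
      have key : ∑ j, ∫ k, ∑ i : Fin w.length, ∑ l : Fin w'.length,
          ((√(w.length : ℝ) : ℂ)⁻¹ * (√(w'.length : ℝ) : ℂ)⁻¹ *
            P.permKernel (w.eraseIdx i) (w'.eraseIdx l)) *
              (conj (E.e j k w[i]) * E.e j k w'[l]) ∂E.μ =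
          ((√(w.length : ℝ) : ℂ)⁻¹ * (√(w'.length : ℝ) : ℂ)⁻¹) *
            (w.length * P.permKernel w w') := by
        have h1 : ∀ j, ∫ k, ∑ i : Fin w.length, ∑ l : Fin w'.length,
            ((√(w.length : ℝ) : ℂ)⁻¹ * (√(w'.length : ℝ) : ℂ)⁻¹ *
              P.permKernel (w.eraseIdx i) (w'.eraseIdx l)) *
                (conj (E.e j k w[i]) * E.e j k w'[l]) ∂E.μ =
            ∑ i : Fin w.length, ∑ l : Fin w'.length,
              ((√(w.length : ℝ) : ℂ)⁻¹ * (√(w'.length : ℝ) : ℂ)⁻¹ *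
                P.permKernel (w.eraseIdx i) (w'.eraseIdx l)) *
                ∫ k, conj (E.e j k w[i]) * E.e j k w'[l] ∂E.μ := by
          intro j
          rw [integral_finsetSum _ fun i _ => hi' j i]
          refine Finset.sum_congr rfl fun i _ => ?_
          rw [integral_finsetSum _ fun l _ => hi j i l]
          exact Finset.sum_congr rfl fun l _ => integral_const_mul _ _
        simp only [h1]
        rw [Finset.sum_comm, ← P.sum_sum_permKernel, Finset.mul_sum]
        refine Finset.sum_congr rfl fun i _ => ?_
        rw [Finset.sum_comm, Finset.mul_sum]
        refine Finset.sum_congr rfl fun l _ => ?_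
        rw [← Finset.mul_sum, ← E.inner_eq]
        ring
      simp only [integral_const_mul, ← Finset.mul_sum, key]
      simp only [preForm_single, map_one, one_mul]
      -- Only words of equal length have a nonzero permanent; then the two roots multiply to n⁻¹,
      -- with n = 0 treated apart.
      by_cases hw : w.length = w'.length
      · rcases w with _ | ⟨x, w⟩
        · obtain rfl : w' = [] := by simpa using hw.symm
          simp [permKernel, mul_comm]
        · have hn : (√((x :: w).length : ℝ) : ℂ)⁻¹ * (√((x :: w).length : ℝ) : ℂ)⁻¹ *
              ((x :: w).length : ℂ) = 1 := by
            rw [← mul_inv, ← Complex.ofReal_mul, Real.mul_self_sqrt (by positivity),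
              Complex.ofReal_natCast, inv_mul_cancel₀]
            simp only [List.length_cons]
            exact Nat.cast_ne_zero.mpr (by omega)
          have h0 : (Finsupp.single (x :: w) (1 : ℂ)) [] = 0 := by simp
          rw [← hw, h0, mul_zero, map_zero]
          linear_combination (-(d * conj c * P.permKernel (x :: w) w')) * hn
      · rw [P.permKernel_eq_zero_of_length_ne w w' hw]
        rcases w with _ | ⟨x, w⟩
        · rcases w' with _ | ⟨x, w'⟩
          · exact absurd rfl hw
          · simp
        · simp

theorem lower_mem {W : Type} (a : W → ℂ) {n : ℕ} {b : List W →₀ ℂ}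
    (hb : ∀ w ∈ b.support, w.length ≤ n + 1) (w) (hw : w ∈ (lower a b).support) :
    w.length ≤ n := by
  suffices h : lower a b ∈ Finsupp.supported ℂ ℂ {w : List W | w.length ≤ n} from
    (Finsupp.mem_supported _ _).mp h hw
  rw [lower, Finsupp.linearCombination_apply]
  refine Submodule.sum_mem _ fun w hw => Submodule.smul_mem _ _ (Submodule.sum_mem _ fun i _ =>
    Submodule.smul_mem _ _ (Finsupp.single_mem_supported _ _ ?_))
  have := hb w hw
  have := i.isLt
  simp only [Set.mem_ofPred_eq, List.length_eraseIdx]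
  split <;> omega

include E in
-- Induction on the maximal length of the words in `b`: in `preForm_lower` with equal arguments the
-- first term is a modulus squared, and the integrand is the form of a vector with shorter words.
theorem preForm_nonneg (b : List P.Wave →₀ ℂ) : 0 ≤ (preForm P.permKernel b b).re := by
  obtain ⟨n, hn⟩ : ∃ n, ∀ w ∈ b.support, w.length ≤ n :=
    ⟨b.support.sup List.length, fun w hw => Finset.le_sup hw⟩
  have h0 : ∀ c : ℂ, 0 ≤ (conj c * c).re := fun c => by
    rw [mul_comm, Complex.mul_conj]; exact Complex.normSq_nonneg c
  induction n generalizing b with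
  | zero =>
    have : b = Finsupp.single [] (b []) := by
      ext w
      rcases w with _ | ⟨x, w⟩
      · simp
      · have : (x :: w) ∉ b.support := fun h => by simpa using hn _ h
        simpa using this
    rw [this, preForm_single]
    simpa [permKernel] using h0 (b [])
  | succ n ih =>
    rw [(E.preForm_lower b b).2, Complex.add_re, Complex.re_sum]
    refine add_nonneg (h0 _) (Finset.sum_nonneg fun j _ => ?_)
    have : (∫ k, preForm P.permKernel (lower (E.e j k) b) (lower (E.e j k) b) ∂E.μ).re =
        ∫ k, (preForm P.permKernel (lower (E.e j k) b) (lower (E.e j k) b)).re ∂E.μ :=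
      (integral_re ((E.preForm_lower b b).1 j)).symm
    rw [this]
    exact integral_nonneg fun k => ih _ (lower_mem _ hn)

include E in
theorem form_nonneg (Ψ : P.Fock) : 0 ≤ (P.form Ψ Ψ).re := by
  obtain ⟨a, rfl⟩ := (nullSpace P.permKernel).mkQ_surjective Ψ
  exact E.preForm_nonneg a

include E in
/-- The scalar product of the Fock space is definite, by the Cauchy-Schwarz inequality. -/
theorem eq_zero_of_form_self {Ψ : P.Fock} (h : P.form Ψ Ψ = 0) : Ψ = 0 := by
  refine WordSpace.eq_zero_of_form P.permKernel_conj fun Φ => ?_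
  change P.form Φ Ψ = 0
  by_contra hne
  set z := P.form Φ Ψ
  have hz : P.form Ψ Φ = conj z := (P.form_conj Φ Ψ).symm
  have hpos : 0 < Complex.normSq z := Complex.normSq_pos.mpr hne
  -- If Ψ has norm zero, adding t z̄ Ψ to Φ changes the norm of Φ linearly in t.
  have key : ∀ t : ℝ, 0 ≤ (P.form Φ Φ).re + 2 * t * Complex.normSq z := by
    intro t
    have := E.form_nonneg (Φ + ((t : ℂ) * conj z) • Ψ)
    simp only [map_add, LinearMap.add_apply, map_smul, map_smulₛₗ, LinearMap.smul_apply, h, hz,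
      smul_eq_mul, mul_zero, add_zero, map_mul, Complex.conj_conj, Complex.conj_ofReal] at this
    have e : (P.form Φ Φ + (t : ℂ) * conj z * z + (t : ℂ) * z * conj z).re =
        (P.form Φ Φ).re + 2 * t * Complex.normSq z := by
      simp [Complex.normSq_apply]; ring
    rw [← e]
    convert this using 2
    ring
  -- This t makes the linear function equal to -1.
  have := key (-((P.form Φ Φ).re + 1) / (2 * Complex.normSq z))
  field_simp at this
  linarith

end Amplitudes

end OneParticle

namespace Letters

namespace Quartet

variable {A : Letters} {P : OneParticle} (D : A.Quartet P) {F : FreeFields} (ℓ : A.Represents F)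

/-! ### The gauge charge on the space generated by the fields -/

/-- The graded commutator of the charge with a field operator. -/
def bracket (x : F.Sym) : A.Fock →ₗ[ℂ] A.Fock :=
  A.create (D.q.map (ℓ.letter x)) -
    oddSign (F.odd x) • A.annihilate (D.q.map (ℓ.letter (F.adj x)))

theorem charge_field (x : F.Sym) (Ψ : A.Fock) : D.charge (ℓ.field x Ψ) =
    oddSign (F.odd x) • ℓ.field x (D.charge Ψ) + D.bracket ℓ x Ψ := by
  simp only [Represents.field, bracket, charge, LinearMap.add_apply, map_add, OddOp.op_create,
    OddOp.annihilate_op, LinearMap.sub_apply, LinearMap.smul_apply, ℓ.odd_letter, ℓ.odd_adj]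
  cases F.odd x <;> simp [oddSign] <;> abel

/-- `Q` is the gauge charge, transported to the space generated by the fields. -/
def IsCharge (Q : F.Space →ₗ[ℂ] F.Space) : Prop :=
  ∀ Ψ, ℓ.equiv (Q Ψ) = D.charge (ℓ.equiv Ψ)

/-- Vanishing on the vacuum and the commutators with all fields fix an operator by recursion over
words; uniqueness of the gauge charge comes from here. -/
theorem isCharge_of_comm {Q : F.Space →ₗ[ℂ] F.Space} (h₀ : Q F.vacuum = 0)
    (h : ∀ x Ψ, ℓ.equiv (Q (F.op x Ψ)) =
      oddSign (F.odd x) • ℓ.equiv (F.op x (Q Ψ)) + D.bracket ℓ x (ℓ.equiv Ψ)) :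
    D.IsCharge ℓ Q := by
  have : ℓ.equiv.toLinearMap ∘ₗ Q = D.charge ∘ₗ ℓ.equiv.toLinearMap := by
    refine Represents.space_hom_ext F ?_ fun x Ψ hx => ?_
    · simp [h₀, ℓ.equiv_vacuum, OddOp.op_vacuum]
    · simp only [LinearMap.comp_apply, LinearEquiv.coe_coe] at hx ⊢
      rw [h, ℓ.equiv_op, ℓ.equiv_op, charge_field, hx]
  exact fun Ψ => LinearMap.congr_fun this Ψ

/-- The gauge charge on the space generated by the fields. -/
def fieldCharge : F.Space →ₗ[ℂ] F.Space :=
  ℓ.equiv.symm.toLinearMap ∘ₗ D.charge ∘ₗ ℓ.equiv.toLinearMap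

theorem isCharge_fieldCharge : D.IsCharge ℓ (D.fieldCharge ℓ) := fun Ψ => by
  simp [fieldCharge]

variable {ℓ} {D}

theorem IsCharge.eq_fieldCharge {Q : F.Space →ₗ[ℂ] F.Space} (hQ : D.IsCharge ℓ Q) :
    Q = D.fieldCharge ℓ := by
  refine LinearMap.ext fun Ψ => ℓ.equiv.injective ?_
  rw [hQ, D.isCharge_fieldCharge]

theorem IsCharge.vacuum {Q : F.Space →ₗ[ℂ] F.Space} (hQ : D.IsCharge ℓ Q) : Q F.vacuum = 0 := by
  refine ℓ.equiv.injective ?_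
  rw [hQ, ℓ.equiv_vacuum, OddOp.op_vacuum, map_zero]

theorem IsCharge.op {Q : F.Space →ₗ[ℂ] F.Space} (hQ : D.IsCharge ℓ Q) (x : F.Sym) (Ψ : F.Space) :
    ℓ.equiv (Q (F.op x Ψ)) =
      oddSign (F.odd x) • ℓ.equiv (F.op x (Q Ψ)) + D.bracket ℓ x (ℓ.equiv Ψ) := by
  rw [hQ, ℓ.equiv_op, ℓ.equiv_op, charge_field, hQ]

theorem IsCharge.comp_self {Q : F.Space →ₗ[ℂ] F.Space} (hQ : D.IsCharge ℓ Q) : Q ∘ₗ Q = 0 := by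
  refine LinearMap.ext fun Ψ => ℓ.equiv.injective ?_
  rw [LinearMap.comp_apply, hQ, hQ, charge_charge_apply, LinearMap.zero_apply, map_zero]

theorem IsCharge.form {Q : F.Space →ₗ[ℂ] F.Space} (hQ : D.IsCharge ℓ Q) (Ψ Φ : F.Space) :
    F.form (Q Ψ) Φ = F.form Ψ (Q Φ) := by
  rw [← ℓ.form_equiv, ← ℓ.form_equiv, hQ, hQ, OddOp.form_op]

variable (D) (ℓ) in
/-- The embedding of the physical Fock space. -/
def fieldIncl : P.Fock →ₗ[ℂ] F.Space := ℓ.equiv.symm.toLinearMap ∘ₗ D.incl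

theorem equiv_fieldIncl (Φ : P.Fock) : ℓ.equiv (D.fieldIncl ℓ Φ) = D.incl Φ := by
  simp [fieldIncl]

theorem form_fieldIncl (Φ Φ' : P.Fock) :
    F.form (D.fieldIncl ℓ Φ) (D.fieldIncl ℓ Φ') = P.form Φ Φ' := by
  rw [← ℓ.form_equiv, equiv_fieldIncl, equiv_fieldIncl, form_incl]

section

variable {Q : F.Space →ₗ[ℂ] F.Space} (hQ : D.IsCharge ℓ Q)
include hQ

theorem IsCharge.fieldIncl (Φ : P.Fock) : Q (D.fieldIncl ℓ Φ) = 0 := by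
  refine ℓ.equiv.injective ?_
  rw [hQ, equiv_fieldIncl, charge_incl, map_zero]

theorem IsCharge.apply_apply (Ψ : F.Space) : Q (Q Ψ) = 0 := LinearMap.congr_fun hQ.comp_self Ψ

theorem IsCharge.exists_decomposition {Ψ : F.Space} (h : Q Ψ = 0) :
    ∃ Φ χ, Ψ = D.fieldIncl ℓ Φ + Q χ := by
  have h' : ℓ.equiv Ψ ∈ LinearMap.range D.incl ⊔ LinearMap.range D.charge := by
    rw [← ker_charge, LinearMap.mem_ker, ← hQ, h, map_zero]
  obtain ⟨_, ⟨Φ, rfl⟩, _, ⟨χ, rfl⟩, e⟩ := Submodule.mem_sup.mp h'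
  refine ⟨Φ, ℓ.equiv.symm χ, ℓ.equiv.injective ?_⟩
  rw [map_add, equiv_fieldIncl, hQ, LinearEquiv.apply_symm_apply, e]

/-- All terms containing an exact vector vanish: symmetry moves Q to the other argument, which is
closed. -/
theorem IsCharge.form_decomposition (Φ Φ' : P.Fock) (χ χ' : F.Space) :
    F.form (D.fieldIncl ℓ Φ + Q χ) (D.fieldIncl ℓ Φ' + Q χ') = P.form Φ Φ' := by
  simp only [map_add, LinearMap.add_apply, hQ.form, hQ.fieldIncl, hQ.apply_apply, map_zero,
    add_zero, ← hQ.form (D.fieldIncl ℓ Φ), form_fieldIncl, LinearMap.zero_apply]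

/-- On closed vectors the form is that of the physical component, so positivity and the description
of the null vectors reduce to definiteness of the physical Fock space. -/
theorem IsCharge.positive {X ι : Type} [MeasurableSpace X] [Fintype ι] (E : P.Amplitudes X ι) :
    ∀ Ψ ∈ LinearMap.ker Q, (F.form Ψ Ψ).im = 0 ∧ 0 ≤ (F.form Ψ Ψ).re ∧
      (F.form Ψ Ψ = 0 ↔ Ψ ∈ LinearMap.range Q) := by
  intro Ψ hΨ
  obtain ⟨Φ, χ, rfl⟩ := hQ.exists_decomposition hΨ
  rw [hQ.form_decomposition]
  refine ⟨Complex.conj_eq_iff_im.mp (P.form_conj Φ Φ), E.form_nonneg Φ, fun h => ?_, ?_⟩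
  · rw [E.eq_zero_of_form_self h, map_zero, zero_add]
    exact ⟨χ, rfl⟩
  · rintro ⟨χ', h⟩
    rw [← hQ.form_decomposition Φ Φ χ χ, ← h, hQ.form, hQ.apply_apply, map_zero]

/-- The map from the physical Fock space to the cohomology. -/
def IsCharge.toCohomology : P.Fock →ₗ[ℂ] Cohomology Q :=
  ((LinearMap.range Q).submoduleOf (LinearMap.ker Q)).mkQ ∘ₗ
    (D.fieldIncl ℓ).codRestrict (LinearMap.ker Q) hQ.fieldIncl

theorem IsCharge.cls_eq {Ψ : LinearMap.ker Q} {Φ : P.Fock} {χ : F.Space}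
    (h : (Ψ : F.Space) = D.fieldIncl ℓ Φ + Q χ) : cls Q Ψ = hQ.toCohomology Φ := by
  refine (Submodule.Quotient.eq _).mpr ?_
  refine ⟨χ, ?_⟩
  change _ = (Ψ : F.Space) - D.fieldIncl ℓ Φ
  rw [h]
  exact (add_sub_cancel_left _ _).symm

/-- Surjectivity is the decomposition of closed vectors. For injectivity, an exact physical vector
is orthogonal to all physical vectors, and the physical form is nondegenerate. -/
theorem IsCharge.toCohomology_bijective : Function.Bijective hQ.toCohomology := by
  constructor
  · rw [← LinearMap.ker_eq_bot, LinearMap.ker_eq_bot']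
    intro Φ h
    have h' := (Submodule.Quotient.mk_eq_zero _).mp h
    obtain ⟨χ, hχ⟩ := h'
    change Q χ = D.fieldIncl ℓ Φ at hχ
    refine WordSpace.eq_zero_of_form P.permKernel_conj fun Φ' => ?_
    change P.form Φ' Φ = 0
    rw [← form_fieldIncl (D := D) (ℓ := ℓ), ← hχ, ← hQ.form, hQ.fieldIncl, map_zero,
      LinearMap.zero_apply]
  · intro c
    obtain ⟨Ψ, rfl⟩ := Submodule.mkQ_surjective _ c
    obtain ⟨Φ, χ, h⟩ := hQ.exists_decomposition Ψ.2
    exact ⟨Φ, (hQ.cls_eq h).symm⟩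

/-- The isomorphism of the cohomology with the physical Fock space. -/
def IsCharge.iso : Cohomology Q ≃ₗ[ℂ] P.Fock :=
  (LinearEquiv.ofBijective hQ.toCohomology hQ.toCohomology_bijective).symm

theorem IsCharge.iso_cls {Ψ : LinearMap.ker Q} {Φ : P.Fock} {χ : F.Space}
    (h : (Ψ : F.Space) = D.fieldIncl ℓ Φ + Q χ) : hQ.iso (cls Q Ψ) = Φ := by
  rw [hQ.cls_eq h, IsCharge.iso, LinearEquiv.symm_apply_eq]
  rfl

theorem IsCharge.form_iso (Ψ Ψ' : LinearMap.ker Q) :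
    P.form (hQ.iso (cls Q Ψ)) (hQ.iso (cls Q Ψ')) = F.form Ψ Ψ' := by
  obtain ⟨Φ, χ, h⟩ := hQ.exists_decomposition Ψ.2
  obtain ⟨Φ', χ', h'⟩ := hQ.exists_decomposition Ψ'.2
  rw [hQ.iso_cls h, hQ.iso_cls h', h, h', hQ.form_decomposition]

theorem IsCharge.iso_vacuum : ∃ h : F.vacuum ∈ LinearMap.ker Q,
    hQ.iso (cls Q ⟨F.vacuum, h⟩) = P.vacuum := by
  refine ⟨hQ.vacuum, hQ.iso_cls (χ := 0) ?_⟩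
  refine ℓ.equiv.injective ?_
  rw [map_zero, add_zero, equiv_fieldIncl, incl_vacuum]
  exact ℓ.equiv_vacuum

/-- Gauge invariant even fields act on the cohomology by the field operators of the Fock space. -/
theorem IsCharge.iso_field {B : F.Space →ₗ[ℂ] F.Space} {x x' : A.L}
    (hB : ∀ Ψ, ℓ.equiv (B Ψ) = A.create x (ℓ.equiv Ψ) + A.annihilate x' (ℓ.equiv Ψ))
    (hx : A.odd x = false) (hx' : A.odd x' = false) (hqx : ∀ t, A.inner t (D.q.map x) = 0)
    (hqx' : ∀ t, A.inner t (D.q.map x') = 0) {ψ ψ' : P.Wave}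
    (hψ : ∀ t, A.inner t x = A.inner t (D.phys ψ) + A.inner t (D.q.map (D.r.map x)))
    (hψ' : ∀ φ, A.inner x' (D.phys φ) = P.inner ψ' φ) (Ψ : LinearMap.ker Q) :
    ∃ h : B Ψ ∈ LinearMap.ker Q, hQ.iso (cls Q ⟨B Ψ, h⟩) =
      P.create ψ (hQ.iso (cls Q Ψ)) + P.annihilate ψ' (hQ.iso (cls Q Ψ)) := by
  -- Both letters of the field are even and killed by q, so the field commutes with Q and acts on
  -- the cohomology.
  have hcomm : ∀ χ, B (Q χ) = Q (B χ) := by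
    intro χ
    refine ℓ.equiv.injective ?_
    rw [hB, hQ, hQ, hB, map_add, OddOp.op_create, OddOp.annihilate_op, A.create_eq_zero hqx,
      A.annihilate_eq_zero hqx', hx, hx']
    simp [oddSign]
  have hker : B Ψ ∈ LinearMap.ker Q := by
    rw [LinearMap.mem_ker, ← hcomm, Ψ.2, map_zero]
  obtain ⟨Φ, χ, h⟩ := hQ.exists_decomposition Ψ.2
  refine ⟨hker, ?_⟩
  rw [hQ.iso_cls h]
  -- The letter `x` is physical up to q(rx), and on vectors closed under Q the operator a†(q(rx))
  -- equals Q a†(rx). This provides the first exact term; the second comes from the exact part of Ψ.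
  refine hQ.iso_cls (χ := ℓ.equiv.symm (A.create (D.r.map x) (D.incl Φ)) + B χ) ?_
  change B Ψ = _
  rw [h, map_add, hcomm, map_add Q, ← add_assoc]
  congr 1
  refine ℓ.equiv.injective ?_
  have hcr : A.create x = A.create (D.phys ψ) + A.create (D.q.map (D.r.map x)) :=
    A.create_add (by rw [hx, D.odd_phys]) (by simp [OddOp.odd_map]) hψ
  rw [hB, map_add, hQ, LinearEquiv.apply_symm_apply, equiv_fieldIncl, equiv_fieldIncl, map_add,
    incl_create, D.annihilate_incl hx' hψ', OddOp.op_create, charge_incl, hcr]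
  simp only [LinearMap.add_apply, map_zero, smul_zero, add_zero]
  abel

end

end Quartet
end Letters

/-! ### The Fourier transform on the mass shells -/

/-- The frequency at which the Fourier transform gives the restriction to the upper mass shell. -/
def shellFreq (m : ℝ) (k : Momentum) : Spacetime :=
  WithLp.toLp 2 fun μ => -(eta μ * shellPoint m k μ) / (2 * Real.pi)

/-- The sign and the factor 2π in `shellFreq` translate the kernel exp(-2πi x·ξ) with Euclidean
product into exp(i p·x) with Minkowski product. -/
theorem inner_shellFreq (m : ℝ) (k : Momentum) (x : Spacetime) :
    2 * Real.pi * inner ℝ x (shellFreq m k) = -shellDot m k x := by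
  simp only [PiLp.inner_apply, shellFreq, shellDot, Finset.mul_sum, ← Finset.sum_neg_distrib,
    RCLike.inner_apply, conj_trivial]
  refine Finset.sum_congr rfl fun μ _ => ?_
  field_simp

theorem posFT_eq (m : ℝ) (f : TestFun) (k : Momentum) : posFT m f k = 𝓕 f (shellFreq m k) := by
  rw [SchwartzMap.fourier_coe, Real.fourier_eq, posFT]
  congr 1
  ext x
  rw [Circle.smul_def, Real.fourierChar_apply, smul_eq_mul, mul_neg, inner_shellFreq, neg_neg,
    mul_comm Complex.I]

theorem negFT_eq (m : ℝ) (f : TestFun) (k : Momentum) : negFT m f k = 𝓕 f (-shellFreq m k) := by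
  rw [SchwartzMap.fourier_coe, Real.fourier_eq, negFT]
  congr 1
  ext x
  rw [Circle.smul_def, Real.fourierChar_apply, smul_eq_mul, inner_neg_right, neg_neg,
    inner_shellFreq, Complex.ofReal_neg, neg_mul, mul_comm Complex.I]

theorem posFT_conjTest (m : ℝ) (f : TestFun) (k : Momentum) :
    posFT m (conjTest f) k = conj (negFT m f k) := by
  rw [posFT_eq, fourier_conjTest, negFT_eq]

theorem posFT_add (m : ℝ) (f g : TestFun) (k : Momentum) :
    posFT m (f + g) k = posFT m f k + posFT m g k := by
  simp [posFT_eq, FourierTransform.fourier_add]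

theorem posFT_smul (m : ℝ) (c : ℂ) (f : TestFun) (k : Momentum) :
    posFT m (c • f) k = c * posFT m f k := by
  simp [posFT_eq, FourierTransform.fourier_smul]

theorem negFT_smul (m : ℝ) (c : ℂ) (f : TestFun) (k : Momentum) :
    negFT m (c • f) k = c * negFT m f k := by
  simp [negFT_eq, FourierTransform.fourier_smul]

theorem negFT_add (m : ℝ) (f g : TestFun) (k : Momentum) :
    negFT m (f + g) k = negFT m f k + negFT m g k := by
  simp [negFT_eq, FourierTransform.fourier_add]

theorem fourier_partialD (μ : Fin 4) (f : TestFun) (ξ : Spacetime) :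
    𝓕 (partialD μ f) ξ = 2 * Real.pi * Complex.I * ξ μ * 𝓕 f ξ := by
  rw [partialD, SchwartzMap.fourier_lineDerivOp_eq]
  have hg : (fun x : Spacetime => inner ℝ x (EuclideanSpace.single μ (1 : ℝ))).HasTemperateGrowth := by
    fun_prop
  simp only [smul_apply]
  rw [SchwartzMap.smulLeftCLM_apply_apply hg]
  simp [PiLp.inner_apply]
  ring

theorem posFT_partialD (m : ℝ) (μ : Fin 4) (f : TestFun) (k : Momentum) :
    posFT m (partialD μ f) k = -(Complex.I * eta μ * shellPoint m k μ) * posFT m f k := by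
  have : (Real.pi : ℂ) ≠ 0 := by exact_mod_cast Real.pi_ne_zero
  rw [posFT_eq, fourier_partialD, ← posFT_eq]
  simp only [shellFreq]
  push_cast
  field_simp

theorem negFT_partialD (m : ℝ) (μ : Fin 4) (f : TestFun) (k : Momentum) :
    negFT m (partialD μ f) k = Complex.I * eta μ * shellPoint m k μ * negFT m f k := by
  have : (Real.pi : ℂ) ≠ 0 := by exact_mod_cast Real.pi_ne_zero
  rw [negFT_eq, fourier_partialD, ← negFT_eq]
  simp only [shellFreq, PiLp.neg_apply]
  push_cast
  field_simp

theorem continuous_energy (m : ℝ) : Continuous (energy m) := by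
  unfold energy; fun_prop

theorem energy_nonneg (m : ℝ) (k : Momentum) : 0 ≤ energy m k := Real.sqrt_nonneg _

theorem energy_sq (m : ℝ) (k : Momentum) : energy m k ^ 2 = m ^ 2 + ‖k‖ ^ 2 :=
  Real.sq_sqrt (by positivity)

theorem energy_zero (k : Momentum) : energy 0 k = ‖k‖ := by simp [energy]

theorem norm_le_energy (m : ℝ) (k : Momentum) : ‖k‖ ≤ energy m k :=
  Real.le_sqrt_of_sq_le (by nlinarith [sq_nonneg m])

theorem mass_le_energy {m : ℝ} (k : Momentum) : m ≤ energy m k :=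
  Real.le_sqrt_of_sq_le (by nlinarith [sq_nonneg ‖k‖])

theorem continuous_shellFreq (m : ℝ) : Continuous (shellFreq m) := by
  unfold shellFreq
  have := continuous_energy m
  refine (PiLp.continuous_toLp 2 _).comp (continuous_pi fun μ => ?_)
  refine Continuous.div_const (Continuous.neg (Continuous.mul continuous_const ?_)) _
  refine Fin.cases ?_ (fun j => ?_) μ
  · simpa [shellPoint] using this
  · simp only [shellPoint, Fin.cons_succ]; fun_prop

theorem continuous_posFT (m : ℝ) (f : TestFun) : Continuous (posFT m f) := by
  have : posFT m f = fun k => 𝓕 f (shellFreq m k) := funext (posFT_eq m f)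
  rw [this]
  exact (𝓕 f).continuous.comp (continuous_shellFreq m)

theorem norm_sq_shellFreq (m : ℝ) (k : Momentum) :
    (2 * Real.pi) ^ 2 * ‖shellFreq m k‖ ^ 2 = energy m k ^ 2 + ‖k‖ ^ 2 := by
  rw [EuclideanSpace.norm_sq_eq, EuclideanSpace.norm_sq_eq, Fin.sum_univ_succ, mul_add,
    Finset.mul_sum]
  congr 1
  · simp [shellFreq, shellPoint, eta]
    field_simp
    simp
  · refine Finset.sum_congr rfl fun j _ => ?_
    simp [shellFreq, shellPoint, eta, Fin.succ_ne_zero]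
    field_simp
    simp

theorem energy_le_norm_shellFreq (m : ℝ) (k : Momentum) :
    energy m k ≤ 2 * Real.pi * ‖shellFreq m k‖ := by
  refine le_of_sq_le_sq ?_ (by positivity)
  rw [mul_pow, norm_sq_shellFreq]
  nlinarith [sq_nonneg ‖k‖]

theorem norm_shellFreq_le (m : ℝ) (k : Momentum) : ‖shellFreq m k‖ ≤ energy m k := by
  refine le_of_sq_le_sq ?_ (energy_nonneg m k)
  have h := norm_sq_shellFreq m k
  have h1 : ‖k‖ ^ 2 ≤ energy m k ^ 2 := by
    rw [energy_sq]; nlinarith [sq_nonneg m]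
  have h2 : 2 ≤ (2 * Real.pi) ^ 2 := by nlinarith [Real.pi_gt_three]
  nlinarith [sq_nonneg ‖shellFreq m k‖]

/-- Schwartz functions decrease rapidly on the mass shell. -/
theorem exists_norm_posFT_le (m : ℝ) (f : TestFun) (n : ℕ) :
    ∃ C, 0 ≤ C ∧ ∀ k, ‖posFT m f k‖ ≤ C * ((1 + ‖k‖) ^ n)⁻¹ := by
  refine ⟨(2 * Real.pi) ^ n * (2 ^ n * (Finset.Iic (n, 0)).sup
    (fun m => SchwartzMap.seminorm ℂ m.1 m.2) (𝓕 f)), by positivity, fun k => ?_⟩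
  have h := SchwartzMap.one_add_le_sup_seminorm_apply (𝕜 := ℂ) (m := (n, 0)) (k := n) (n := 0)
    le_rfl le_rfl (𝓕 f) (shellFreq m k)
  rw [norm_iteratedFDeriv_zero, ← posFT_eq] at h
  rw [← div_eq_mul_inv, le_div_iff₀ (by positivity)]
  -- On the shell |k| ≤ ω ≤ 2π‖ξ‖, so decay in the frequency ξ implies decay in k.
  have h1 : 1 + ‖k‖ ≤ 2 * Real.pi * (1 + ‖shellFreq m k‖) := by
    have := (norm_le_energy m k).trans (energy_le_norm_shellFreq m k)
    nlinarith [Real.pi_gt_three]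
  calc ‖posFT m f k‖ * (1 + ‖k‖) ^ n
      ≤ ‖posFT m f k‖ * (2 * Real.pi * (1 + ‖shellFreq m k‖)) ^ n := by gcongr
    _ = (2 * Real.pi) ^ n * ((1 + ‖shellFreq m k‖) ^ n * ‖posFT m f k‖) := by
        rw [mul_pow]; ring
    _ ≤ _ := by gcongr

/-- The restrictions of the test functions to the mass shell compensate the singularity of the
invariant measure at `ω = 0`. -/
def TestSpace.Regular (T : TestSpace) (m : ℝ) : Prop :=
  ∀ f ∈ T.carrier, ∃ C, 0 ≤ C ∧ ∀ k, ‖posFT m f k‖ ≤ C * energy m k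

theorem regular_allTest {m : ℝ} (hm : 0 < m) : allTest.Regular m := by
  intro f _
  obtain ⟨C, hC, h⟩ := exists_norm_posFT_le m f 0
  refine ⟨C / m, by positivity, fun k => (h k).trans ?_⟩
  have : m ≤ energy m k := mass_le_energy k
  rw [pow_zero, inv_one, mul_one, div_mul_eq_mul_div, le_div_iff₀ hm]
  gcongr

theorem exists_ball_of_infrared {f : TestFun} (hf : f ∈ infraredTest.carrier) :
    ∃ δ > 0, ∀ ξ : Spacetime, ‖ξ‖ < δ → 𝓕 f ξ = 0 := by
  obtain ⟨δ, hδ, h⟩ := Metric.eventually_nhds_iff.mp (show ∀ᶠ ξ in nhds (0 : Spacetime), 𝓕 f ξ = 0 from hf)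
  exact ⟨δ, hδ, fun ξ hξ => h (by simpa using hξ)⟩

/-- Since ‖ξ‖ ≤ ω on the shell, small ω lies in the ball where the Fourier transform vanishes;
elsewhere ω ≥ δ and the uniform bound C gives (C/δ) ω. -/
theorem regular_infraredTest (m : ℝ) : infraredTest.Regular m := by
  intro f hf
  obtain ⟨δ, hδ, hz⟩ := exists_ball_of_infrared hf
  obtain ⟨C, hC, h⟩ := exists_norm_posFT_le m f 0
  refine ⟨C / δ, by positivity, fun k => ?_⟩
  by_cases hk : energy m k < δ
  · rw [posFT_eq, hz _ ((norm_shellFreq_le m k).trans_lt hk), norm_zero]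
    have := energy_nonneg m k
    positivity
  · refine (h k).trans ?_
    rw [pow_zero, inv_one, mul_one, div_mul_eq_mul_div, le_div_iff₀ hδ]
    gcongr
    exact not_lt.mp hk

theorem posFT_infrared_zero (f : infraredTest.Fun) : posFT 0 f 0 = 0 := by
  obtain ⟨C, -, h⟩ := regular_infraredTest 0 f f.2
  simpa [energy_zero] using h 0

theorem measurable_shellDensity (m : ℝ) : Measurable fun k : Momentum =>
    ((2 * Real.pi) ^ 3)⁻¹ / (2 * energy m k) := by
  have := (continuous_energy m).measurable
  fun_prop

/-- One factor, bounded by a multiple of ω, cancels the 1/ω of the measure; the other decays like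
the fourth inverse power, which is integrable in dimension three. -/
theorem integrable_posFT {T : TestSpace} {m : ℝ} (hT : T.Regular m) (f g : T.Fun) :
    Integrable (fun k => conj (posFT m f k) * posFT m g k) (shellMeasure m) := by
  rw [shellMeasure, integrable_withDensity_iff_integrable_smul']
  rotate_left
  · exact (measurable_shellDensity m).ennreal_ofReal
  · simp
  obtain ⟨C, hC0, hC⟩ := hT f f.2
  obtain ⟨C', hC', h'⟩ := exists_norm_posFT_le m g 4
  have hint : Integrable (fun k : Momentum => C * C' * (1 + ‖k‖) ^ (-(4 : ℝ))) :=
    (integrable_one_add_norm (by simp; norm_num)).const_mul _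
  refine hint.mono' ?_ (Eventually.of_forall fun k => ?_)
  · refine ((measurable_shellDensity m).ennreal_ofReal.ennreal_toReal.aestronglyMeasurable).smul ?_
    exact ((Complex.continuous_conj.comp (continuous_posFT m f)).mul
      (continuous_posFT m g)).aestronglyMeasurable
  · have hd : ((2 * Real.pi) ^ 3)⁻¹ ≤ 1 := by
      apply inv_le_one_of_one_le₀
      exact one_le_pow₀ (by nlinarith [Real.pi_gt_three])
    have he := energy_nonneg m k
    have hnn : 0 ≤ ((2 * Real.pi) ^ 3)⁻¹ / (2 * energy m k) := by positivity
    rw [norm_smul, norm_mul, RCLike.norm_conj, ENNReal.toReal_ofReal hnn, Real.norm_of_nonneg hnn,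
      ← mul_assoc]
    have h1 : ((2 * Real.pi) ^ 3)⁻¹ / (2 * energy m k) * ‖posFT m f k‖ ≤ C := by
      -- At ω = 0 the density is 0 by the convention for division by zero.
      rcases he.eq_or_lt with h0 | h0
      · rw [← h0]
        simpa using hC0
      · rw [div_mul_eq_mul_div, div_le_iff₀ (by positivity)]
        calc _ ≤ 1 * (C * energy m k) := by gcongr; exact hC k
          _ ≤ _ := by
            have := mul_nonneg hC0 he
            linarith
    have h2 : (1 + ‖k‖) ^ (-(4 : ℝ)) = ((1 + ‖k‖) ^ 4)⁻¹ := by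
      rw [Real.rpow_neg (by positivity)]
      norm_cast
    rw [h2, mul_assoc C]
    exact mul_le_mul h1 (h' k) (norm_nonneg _) hC0

/-- The value of the Fourier transform at a point of the upper mass shell. -/
def TestSpace.hat (T : TestSpace) (m : ℝ) (k : Momentum) : T.Fun →ₗ[ℂ] ℂ where
  toFun f := posFT m f k
  map_add' f g := posFT_add m f g k
  map_smul' c f := posFT_smul m c f k

theorem TestSpace.hat_apply (T : TestSpace) (m : ℝ) (k : Momentum) (f : T.Fun) :
    T.hat m k f = posFT m f k := rfl

/-! ### One-particle states of a family of Bose fields and a pair of ghost fields -/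

section ShellLetters

variable (T : TestSpace) (m : ℝ) {ι : Type} [Fintype ι] (σ : ι → ℝ)

/-- The density of the scalar product, with the signs `σ` for the Bose fields. -/
def letterDensity : (ι → T.Fun) ⊕ (T.Fun × T.Fun) → (ι → T.Fun) ⊕ (T.Fun × T.Fun) → Momentum → ℂ
  | .inl x, .inl y => fun k => ∑ i, σ i * (conj (T.hat m k (x i)) * T.hat m k (y i))
  | .inr x, .inr y => fun k =>
      conj (T.hat m k x.1) * T.hat m k y.2 + conj (T.hat m k x.2) * T.hat m k y.1
  | _, _ => 0

theorem conj_letterDensity (x y : (ι → T.Fun) ⊕ (T.Fun × T.Fun)) (k : Momentum) :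
    conj (letterDensity T m σ x y k) = letterDensity T m σ y x k := by
  rcases x with x | x <;> rcases y with y | y <;> simp [letterDensity]
  · exact Finset.sum_congr rfl fun i _ => by ring
  · ring

/-- The one-particle states of Bose fields with the signs `σ`, and of a pair of ghost fields. -/
def shellLetters : Letters where
  L := (ι → T.Fun) ⊕ (T.Fun × T.Fun)
  odd := Sum.isRight
  inner x y := ∫ k, letterDensity T m σ x y k ∂(shellMeasure m)
  conj_inner x y := by
    rw [← integral_conj]
    simp only [conj_letterDensity]
  inner_eq_zero x y h := by
    rcases x with x | x <;> rcases y with y | y <;> simp [letterDensity] at h ⊢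

variable {T m} (hT : T.Regular m)
include hT

theorem integrable_letterDensity (x y : (ι → T.Fun) ⊕ (T.Fun × T.Fun)) :
    Integrable (letterDensity T m σ x y) (shellMeasure m) := by
  rcases x with x | x <;> rcases y with y | y
  · exact integrable_finsetSum _ fun i _ => (integrable_posFT hT _ _).const_mul _
  · exact integrable_zero _ _ _
  · exact integrable_zero _ _ _
  · exact (integrable_posFT hT _ _).add (integrable_posFT hT _ _)

/-- This is how linear relations between letters are obtained throughout: pointwise on the shell,
then by integration. -/
theorem shellLetters_inner_sum {κ : Type} (s : Finset κ) (c : κ → ℂ)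
    (x : (ι → T.Fun) ⊕ (T.Fun × T.Fun)) (y : κ → (ι → T.Fun) ⊕ (T.Fun × T.Fun))
    (t : (ι → T.Fun) ⊕ (T.Fun × T.Fun))
    (h : ∀ k, letterDensity T m σ t x k = ∑ a ∈ s, c a * letterDensity T m σ t (y a) k) :
    (shellLetters T m σ).inner t x = ∑ a ∈ s, c a * (shellLetters T m σ).inner t (y a) := by
  change ∫ k, _ ∂_ = ∑ a ∈ s, c a * ∫ k, _ ∂_
  simp only [h]
  rw [integral_finsetSum _ fun a _ => (integrable_letterDensity σ hT t (y a)).const_mul _]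
  exact Finset.sum_congr rfl fun a _ => integral_const_mul _ _

theorem inner_inl_sum {κ : Type} (s : Finset κ) (c : κ → ℂ) (x : ι → T.Fun) (y : κ → ι → T.Fun)
    (h : ∀ i k, T.hat m k (x i) = ∑ a ∈ s, c a * T.hat m k (y a i))
    (t : (ι → T.Fun) ⊕ (T.Fun × T.Fun)) : (shellLetters T m σ).inner t (.inl x) =
      ∑ a ∈ s, c a * (shellLetters T m σ).inner t (.inl (y a)) := by
  refine shellLetters_inner_sum σ hT s c _ (fun a => .inl (y a)) t fun k => ?_
  rcases t with t | t
  · simp only [letterDensity, h, Finset.mul_sum]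
    rw [Finset.sum_comm]
    exact Finset.sum_congr rfl fun a _ => Finset.sum_congr rfl fun i _ => by ring
  · simp [letterDensity]

theorem inner_inr_sum {κ : Type} (s : Finset κ) (c : κ → ℂ) (x : T.Fun × T.Fun)
    (y : κ → T.Fun × T.Fun)
    (h : ∀ k, T.hat m k x.1 = ∑ a ∈ s, c a * T.hat m k (y a).1)
    (h' : ∀ k, T.hat m k x.2 = ∑ a ∈ s, c a * T.hat m k (y a).2)
    (t : (ι → T.Fun) ⊕ (T.Fun × T.Fun)) : (shellLetters T m σ).inner t (.inr x) =
      ∑ a ∈ s, c a * (shellLetters T m σ).inner t (.inr (y a)) := by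
  refine shellLetters_inner_sum σ hT s c _ (fun a => .inr (y a)) t fun k => ?_
  rcases t with t | t
  · simp [letterDensity]
  · simp only [letterDensity, h, h', Finset.mul_sum]
    rw [← Finset.sum_add_distrib]
    exact Finset.sum_congr rfl fun a _ => by ring

theorem inner_inl_zero {x : ι → T.Fun} (h : ∀ i k, T.hat m k (x i) = 0)
    (t : (ι → T.Fun) ⊕ (T.Fun × T.Fun)) : (shellLetters T m σ).inner t (.inl x) = 0 := by
  simpa using inner_inl_sum σ hT (κ := Empty) ∅ (fun _ => 0) x (fun _ => x) (by simpa using h) t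

theorem inner_inr_zero {x : T.Fun × T.Fun} (h : ∀ k, T.hat m k x.1 = 0)
    (h' : ∀ k, T.hat m k x.2 = 0)
    (t : (ι → T.Fun) ⊕ (T.Fun × T.Fun)) : (shellLetters T m σ).inner t (.inr x) = 0 := by
  simpa using inner_inr_sum σ hT (κ := Empty) ∅ (fun _ => 0) x (fun _ => x) (by simpa using h)
    (by simpa using h') t

theorem inner_inl_add {x y z : ι → T.Fun}
    (h : ∀ i k, T.hat m k (x i) = T.hat m k (y i) + T.hat m k (z i))
    (t : (ι → T.Fun) ⊕ (T.Fun × T.Fun)) : (shellLetters T m σ).inner t (.inl x) =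
      (shellLetters T m σ).inner t (.inl y) + (shellLetters T m σ).inner t (.inl z) := by
  simpa using inner_inl_sum σ hT (κ := Bool) Finset.univ (fun _ => 1) x
    (fun b => if b then y else z) (by simpa using h) t

theorem inner_inr_add {x y z : T.Fun × T.Fun}
    (h : ∀ k, T.hat m k x.1 = T.hat m k y.1 + T.hat m k z.1)
    (h' : ∀ k, T.hat m k x.2 = T.hat m k y.2 + T.hat m k z.2)
    (t : (ι → T.Fun) ⊕ (T.Fun × T.Fun)) : (shellLetters T m σ).inner t (.inr x) =
      (shellLetters T m σ).inner t (.inr y) + (shellLetters T m σ).inner t (.inr z) := by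
  simpa using inner_inr_sum σ hT (κ := Bool) Finset.univ (fun _ => 1) x
    (fun b => if b then y else z) (by simpa using h) (by simpa using h') t

end ShellLetters

/-! ### Multipliers and null directions on the mass shell -/

/-- Multiplication by a function on the mass shell, realized on test functions. -/
structure ShellMultiplier (T : TestSpace) (m : ℝ) where
  symbol : Momentum → ℂ
  map : T.Fun → T.Fun
  dual : T.Fun → T.Fun
  hat_map : ∀ f k, T.hat m k (map f) = symbol k * T.hat m k f
  hat_dual : ∀ f k, T.hat m k (dual f) = conj (symbol k) * T.hat m k f

/-- Gauge and conjugate directions in the one-particle space, and the states orthogonal to them. -/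
structure ShellQuartet (T : TestSpace) (m : ℝ) (ι : Type) [Fintype ι] (σ : ι → ℝ)
    (P : OneParticle) where
  regular : T.Regular m
  e : ι → ShellMultiplier T m
  l : ι → ShellMultiplier T m
  e_e : ∀ k, ∑ i, σ i * (conj ((e i).symbol k) * (e i).symbol k) = 0
  l_l : ∀ k, ∑ i, σ i * (conj ((l i).symbol k) * (l i).symbol k) = 0
  e_l : ∀ k, (∀ f, T.hat m k f = 0) ∨ ∑ i, σ i * (conj ((e i).symbol k) * (l i).symbol k) = 1
  phys : P.Wave → ι → T.Fun
  inner_phys : ∀ ψ φ, ∫ k, letterDensity T m σ (.inl (phys ψ)) (.inl (phys φ)) k ∂(shellMeasure m) =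
    P.inner ψ φ
  e_phys : ∀ ψ k, ∑ i, σ i * (conj ((e i).symbol k) * T.hat m k (phys ψ i)) = 0
  l_phys : ∀ ψ k, ∑ i, σ i * (conj ((l i).symbol k) * T.hat m k (phys ψ i)) = 0
  exists_phys : ∀ x : ι → T.Fun,
    (∀ k, ∑ i, σ i * (conj ((e i).symbol k) * T.hat m k (x i)) = 0) →
    (∀ k, ∑ i, σ i * (conj ((l i).symbol k) * T.hat m k (x i)) = 0) →
    ∃ ψ, ∀ i k, T.hat m k (phys ψ i) = T.hat m k (x i)

/-! ### Odd operators given by a direction in the space of multiplets -/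

section Pairing

variable {T : TestSpace} {m : ℝ} {ι : Type} [Fintype ι] (σ : ι → ℝ)

/-- The pairing of a multiplet of test functions with a direction. -/
def directionPairing (e : ι → ShellMultiplier T m) (x : ι → T.Fun) : T.Fun :=
  ∑ i, (σ i : ℂ) • (e i).dual (x i)

theorem hat_directionPairing (e : ι → ShellMultiplier T m) (x : ι → T.Fun) (k : Momentum) :
    T.hat m k (directionPairing σ e x) =
      ∑ i, σ i * (conj ((e i).symbol k) * T.hat m k (x i)) := by
  simp [directionPairing, (e _).hat_dual]

/-- The odd operator which maps the first ghost (for `b = false`) or the second one to a multiplet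
along a direction. -/
def directionMap (e : ι → ShellMultiplier T m) (b : Bool) :
    (ι → T.Fun) ⊕ (T.Fun × T.Fun) → (ι → T.Fun) ⊕ (T.Fun × T.Fun)
  | .inl x => .inr (if b then (directionPairing σ e x, 0) else (0, directionPairing σ e x))
  | .inr x => .inl fun i => (e i).map (if b then x.2 else x.1)

/-- Multiplication along `e` and pairing with `e` are adjoint for the Bose form. The ghost form
pairs the first ghost with the second, which is why the pairing lands in the slot opposite to the
one read. -/
theorem directionMap_symm (e : ι → ShellMultiplier T m) (b : Bool)
    (x y : (ι → T.Fun) ⊕ (T.Fun × T.Fun)) (k : Momentum) :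
    letterDensity T m σ (directionMap σ e b x) y k =
      letterDensity T m σ x (directionMap σ e b y) k := by
  rcases x with x | x <;> rcases y with y | y
  · rfl
  · cases b <;> simp only [directionMap, letterDensity, hat_directionPairing, (e _).hat_map,
      if_true, map_zero, zero_mul, zero_add, add_zero, map_sum, Finset.sum_mul, Bool.false_eq_true,
      if_false] <;>
    exact Finset.sum_congr rfl fun i _ => by simp; ring
  · cases b <;> simp only [directionMap, letterDensity, hat_directionPairing, (e _).hat_map,
      if_true, map_zero, mul_zero, zero_add, add_zero, Finset.mul_sum, Bool.false_eq_true,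
      if_false] <;>
    exact Finset.sum_congr rfl fun i _ => by simp; ring
  · rfl

/-- `directionMap` as an odd symmetric operator. -/
def directionOp (e : ι → ShellMultiplier T m) (b : Bool) : (shellLetters T m σ).OddOp where
  map := directionMap σ e b
  odd_map x := by rcases x with x | x <;> rfl
  symm x y := integral_congr_ae (Eventually.of_forall (directionMap_symm σ e b x y))

end Pairing

/-! ### From two conjugate null directions to a quartet -/

namespace ShellQuartet

variable {T : TestSpace} {m : ℝ} {ι : Type} [Fintype ι] {σ : ι → ℝ} {P : OneParticle}
  (S : ShellQuartet T m ι σ P)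

/-- The normalization ⟨e, l⟩ = 1 may fail where all test functions vanish, as at k = 0 in the
massless case; multiplied by such a function it holds everywhere. -/
theorem e_l_mul (k : Momentum) (f : T.Fun) :
    (∑ i, σ i * (conj ((S.e i).symbol k) * (S.l i).symbol k)) * T.hat m k f = T.hat m k f := by
  rcases S.e_l k with h | h
  · rw [h f, mul_zero]
  · rw [h, one_mul]

theorem l_e_mul (k : Momentum) (f : T.Fun) :
    (∑ i, σ i * (conj ((S.l i).symbol k) * (S.e i).symbol k)) * T.hat m k f = T.hat m k f := by
  rcases S.e_l k with h | h
  · rw [h f, mul_zero]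
  · have := congrArg conj h
    rw [map_sum, map_one] at this
    refine (congrArg (· * T.hat m k f) (Eq.trans ?_ this)).trans (one_mul _)
    refine Finset.sum_congr rfl fun i _ => ?_
    simp only [map_mul, Complex.conj_conj, Complex.conj_ofReal]
    ring

/-- The pairing of a direction with the multiplet obtained along two directions. -/
theorem pairing_add (d : ι → ShellMultiplier T m) (f g : T.Fun) (k : Momentum) :
    ∑ i, σ i * (conj ((d i).symbol k) *
      T.hat m k ((S.e i).map f + (S.l i).map g)) =
    (∑ i, σ i * (conj ((d i).symbol k) * (S.e i).symbol k)) * T.hat m k f +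
      (∑ i, σ i * (conj ((d i).symbol k) * (S.l i).symbol k)) * T.hat m k g := by
  rw [Finset.sum_mul, Finset.sum_mul, ← Finset.sum_add_distrib]
  refine Finset.sum_congr rfl fun i _ => ?_
  rw [map_add, (S.e i).hat_map, (S.l i).hat_map]
  ring

/-- The unphysical part of a multiplet. -/
def unphys (x : ι → T.Fun) (i : ι) : T.Fun :=
  (S.e i).map (directionPairing σ S.l x) + (S.l i).map (directionPairing σ S.e x)

/-- With e and l null and ⟨e, l⟩ = 1, `unphys` is the projection onto their span along the
orthogonal complement, so it preserves both pairings. -/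
theorem pairing_e_unphys (x : ι → T.Fun) (k : Momentum) :
    ∑ i, σ i * (conj ((S.e i).symbol k) * T.hat m k (S.unphys x i)) =
      ∑ i, σ i * (conj ((S.e i).symbol k) * T.hat m k (x i)) := by
  simp only [unphys]
  rw [S.pairing_add, S.e_e, zero_mul, zero_add, S.e_l_mul, hat_directionPairing]

theorem pairing_l_unphys (x : ι → T.Fun) (k : Momentum) :
    ∑ i, σ i * (conj ((S.l i).symbol k) * T.hat m k (S.unphys x i)) =
      ∑ i, σ i * (conj ((S.l i).symbol k) * T.hat m k (x i)) := by
  simp only [unphys]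
  rw [S.pairing_add, S.l_l, zero_mul, add_zero, S.l_e_mul, hat_directionPairing]

/-- The remainder x - `unphys` x is orthogonal to both directions, hence physical by `exists_phys`.
-/
theorem exists_phys_add_unphys (x : ι → T.Fun) : ∃ ψ, ∀ i k,
    T.hat m k (x i) = T.hat m k (S.phys ψ i) + T.hat m k (S.unphys x i) := by
  obtain ⟨ψ, h⟩ := S.exists_phys (fun i => x i - S.unphys x i)
    (fun k => by simp only [map_sub, mul_sub, Finset.sum_sub_distrib, pairing_e_unphys, sub_self])
    (fun k => by simp only [map_sub, mul_sub, Finset.sum_sub_distrib, pairing_l_unphys, sub_self])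
  exact ⟨ψ, fun i k => by rw [h, map_sub, sub_add_cancel]⟩

theorem hat_unphys_unphys (x : ι → T.Fun) (i : ι) (k : Momentum) :
    T.hat m k (S.unphys (S.unphys x) i) = T.hat m k (S.unphys x i) := by
  conv_lhs => rw [unphys]
  conv_rhs => rw [unphys]
  simp only [map_add, (S.e i).hat_map, (S.l i).hat_map, hat_directionPairing, pairing_e_unphys,
    pairing_l_unphys]

/-- The projection onto the span of e and l is qr + rq: its two terms are e⟨l, x⟩ and l⟨e, x⟩. -/
theorem inner_unphys (x : ι → T.Fun) (t : (ι → T.Fun) ⊕ (T.Fun × T.Fun)) :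
    (shellLetters T m σ).inner t (.inl (S.unphys x)) =
      (shellLetters T m σ).inner t
        (directionMap σ S.e true (directionMap σ S.l false (.inl x))) +
      (shellLetters T m σ).inner t
        (directionMap σ S.l false (directionMap σ S.e true (.inl x))) := by
  refine inner_inl_add σ S.regular (fun i k => ?_) t
  simp only [unphys, map_add, if_true, Bool.false_eq_true, if_false]

/-- The quartet structure on the one-particle states. -/
def quartet : (shellLetters T m σ).Quartet P where
  q := directionOp σ S.e true
  r := directionOp σ S.l false
  phys ψ := .inl (S.phys ψ)
  odd_phys _ := rfl
  inner_phys := S.inner_phys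
  q_q x t := by
    rcases x with x | x
    · refine inner_inl_zero σ S.regular (fun i k => ?_) t
      simp [(S.e i).hat_map]
    · refine inner_inr_zero σ S.regular (fun k => ?_) (fun k => ?_) t
      · simp only [if_true, hat_directionPairing, (S.e _).hat_map]
        have := congrArg (· * T.hat m k x.2) (S.e_e k)
        simpa [Finset.sum_mul, mul_assoc] using this
      · simp
  q_phys ψ t := by
    refine inner_inr_zero σ S.regular (fun k => ?_) (fun k => ?_) t
    · simp only [if_true, hat_directionPairing, S.e_phys]
    · simp
  r_phys ψ t := by
    refine inner_inr_zero σ S.regular (fun k => ?_) (fun k => ?_) t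
    · simp
    · simp only [Bool.false_eq_true, if_false, hat_directionPairing, S.l_phys]
  homotopy_odd x hx t := by
    rcases x with x | x
    · exact absurd hx (by simp [shellLetters])
    · refine inner_inr_add σ S.regular (fun k => ?_) (fun k => ?_) t
      · have := S.e_l_mul k x.1
        simp only [if_true, Bool.false_eq_true, if_false, hat_directionPairing, (S.l _).hat_map,
          map_zero, add_zero]
        rw [Finset.sum_mul] at this
        exact this.symm.trans (Finset.sum_congr rfl fun i _ => by ring)
      · have := S.l_e_mul k x.2
        simp only [if_true, Bool.false_eq_true, if_false, hat_directionPairing, (S.e _).hat_map,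
          map_zero, zero_add]
        rw [Finset.sum_mul] at this
        exact this.symm.trans (Finset.sum_congr rfl fun i _ => by ring)
  split x hx := by
    rcases x with x | x
    · obtain ⟨ψ, h⟩ := S.exists_phys_add_unphys x
      refine ⟨ψ, .inl (S.unphys x), rfl, inner_inl_add σ S.regular h, fun t => ?_⟩
      -- The homotopy identity at the projected multiplet follows because the projection is
      -- idempotent.
      refine Eq.trans ?_ (S.inner_unphys (S.unphys x) t)
      simpa using inner_inl_sum σ S.regular (κ := Unit) Finset.univ (fun _ => 1) (S.unphys x)
        (fun _ => S.unphys (S.unphys x)) (by simp [hat_unphys_unphys]) t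
    · exact absurd hx (by simp [shellLetters])

/-- A multiplet orthogonal to the gauge direction is a physical one up to a gauge part. -/
theorem exists_phys_of_transverse (x : ι → T.Fun)
    (hx : ∀ k, ∑ i, σ i * (conj ((S.e i).symbol k) * T.hat m k (x i)) = 0) :
    (∀ t, (shellLetters T m σ).inner t (S.quartet.q.map (.inl x)) = 0) ∧ ∃ ψ,
      (∀ i k, T.hat m k (S.phys ψ i) =
        T.hat m k (x i) - (S.e i).symbol k *
          ∑ a, σ a * (conj ((S.l a).symbol k) * T.hat m k (x a))) ∧
      (∀ t, (shellLetters T m σ).inner t (.inl x) =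
        (shellLetters T m σ).inner t (S.quartet.phys ψ) +
          (shellLetters T m σ).inner t (S.quartet.q.map (S.quartet.r.map (.inl x)))) ∧
      ∀ φ, (shellLetters T m σ).inner (.inl x) (S.quartet.phys φ) = P.inner ψ φ := by
  have hq : ∀ t, (shellLetters T m σ).inner t (S.quartet.q.map (.inl x)) = 0 := fun t => by
    refine inner_inr_zero σ S.regular (fun k => ?_) (fun k => ?_) t
    · simp only [if_true, hat_directionPairing, hx]
    · simp
  obtain ⟨ψ, hψ⟩ := S.exists_phys_add_unphys x
  have hψ' : ∀ i k, T.hat m k (x i) = T.hat m k (S.phys ψ i) +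
      T.hat m k ((S.e i).map (directionPairing σ S.l x)) := by
    intro i k
    rw [hψ, unphys, map_add, (S.l i).hat_map, hat_directionPairing, hx, mul_zero, add_zero]
  have hsplit : ∀ t, (shellLetters T m σ).inner t (.inl x) =
      (shellLetters T m σ).inner t (S.quartet.phys ψ) +
        (shellLetters T m σ).inner t (S.quartet.q.map (S.quartet.r.map (.inl x))) := fun t => by
    exact inner_inl_add σ S.regular (y := S.phys ψ)
      (z := fun i => (S.e i).map (directionPairing σ S.l x)) hψ' t
  refine ⟨hq, ψ, fun i k => ?_, hsplit, fun φ => ?_⟩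
  · rw [hψ', (S.e i).hat_map, hat_directionPairing, add_sub_cancel_right]
  · exact S.quartet.inner_phys_of_split hsplit φ

end ShellQuartet

/-! ### Division by `|k|²` on the test functions for massless fields -/

/-- On y > c the n-th derivative of 1/y is bounded by n! / c^(n+1), so the composition with a
function of temperate growth bounded below by c again has temperate growth. -/
theorem hasTemperateGrowth_inv {E : Type*} [NormedAddCommGroup E] [NormedSpace ℝ E] {D : E → ℝ}
    (hD : D.HasTemperateGrowth) {c : ℝ} (hc : 0 < c) (h : ∀ x, c < D x) :
    (fun x => (D x)⁻¹).HasTemperateGrowth := by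
  have hopen : IsOpen {y : ℝ | c < y} := isOpen_lt' c
  have hne : ∀ y ∈ {y : ℝ | c < y}, y ≠ 0 := fun y hy => (hc.trans hy).ne'
  have hdiff : ContDiffOn ℝ (⊤ : ℕ∞) (fun y : ℝ => y⁻¹) {y : ℝ | c < y} :=
    contDiffOn_id.inv hne
  refine Function.HasTemperateGrowth.comp' (g := fun y : ℝ => y⁻¹) (t := {y | c < y})
    (by rintro _ ⟨x, rfl⟩; exact h x) hopen.uniqueDiffOn hdiff (fun N => ?_) hD
  refine ⟨0, ∑ n ∈ Finset.range (N + 1), (n.factorial : ℝ) * (c ^ (n + 1))⁻¹, by positivity,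
    fun n hn y hy => ?_⟩
  have hcy : c < y := hy
  have hy0 : 0 < y := hc.trans hcy
  rw [norm_iteratedFDerivWithin_eq_norm_iteratedDerivWithin,
    iteratedDerivWithin_eq_iteratedDeriv hopen.uniqueDiffOn (contDiffAt_inv ℝ hy0.ne') hy,
    iteratedDeriv_eq_iterate, iter_deriv_inv, pow_zero, mul_one]
  have e : ‖(-1 : ℝ) ^ n * (n.factorial : ℝ) * y ^ (-1 - (n : ℤ))‖ =
      (n.factorial : ℝ) * (y ^ (n + 1))⁻¹ := by
    rw [norm_mul, norm_mul, norm_pow, norm_neg, norm_one, one_pow, one_mul,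
      Real.norm_of_nonneg (by positivity), Real.norm_of_nonneg (by positivity)]
    congr 1
    rw [← zpow_natCast, ← zpow_neg]
    congr 1
    push_cast
    ring
  rw [e]
  refine le_trans ?_ (Finset.single_le_sum (f := fun n : ℕ => (n.factorial : ℝ) * (c ^ (n + 1))⁻¹)
    (fun _ _ => by positivity) (Finset.mem_range.mpr (Nat.lt_succ_of_le hn)))
  gcongr

/-- The function ‖ξ‖⁻² is singular only where the Fourier transform of `f` vanishes. Adding a bump
near the origin to ‖ξ‖² yields a denominator bounded below without changing the quotient. -/
theorem exists_fourier_div_norm_sq (f : infraredTest.Fun) : ∃ g : infraredTest.Fun,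
    ∀ ξ, 𝓕 (g : TestFun) ξ = ((‖ξ‖ ^ 2)⁻¹ : ℝ) • 𝓕 (f : TestFun) ξ := by
  obtain ⟨δ, hδ, hz⟩ := exists_ball_of_infrared f.2
  -- The bump is 1 up to δ/4, where ‖ξ‖² may be small, and is supported within radius δ/2, where 𝓕 f
  -- = 0.
  let χ : ContDiffBump (0 : Spacetime) := ⟨δ / 4, δ / 2, by positivity, by linarith⟩
  let D : Spacetime → ℝ := fun ξ => ‖ξ‖ ^ 2 + χ ξ
  have hD : D.HasTemperateGrowth :=
    (Function.hasTemperateGrowth_norm_sq (H := Spacetime)).add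
      (χ.hasCompactSupport.hasTemperateGrowth χ.contDiff)
  have hc : ∀ ξ, min (1 / 2) ((δ / 4) ^ 2 / 2) < D ξ := by
    intro ξ
    have h0 : 0 ≤ χ ξ := χ.nonneg
    by_cases h : ‖ξ‖ ≤ δ / 4
    · have : χ ξ = 1 := χ.one_of_mem_closedBall (by simpa using h)
      refine (min_le_left _ _).trans_lt ?_
      simp only [D, this]
      nlinarith [sq_nonneg ‖ξ‖]
    · refine (min_le_right _ _).trans_lt ?_
      simp only [D]
      have : (δ / 4) ^ 2 ≤ ‖ξ‖ ^ 2 := by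
        have := not_le.mp h
        gcongr
      nlinarith [sq_pos_of_pos hδ]
  have hM : (fun ξ => (D ξ)⁻¹).HasTemperateGrowth :=
    hasTemperateGrowth_inv hD (by positivity) hc
  have key : ∀ ξ, 𝓕 (𝓕⁻ (SchwartzMap.smulLeftCLM ℂ (fun ξ => (D ξ)⁻¹) (𝓕 (f : TestFun)))) ξ =
      ((‖ξ‖ ^ 2)⁻¹ : ℝ) • 𝓕 (f : TestFun) ξ := by
    intro ξ
    rw [FourierTransform.fourier_fourierInv_eq, SchwartzMap.smulLeftCLM_apply_apply hM]
    by_cases h : ‖ξ‖ < δ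
    · rw [hz ξ h, smul_zero, smul_zero]
    · have : χ ξ = 0 := χ.zero_of_le_dist (by
        have := not_lt.mp h
        simp only [dist_zero_right, χ]
        linarith)
      simp [D, this]
  refine ⟨⟨𝓕⁻ (SchwartzMap.smulLeftCLM ℂ (fun ξ => (D ξ)⁻¹) (𝓕 (f : TestFun))), ?_⟩, key⟩
  filter_upwards [f.2] with ξ hξ
  rw [key, hξ, smul_zero]

theorem exists_hat_div_norm_sq (f : infraredTest.Fun) : ∃ g : infraredTest.Fun,
    ∀ k, infraredTest.hat 0 k g = ((‖k‖ ^ 2 : ℝ) : ℂ)⁻¹ * infraredTest.hat 0 k f := by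
  obtain ⟨g, hg⟩ := exists_fourier_div_norm_sq f
  -- On the light cone (2π)²‖ξ‖² = 2|k|², because the energy equals |k|.
  refine ⟨((2 / (2 * Real.pi) ^ 2 : ℝ) : ℂ) • g, fun k => ?_⟩
  rw [map_smul, TestSpace.hat_apply, TestSpace.hat_apply, posFT_eq, posFT_eq, hg, smul_eq_mul,
    Complex.real_smul, ← mul_assoc, ← Complex.ofReal_mul, ← Complex.ofReal_inv]
  congr 2
  have h := norm_sq_shellFreq 0 k
  rw [energy_zero, ← two_mul] at h
  have hp : (2 * Real.pi) ^ 2 ≠ 0 := by positivity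
  have h' : ‖shellFreq 0 k‖ ^ 2 = 2 * ‖k‖ ^ 2 / (2 * Real.pi) ^ 2 := by
    rw [eq_div_iff hp, mul_comm, h]
  rw [h', inv_div, div_mul_div_comm, mul_left_comm ((2 * Real.pi) ^ 2), ← mul_assoc,
    div_mul_cancel_left₀ (by positivity)]

/-! ### Multipliers -/

namespace ShellMultiplier

variable {T : TestSpace} {m : ℝ}

/-- The product of multipliers. -/
def mul (a b : ShellMultiplier T m) : ShellMultiplier T m where
  symbol k := a.symbol k * b.symbol k
  map f := a.map (b.map f)
  dual f := a.dual (b.dual f)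
  hat_map f k := by rw [a.hat_map, b.hat_map, mul_assoc]
  hat_dual f k := by rw [a.hat_dual, b.hat_dual, map_mul, mul_assoc]

/-- A constant as a multiplier. -/
def const (c : ℂ) : ShellMultiplier T m where
  symbol _ := c
  map f := c • f
  dual f := conj c • f
  hat_map f k := by rw [map_smul, smul_eq_mul]
  hat_dual f k := by rw [map_smul, smul_eq_mul]

/-- Multiplication by the contravariant component `p^μ`. -/
def momentum (μ : Fin 4) : ShellMultiplier T m where
  symbol k := shellPoint m k μ
  map f := (Complex.I * eta μ) • T.pd μ f
  dual f := (Complex.I * eta μ) • T.pd μ f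
  hat_map f k := by
    have : (eta μ : ℂ) * eta μ = 1 := by unfold eta; split <;> simp
    rw [map_smul, smul_eq_mul, TestSpace.hat_apply]
    change _ * posFT m (partialD μ f) k = _
    rw [posFT_partialD, TestSpace.hat_apply]
    linear_combination (-(shellPoint m k μ * posFT m f k * (eta μ * eta μ) : ℂ)) * Complex.I_mul_I +
      (shellPoint m k μ * posFT m f k : ℂ) * this
  hat_dual f k := by
    have : (eta μ : ℂ) * eta μ = 1 := by unfold eta; split <;> simp
    rw [map_smul, smul_eq_mul, TestSpace.hat_apply, Complex.conj_ofReal]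
    change _ * posFT m (partialD μ f) k = _
    rw [posFT_partialD, TestSpace.hat_apply]
    linear_combination (-(shellPoint m k μ * posFT m f k * (eta μ * eta μ) : ℂ)) * Complex.I_mul_I +
      (shellPoint m k μ * posFT m f k : ℂ) * this

/-- Multiplication by `1 / |k|²`. -/
def invNormSq : ShellMultiplier infraredTest 0 where
  symbol k := ((‖k‖ ^ 2 : ℝ) : ℂ)⁻¹
  map f := (exists_hat_div_norm_sq f).choose
  dual f := (exists_hat_div_norm_sq f).choose
  hat_map f := (exists_hat_div_norm_sq f).choose_spec
  hat_dual f k := by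
    rw [map_inv₀, Complex.conj_ofReal]
    exact (exists_hat_div_norm_sq f).choose_spec k

end ShellMultiplier

theorem sum_eta_shellPoint (m : ℝ) (k : Momentum) :
    ∑ μ, eta μ * (shellPoint m k μ * shellPoint m k μ) = m ^ 2 := by
  have h : ‖k‖ ^ 2 = ∑ j, k j * k j := by
    rw [EuclideanSpace.real_norm_sq_eq]
    exact Finset.sum_congr rfl fun j _ => sq _
  rw [Fin.sum_univ_succ]
  simp only [eta, Fin.succ_ne_zero, if_true, if_false, shellPoint, Fin.cons_zero, Fin.cons_succ,
    neg_one_mul, Finset.sum_neg_distrib, ← h]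
  have := energy_sq m k
  nlinarith

theorem sum_shellPoint (m : ℝ) (k : Momentum) :
    ∑ μ, shellPoint m k μ * shellPoint m k μ = energy m k ^ 2 + ‖k‖ ^ 2 := by
  have h : ‖k‖ ^ 2 = ∑ j, k j * k j := by
    rw [EuclideanSpace.real_norm_sq_eq]
    exact Finset.sum_congr rfl fun j _ => sq _
  rw [Fin.sum_univ_succ]
  simp only [shellPoint, Fin.cons_zero, Fin.cons_succ, ← h]
  ring

theorem eta_mul_eta (μ : Fin 4) : eta μ * eta μ = 1 := by unfold eta; split <;> norm_num

/-! ### The charge characterized by its commutators with the fields -/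

namespace Letters.Quartet

variable {A : Letters} {P : OneParticle} (D : A.Quartet P) {F : FreeFields} (ℓ : A.Represents F)

/-- The bracket is a combination of fields when the creation and the annihilation parts expand with
matching coefficients. The sign and the conjugation in `h'` come from antilinearity of a(·) and from
the graded commutator. -/
theorem bracket_eq_sum {x : F.Sym} {κ : Type} (s : Finset κ) (c : κ → ℂ) (y : κ → F.Sym)
    (hy : ∀ a ∈ s, F.odd (y a) = !F.odd x)
    (h : ∀ t, A.inner t (D.q.map (ℓ.letter x)) = ∑ a ∈ s, c a * A.inner t (ℓ.letter (y a)))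
    (h' : ∀ t, A.inner t (D.q.map (ℓ.letter (F.adj x))) =
      ∑ a ∈ s, -(oddSign (F.odd x) * conj (c a)) * A.inner t (ℓ.letter (F.adj (y a))))
    (Ψ : F.Space) : D.bracket ℓ x (ℓ.equiv Ψ) = ℓ.equiv (∑ a ∈ s, c a • F.op (y a) Ψ) := by
  have h₁ := A.create_combination s c (fun a => ℓ.letter (y a)) (D.q.map (ℓ.letter x))
    (fun a ha => by rw [ℓ.odd_letter, hy a ha, OddOp.odd_map, ℓ.odd_letter]) h
  have h₂ := A.annihilate_combination s _ (fun a => ℓ.letter (F.adj (y a)))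
    (D.q.map (ℓ.letter (F.adj x)))
    (fun a ha => by
      rw [ℓ.odd_letter, ℓ.odd_adj, hy a ha, OddOp.odd_map, ℓ.odd_letter, ℓ.odd_adj]) h'
  rw [bracket, h₁, h₂, map_sum]
  simp only [map_smul, ℓ.equiv_op, Represents.field, LinearMap.smul_apply,
    LinearMap.sum_apply, LinearMap.add_apply, smul_add, Finset.sum_add_distrib, sub_eq_add_neg,
    Finset.smul_sum, ← Finset.sum_neg_distrib, smul_smul, ← neg_smul]
  congr 1
  refine Finset.sum_congr rfl fun a _ => ?_
  congr 1
  cases F.odd x <;> simp [oddSign]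

theorem _root_.GaugeCharge.Letters.comm_even_iff {V : Type*} [AddCommGroup V] [Module ℂ V]
    {Q B C : V →ₗ[ℂ] V} : Q ∘ₗ B - B ∘ₗ Q = C ↔
      ∀ Ψ, Q (B Ψ) = oddSign false • B (Q Ψ) + C Ψ := by
  rw [sub_eq_iff_eq_add', LinearMap.ext_iff]
  simp [oddSign]

theorem _root_.GaugeCharge.Letters.comm_odd_iff {V : Type*} [AddCommGroup V] [Module ℂ V]
    {Q B C : V →ₗ[ℂ] V} : Q ∘ₗ B + B ∘ₗ Q = C ↔
      ∀ Ψ, Q (B Ψ) = oddSign true • B (Q Ψ) + C Ψ := by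
  rw [← eq_sub_iff_add_eq, sub_eq_neg_add, LinearMap.ext_iff]
  simp [oddSign]

theorem isCharge_iff {C : F.Sym → F.Space →ₗ[ℂ] F.Space}
    (hC : ∀ x Ψ, D.bracket ℓ x (ℓ.equiv Ψ) = ℓ.equiv (C x Ψ)) {Q : F.Space →ₗ[ℂ] F.Space} :
    D.IsCharge ℓ Q ↔ Q F.vacuum = 0 ∧
      ∀ x Ψ, Q (F.op x Ψ) = oddSign (F.odd x) • F.op x (Q Ψ) + C x Ψ := by
  refine ⟨fun h => ⟨h.vacuum, fun x Ψ => ℓ.equiv.injective ?_⟩,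
    fun ⟨h₀, h⟩ => D.isCharge_of_comm ℓ h₀ fun x Ψ => ?_⟩
  · rw [h.op, hC, map_add, map_smul]
  · rw [h, hC, map_add, map_smul]

end Letters.Quartet

/-! ### Scalar products of the letters of the basic fields, and the gauge operator on them -/

section Generators

variable {T : TestSpace} {m : ℝ} {ι : Type} [Fintype ι] (σ : ι → ℝ)
  (hT : T.Regular m)

theorem TestSpace.hat_bar (f : T.Fun) (k : Momentum) :
    T.hat m k (T.bar f) = conj (negFT m f k) := posFT_conjTest m f k

theorem TestSpace.hat_pd (μ : Fin 4) (f : T.Fun) (k : Momentum) :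
    T.hat m k (T.pd μ f) = -(Complex.I * eta μ * shellPoint m k μ) * T.hat m k f := by
  rw [TestSpace.hat_apply, TestSpace.hat_apply]
  refine (posFT_partialD m μ f k).trans ?_
  ring

theorem TestSpace.hat_bar_pd (μ : Fin 4) (f : T.Fun) (k : Momentum) :
    T.hat m k (T.bar (T.pd μ f)) =
      -(Complex.I * eta μ * shellPoint m k μ) * T.hat m k (T.bar f) := by
  rw [TestSpace.hat_bar, TestSpace.hat_bar]
  refine (congrArg conj (negFT_partialD m μ f k)).trans ?_
  simp
  try ring

theorem pauliVillarsPos_eq (f g : T.Fun) : pauliVillarsPos m f g =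
    Complex.I * ∫ k, conj (T.hat m k (T.bar f)) * T.hat m k g ∂(shellMeasure m) := by
  simp only [TestSpace.hat_bar, Complex.conj_conj]
  rfl

theorem inner_single_single [DecidableEq ι] (i j : ι) (f g : T.Fun) : (shellLetters T m σ).inner
    (.inl (Pi.single i f)) (.inl (Pi.single j g)) =
      if i = j then σ i * ∫ k, conj (T.hat m k f) * T.hat m k g ∂(shellMeasure m) else 0 := by
  change ∫ k, letterDensity T m σ _ _ k ∂_ = _
  split_ifs with h
  · subst h
    rw [← integral_const_mul]
    congr 1
    ext k
    simp only [letterDensity]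
    rw [Finset.sum_eq_single i (fun j _ hj => by simp [hj]) (by simp)]
    simp
  · rw [← integral_zero Momentum ℂ]
    congr 1
    ext k
    refine Finset.sum_eq_zero fun a _ => ?_
    by_cases ha : a = i
    · subst ha
      simp [Pi.single_eq_of_ne h]
    · simp [Pi.single_eq_of_ne ha]

theorem inner_inr_inr (x y : T.Fun × T.Fun) (h : x.2 = 0 ∨ y.1 = 0) :
    (shellLetters T m σ).inner (.inr x) (.inr y) =
      ∫ k, conj (T.hat m k x.1) * T.hat m k y.2 ∂(shellMeasure m) := by
  change ∫ k, letterDensity T m σ _ _ k ∂_ = _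
  congr 1
  ext k
  rcases h with h | h <;> simp [letterDensity, h]

theorem inner_inr_inr' (x y : T.Fun × T.Fun) (h : x.1 = 0 ∨ y.2 = 0) :
    (shellLetters T m σ).inner (.inr x) (.inr y) =
      ∫ k, conj (T.hat m k x.2) * T.hat m k y.1 ∂(shellMeasure m) := by
  change ∫ k, letterDensity T m σ _ _ k ∂_ = _
  congr 1
  ext k
  rcases h with h | h <;> simp [letterDensity, h]

theorem inner_inl_inr (x : ι → T.Fun) (y : T.Fun × T.Fun) :
    (shellLetters T m σ).inner (.inl x) (.inr y) = 0 := integral_zero _ _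

theorem inner_inr_inl (x : ι → T.Fun) (y : T.Fun × T.Fun) :
    (shellLetters T m σ).inner (.inr y) (.inl x) = 0 := integral_zero _ _

include hT

theorem inner_inl_single [DecidableEq ι] (c : ι → ℂ) (x y : ι → T.Fun)
    (h : ∀ i k, T.hat m k (x i) = c i * T.hat m k (y i)) (t : (ι → T.Fun) ⊕ (T.Fun × T.Fun)) :
    (shellLetters T m σ).inner t (.inl x) =
      ∑ i, c i * (shellLetters T m σ).inner t (.inl (Pi.single i (y i))) := by
  refine inner_inl_sum σ hT Finset.univ c x (fun i => Pi.single i (y i)) (fun i k => ?_) t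
  rw [Finset.sum_eq_single i (fun j _ hj => by simp [Pi.single_eq_of_ne hj.symm]) (by simp), h]
  simp

theorem inner_inr_split (x : T.Fun × T.Fun) (t : (ι → T.Fun) ⊕ (T.Fun × T.Fun)) :
    (shellLetters T m σ).inner t (.inr x) = ∑ b : Bool, (1 : ℂ) *
      (shellLetters T m σ).inner t (.inr (if b then (x.1, 0) else (0, x.2))) :=
  inner_inr_sum σ hT Finset.univ (fun _ => 1) x (fun b : Bool => if b then (x.1, 0) else (0, x.2))
    (by simp) (by simp) t

/-- The sum over `Unit` has one term; it has the shape of the hypotheses of `bracket_eq_sum`. -/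
theorem inner_direction_single [DecidableEq ι] (e : ι → ShellMultiplier T m) (i : ι) (f g : T.Fun) (c : ℂ)
    (h : ∀ k, σ i * (conj ((e i).symbol k) * T.hat m k f) = c * T.hat m k g)
    (t : (ι → T.Fun) ⊕ (T.Fun × T.Fun)) :
    (shellLetters T m σ).inner t ((directionOp σ e true).map (.inl (Pi.single i f))) =
      ∑ _a : Unit, c * (shellLetters T m σ).inner t (.inr (g, 0)) := by
  refine inner_inr_sum σ hT Finset.univ (fun _ => c) _ (fun _ => (g, 0)) (fun k => ?_)
    (fun k => by simp) t
  simp only [if_true, hat_directionPairing, Finset.univ_unique, Finset.sum_singleton, ← h]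
  rw [Finset.sum_eq_single i (fun j _ hj => by simp [Pi.single_eq_of_ne hj]) (by simp)]
  simp

theorem inner_direction_fst (e : ι → ShellMultiplier T m) (f : T.Fun)
    (t : (ι → T.Fun) ⊕ (T.Fun × T.Fun)) :
    (shellLetters T m σ).inner t ((directionOp σ e true).map (.inr (f, 0))) = 0 :=
  inner_inl_zero σ hT (fun i k => by simp [(e i).hat_map]) t

theorem inner_direction_snd [DecidableEq ι] (e : ι → ShellMultiplier T m) (f : T.Fun) (c : ι → ℂ) (g : ι → T.Fun)
    (h : ∀ i k, (e i).symbol k * T.hat m k f = c i * T.hat m k (g i))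
    (t : (ι → T.Fun) ⊕ (T.Fun × T.Fun)) :
    (shellLetters T m σ).inner t ((directionOp σ e true).map (.inr (0, f))) =
      ∑ i, c i * (shellLetters T m σ).inner t (.inl (Pi.single i (g i))) :=
  inner_inl_single σ hT c _ g (fun i k => by simp only [if_true, (e i).hat_map, h]) t

end Generators

/-! ### Divergences -/

section Divergence

variable {T : TestSpace} {m : ℝ}

theorem TestSpace.hat_div (f : Fin 4 → T.Fun) (k : Momentum) :
    T.hat m k (T.div f) = -(Complex.I * ∑ μ, (shellPoint m k μ : ℂ) * T.hat m k (f μ)) := by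
  simp only [TestSpace.div, map_sum, map_smul, smul_eq_mul, T.hat_pd, Finset.mul_sum,
    ← Finset.sum_neg_distrib]
  refine Finset.sum_congr rfl fun μ _ => ?_
  have : (eta μ : ℂ) * eta μ = 1 := by exact_mod_cast eta_mul_eta μ
  linear_combination (-(Complex.I * shellPoint m k μ * T.hat m k (f μ))) * this

theorem TestSpace.negFT_div (f : Fin 4 → T.Fun) (k : Momentum) :
    negFT m (T.div f : T.Fun) k = Complex.I * ∑ μ, (shellPoint m k μ : ℂ) * negFT m (f μ) k := by
  have key : ∀ s : Finset (Fin 4), negFT m ((∑ μ ∈ s, (eta μ : ℂ) • T.pd μ (f μ) : T.Fun)) k =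
      Complex.I * ∑ μ ∈ s, (shellPoint m k μ : ℂ) * negFT m (f μ) k := by
    intro s
    induction s using Finset.induction_on with
    | empty =>
      have := negFT_smul m 0 (0 : TestFun) k
      simpa using this
    | insert μ s hμ ih =>
      rw [Finset.sum_insert hμ, Finset.sum_insert hμ]
      have e : negFT m (T.pd μ (f μ) : T.Fun) k = _ := negFT_partialD m μ (f μ) k
      have : (eta μ : ℂ) * eta μ = 1 := by exact_mod_cast eta_mul_eta μ
      refine (negFT_add m _ _ k).trans ?_
      rw [ih]
      refine (congrArg (· + _) ((negFT_smul m _ _ k).trans (congrArg _ e))).trans ?_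
      linear_combination (Complex.I * shellPoint m k μ * negFT m (f μ) k) * this
  exact key Finset.univ

theorem TestSpace.hat_bar_div (f : Fin 4 → T.Fun) (k : Momentum) :
    T.hat m k (T.bar (T.div f)) =
      -(Complex.I * ∑ μ, (shellPoint m k μ : ℂ) * T.hat m k (T.bar (f μ))) := by
  simp [TestSpace.hat_bar, TestSpace.negFT_div]

end Divergence

/-! ### Helicity -/

/-- This is the identity n × (n × ψ) = n (n·ψ) - (n·n) ψ with i² = -1. The factor n·n is kept
because k/|k| is 0 at k = 0. -/
theorem helicityOp_helicityOp (ψ : Momentum → Fin 3 → ℂ) (k : Momentum) (j : Fin 3) :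
    helicityOp (helicityOp ψ) k j =
      (∑ a, ((k a / ‖k‖ : ℝ) : ℂ) * ((k a / ‖k‖ : ℝ) : ℂ)) * ψ k j -
        ((k j / ‖k‖ : ℝ) : ℂ) * ∑ a, ((k a / ‖k‖ : ℝ) : ℂ) * ψ k a := by
  fin_cases j <;> simp [helicityOp, cross_apply, Fin.sum_univ_three] <;> ring_nf <;>
    simp only [Complex.I_sq] <;> ring

/-- For k ≠ 0, Σ² is the projection orthogonal to k. At k = 0 the operator is zero by the convention
for division, which adds the condition ψ(0) = 0; infrared-regular test functions satisfy it
automatically. -/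
theorem hasHelicityOne_iff (ψ : Momentum → Fin 3 → ℂ) :
    HasHelicityOne ψ ↔ (∀ k : Momentum, ∑ j, (k j : ℂ) * ψ k j = 0) ∧ ψ 0 = 0 := by
  have hn : ∀ k : Momentum, k ≠ 0 →
      ∑ a, ((k a / ‖k‖ : ℝ) : ℂ) * ((k a / ‖k‖ : ℝ) : ℂ) = 1 := by
    intro k hk
    have h0 : ‖k‖ ≠ 0 := norm_ne_zero_iff.mpr hk
    have h : ‖k‖ ^ 2 = ∑ j, k j ^ 2 := EuclideanSpace.real_norm_sq_eq k
    have : ∑ a, (k a / ‖k‖) * (k a / ‖k‖) = 1 := by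
      simp only [← sq, div_pow]
      rw [← Finset.sum_div, ← h, div_self (pow_ne_zero 2 h0)]
    exact_mod_cast this
  have hs : ∀ k : Momentum, ∑ a, ((k a / ‖k‖ : ℝ) : ℂ) * ψ k a =
      ((‖k‖ : ℝ) : ℂ)⁻¹ * ∑ a, (k a : ℂ) * ψ k a := by
    intro k
    rw [Finset.mul_sum]
    refine Finset.sum_congr rfl fun a _ => ?_
    push_cast
    ring
  constructor
  · intro h
    refine ⟨fun k => ?_, ?_⟩
    · by_cases hk : k = 0
      · simp [hk]
      have hk' : ((‖k‖ : ℝ) : ℂ) ≠ 0 := by exact_mod_cast norm_ne_zero_iff.mpr hk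
      -- The condition says that the longitudinal vector k (k·ψ) vanishes componentwise, and some
      -- component of k is nonzero.
      have e : ∀ j, (k j : ℂ) * ∑ a, (k a : ℂ) * ψ k a = 0 := by
        intro j
        have := congrFun (congrFun h k) j
        rw [helicityOp_helicityOp, hn k hk, one_mul, hs, sub_eq_self, ← mul_assoc] at this
        rcases mul_eq_zero.mp this with h' | h'
        · rcases mul_eq_zero.mp h' with h' | h'
          · have : k j = 0 := by
              have h'' : k j / ‖k‖ = 0 := by exact_mod_cast h'
              simpa [norm_ne_zero_iff.mpr hk] using h''
            simp [this]
          · exact absurd (inv_eq_zero.mp h') hk'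
        · rw [h', mul_zero]
      by_contra hne
      refine hk (PiLp.ext fun j => ?_)
      have := (mul_eq_zero.mp (e j)).resolve_right hne
      simpa using this
    · funext j
      have := congrFun (congrFun h 0) j
      rw [helicityOp_helicityOp] at this
      simpa using this.symm
  · rintro ⟨h, h0⟩
    funext k j
    rw [helicityOp_helicityOp]
    by_cases hk : k = 0
    · simp [hk, h0]
    · rw [hn k hk, hs, h, mul_zero, mul_zero, sub_zero, one_mul]

theorem exists_photon (x : Fin 3 → infraredTest.Fun)
    (hx : ∀ k : Momentum, ∑ j, (k j : ℂ) * infraredTest.hat 0 k (x j) = 0) :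
    ∃ ψ : photon.Wave, ∀ k j, ψ.1 k j = infraredTest.hat 0 k (x j) :=
  ⟨⟨fun k j => infraredTest.hat 0 k (x j), (hasHelicityOne_iff _).mpr
    ⟨hx, funext fun j => posFT_infrared_zero (x j)⟩, x, fun _ _ => infraredTest.hat_apply _ _ _⟩,
    fun _ _ => rfl⟩

/-! ### The massless quartet -/

namespace Massless

/-- The signs of the scalar product. -/
def sign (μ : Fin 4) : ℝ := -eta μ

open ShellMultiplier in
/-- The direction conjugate to the momentum. -/
def dual (μ : Fin 4) : ShellMultiplier infraredTest 0 :=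
  (const (-(1 / 2) * eta μ)).mul ((momentum μ).mul invNormSq)

theorem dual_symbol (μ : Fin 4) (k : Momentum) : (dual μ).symbol k =
    ((-(1 / 2) * eta μ * (shellPoint 0 k μ * (‖k‖ ^ 2)⁻¹) : ℝ) : ℂ) := by
  change (-(1 / 2) * eta μ : ℂ) * ((shellPoint 0 k μ : ℂ) * ((‖k‖ ^ 2 : ℝ) : ℂ)⁻¹) = _
  push_cast
  ring

theorem momentum_symbol (μ : Fin 4) (k : Momentum) :
    (ShellMultiplier.momentum (T := infraredTest) (m := 0) μ).symbol k = shellPoint 0 k μ := rfl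

theorem hat_zero (f : infraredTest.Fun) : infraredTest.hat 0 0 f = 0 := posFT_infrared_zero f

/-- The covector test functions of a photon. -/
def phys (ψ : photon.Wave) : Fin 4 → infraredTest.Fun :=
  Fin.cons 0 fun j => -(ψ.2.2.choose j)

theorem hat_phys_zero (ψ : photon.Wave) (k : Momentum) :
    infraredTest.hat 0 k (phys ψ 0) = 0 := map_zero _

theorem hat_phys_succ (ψ : photon.Wave) (k : Momentum) (j : Fin 3) :
    infraredTest.hat 0 k (phys ψ j.succ) = -ψ.1 k j := by
  rw [ψ.2.2.choose_spec k j]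
  exact map_neg (infraredTest.hat 0 k) (ψ.2.2.choose j)

theorem sum_momentum_phys (ψ : photon.Wave) (k : Momentum) :
    ∑ j : Fin 3, (k j : ℂ) * infraredTest.hat 0 k (phys ψ j.succ) = 0 := by
  simp only [hat_phys_succ, mul_neg, Finset.sum_neg_distrib,
    ((hasHelicityOne_iff ψ.1).mp ψ.2.1).1 k, neg_zero]

theorem pairing_momentum (x : Fin 4 → infraredTest.Fun) (k : Momentum) :
    ∑ μ, (sign μ : ℂ) * (conj ((ShellMultiplier.momentum (T := infraredTest) (m := 0) μ).symbol k) *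
      infraredTest.hat 0 k (x μ)) =
    -((‖k‖ : ℂ) * infraredTest.hat 0 k (x 0)) +
      ∑ j : Fin 3, (k j : ℂ) * infraredTest.hat 0 k (x j.succ) := by
  rw [Fin.sum_univ_succ]
  simp [sign, eta, momentum_symbol, shellPoint, energy_zero]

theorem pairing_dual (x : Fin 4 → infraredTest.Fun) (k : Momentum) :
    ∑ μ, (sign μ : ℂ) * (conj ((dual μ).symbol k) * infraredTest.hat 0 k (x μ)) =
    (1 / 2 * ((‖k‖ : ℂ) ^ 2)⁻¹) * ((‖k‖ : ℂ) * infraredTest.hat 0 k (x 0) +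
      ∑ j : Fin 3, (k j : ℂ) * infraredTest.hat 0 k (x j.succ)) := by
  rw [Fin.sum_univ_succ, mul_add, Finset.mul_sum]
  simp only [dual_symbol, Complex.conj_ofReal, sign, eta, Fin.succ_ne_zero, if_true, if_false,
    shellPoint, Fin.cons_zero, Fin.cons_succ, energy_zero]
  congr 1
  · push_cast; ring
  · refine Finset.sum_congr rfl fun j _ => ?_
    push_cast
    ring

/-- Away from k = 0 the two pairings say k·x = |k| x₀ and k·x = -|k| x₀, so the time component and
the longitudinal component vanish separately. -/
theorem exists_phys (x : Fin 4 → infraredTest.Fun)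
    (he : ∀ k, ∑ μ, (sign μ : ℂ) *
      (conj ((ShellMultiplier.momentum (T := infraredTest) (m := 0) μ).symbol k) *
        infraredTest.hat 0 k (x μ)) = 0)
    (hl : ∀ k, ∑ μ, (sign μ : ℂ) * (conj ((dual μ).symbol k) *
        infraredTest.hat 0 k (x μ)) = 0) :
    ∃ ψ, ∀ μ k, infraredTest.hat 0 k (phys ψ μ) = infraredTest.hat 0 k (x μ) := by
  have h : ∀ k : Momentum, infraredTest.hat 0 k (x 0) = 0 ∧
      ∑ j : Fin 3, (k j : ℂ) * infraredTest.hat 0 k (x j.succ) = 0 := by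
    intro k
    by_cases hk : k = 0
    · subst hk
      simp [hat_zero]
    have hk' : (‖k‖ : ℂ) ≠ 0 := by exact_mod_cast norm_ne_zero_iff.mpr hk
    have h₁ := he k
    have h₂ := hl k
    rw [pairing_momentum] at h₁
    rw [pairing_dual] at h₂
    have h₃ := (mul_eq_zero.mp h₂).resolve_left
      (mul_ne_zero (by norm_num) (inv_ne_zero (pow_ne_zero 2 hk')))
    constructor
    · refine (mul_eq_zero.mp ?_).resolve_left hk'
      linear_combination (1 / 2 : ℂ) * (h₃ - h₁)
    · linear_combination (1 / 2 : ℂ) * (h₃ + h₁)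
  -- Letters carry contravariant components and photon wave functions covariant ones, hence the
  -- sign.
  obtain ⟨ψ, hψ⟩ := exists_photon (fun j => -(x j.succ)) fun k => by
    simp only [map_neg, mul_neg, Finset.sum_neg_distrib, (h k).2, neg_zero]
  refine ⟨ψ, fun μ k => Fin.cases ?_ (fun j => ?_) μ⟩
  · rw [hat_phys_zero, (h k).1]
  · rw [hat_phys_succ, hψ, map_neg, neg_neg]

/-- The massless quartet. -/
def quartet : ShellQuartet infraredTest 0 (Fin 4) sign photon where
  regular := regular_infraredTest 0
  e := ShellMultiplier.momentum
  l := dual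
  e_e k := by
    have := sum_eta_shellPoint 0 k
    simp only [momentum_symbol, Complex.conj_ofReal, sign]
    rw [zero_pow two_ne_zero] at this
    have h := congrArg (fun r : ℝ => -(r : ℂ)) this
    simpa using h
  l_l k := by
    have := sum_eta_shellPoint 0 k
    rw [zero_pow two_ne_zero] at this
    have h : ∑ μ, -eta μ * (-(1 / 2) * eta μ * (shellPoint 0 k μ * (‖k‖ ^ 2)⁻¹) *
        (-(1 / 2) * eta μ * (shellPoint 0 k μ * (‖k‖ ^ 2)⁻¹))) = 0 := by
      refine Eq.trans ?_ ((congrArg ((-(1 / 4) * ((‖k‖ ^ 2)⁻¹ * (‖k‖ ^ 2)⁻¹)) * ·) this).trans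
        (mul_zero _))
      rw [Finset.mul_sum]
      refine Finset.sum_congr rfl fun μ _ => ?_
      linear_combination (-(1 / 4) * eta μ * ((‖k‖ ^ 2)⁻¹ * (‖k‖ ^ 2)⁻¹) *
        (shellPoint 0 k μ * shellPoint 0 k μ)) * eta_mul_eta μ
    simp only [dual_symbol, Complex.conj_ofReal, sign]
    exact_mod_cast h
  e_l k := by
    -- At the tip of the cone the dual direction is undefined, but there every test function
    -- vanishes.
    by_cases hk : k = 0
    · subst hk
      exact Or.inl hat_zero
    refine Or.inr ?_
    have h0 : ‖k‖ ≠ 0 := norm_ne_zero_iff.mpr hk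
    have h : ∑ μ, -eta μ * (shellPoint 0 k μ *
        (-(1 / 2) * eta μ * (shellPoint 0 k μ * (‖k‖ ^ 2)⁻¹))) = 1 := by
      -- The dual direction is, up to scale, the momentum with reflected spatial part. Its Minkowski
      -- pairing with p is therefore the Euclidean square ω² + |k|² = 2|k|².
      have e : (1 / 2) * (‖k‖ ^ 2)⁻¹ * ∑ μ, shellPoint 0 k μ * shellPoint 0 k μ = 1 := by
        rw [sum_shellPoint, energy_zero]
        field_simp
        norm_num
      refine Eq.trans ?_ e
      rw [Finset.mul_sum]
      refine Finset.sum_congr rfl fun μ _ => ?_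
      linear_combination ((1 / 2) * (‖k‖ ^ 2)⁻¹ *
        (shellPoint 0 k μ * shellPoint 0 k μ)) * eta_mul_eta μ
    simp only [dual_symbol, momentum_symbol, Complex.conj_ofReal, sign]
    exact_mod_cast h
  phys := phys
  inner_phys ψ φ := by
    refine integral_congr_ae (Eventually.of_forall fun k => ?_)
    simp only [letterDensity, vecInner]
    rw [Fin.sum_univ_succ]
    simp [hat_phys_zero, hat_phys_succ, sign, eta]
  e_phys ψ k := by rw [pairing_momentum, hat_phys_zero, sum_momentum_phys]; simp
  l_phys ψ k := by rw [pairing_dual, hat_phys_zero, sum_momentum_phys]; simp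
  exists_phys := exists_phys

end Massless

/-! ### The massless fields on the Fock space and their gauge charge -/

namespace Massless

/-- The one-particle states created by the massless fields. -/
abbrev letters : Letters := shellLetters infraredTest 0 sign

/-- The state created by a field. -/
def letter : MasslessSym → (Fin 4 → infraredTest.Fun) ⊕ (infraredTest.Fun × infraredTest.Fun)
  | .v μ f => .inl (Pi.single μ f)
  | .u f => .inr (f, 0)
  | .uTilde f => .inr (0, f)

/-- The massless fields on the Fock space. -/
def represents : letters.Represents massless where
  letter := letter
  odd_letter x := by rcases x with ⟨μ, f⟩ | f | f <;> rfl
  odd_adj x := by rcases x with ⟨μ, f⟩ | f | f <;> rfl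
  twoPoint_eq x y := by
    rcases x with ⟨μ, f⟩ | f | f <;> rcases y with ⟨ν, g⟩ | g | g <;>
      simp only [massless, letter]
    · rw [inner_single_single, pauliVillarsPos_eq]
      split_ifs
      · rw [sign]
        push_cast
        linear_combination ((eta μ : ℂ) * ∫ k, conj (infraredTest.hat 0 k (infraredTest.bar f)) *
          infraredTest.hat 0 k g ∂(shellMeasure 0)) * Complex.I_mul_I
      · rfl
    · rw [inner_inl_inr]
    · rw [inner_inl_inr]
    · rw [inner_inr_inl]
    · rw [inner_inr_inr _ _ _ (.inl rfl)]
      simp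
    · rw [inner_inr_inr _ _ _ (.inl rfl), pauliVillarsPos_eq]
      linear_combination (-∫ k, conj (infraredTest.hat 0 k (infraredTest.bar f)) *
          infraredTest.hat 0 k g ∂(shellMeasure 0)) * Complex.I_mul_I
    · rw [inner_inr_inl]
    · rw [inner_inr_inr' _ _ _ (.inl rfl), pauliVillarsPos_eq]
      simp only [map_neg, neg_mul, integral_neg]
      linear_combination (∫ k, conj (infraredTest.hat 0 k (infraredTest.bar f)) *
          infraredTest.hat 0 k g ∂(shellMeasure 0)) * Complex.I_mul_I
    · rw [inner_inr_inr _ _ _ (.inr rfl)]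
      simp
  span x := by
    rcases x with x | x
    · exact ⟨Fin 4, Finset.univ, fun _ => 1, fun μ => .v μ (x μ), fun _ _ => rfl,
        inner_inl_single sign quartet.regular (fun _ => 1) x x (by simp)⟩
    · refine ⟨Bool, Finset.univ, fun _ => 1, fun b => if b then .u x.1 else .uTilde x.2,
        fun b _ => by cases b <;> rfl, fun t => ?_⟩
      refine (inner_inr_split sign quartet.regular x t).trans (Finset.sum_congr rfl fun b _ => ?_)
      cases b <;> rfl

/-- The commutators of the gauge charge with the fields. -/
def commutator : MasslessSym → H →ₗ[ℂ] H
  | .v μ f => Complex.I • du μ f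
  | .u _ => 0
  | .uTilde f => -Complex.I • divV f

/-- On the shell a derivative is multiplication by a momentum component times ∓i. The gauge operator
thus turns the letter of v_μ into that of a derivative of u, kills u, and turns ũ into a divergence.
-/
theorem bracket_eq (x : MasslessSym) (Ψ : H) :
    quartet.quartet.bracket represents x (represents.equiv Ψ) =
      represents.equiv (commutator x Ψ) := by
  rcases x with ⟨μ, f⟩ | f | f
  · refine (quartet.quartet.bracket_eq_sum represents (x := MasslessSym.v μ f) Finset.univ
      (fun _ : Unit => -Complex.I) (fun _ => .u (infraredTest.pd μ f)) (fun _ _ => rfl)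
      (inner_direction_single sign quartet.regular _ μ f _ _ fun k => ?_)
      (inner_direction_single sign quartet.regular _ μ (infraredTest.bar f)
        (infraredTest.bar (infraredTest.pd μ f)) _ fun k => ?_) Ψ).trans ?_
    · rw [infraredTest.hat_pd]
      simp only [quartet, momentum_symbol, Complex.conj_ofReal, sign]
      push_cast
      linear_combination (-(eta μ * shellPoint 0 k μ * infraredTest.hat 0 k f) : ℂ) *
        Complex.I_mul_I
    · rw [infraredTest.hat_bar_pd]
      simp only [quartet, momentum_symbol, Complex.conj_ofReal, sign, massless, oddSign, map_neg,
        Complex.conj_I]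
      push_cast
      linear_combination (-(eta μ * shellPoint 0 k μ *
        infraredTest.hat 0 k (infraredTest.bar f)) : ℂ) * Complex.I_mul_I
    · simp [commutator, du, u]
  · refine (quartet.quartet.bracket_eq_sum represents (x := MasslessSym.u f) ∅
      (fun _ : Unit => 0) (fun _ => .u f) (by simp)
      (inner_direction_fst sign quartet.regular _ f)
      (inner_direction_fst sign quartet.regular _ (infraredTest.bar f)) Ψ).trans ?_
    simp [commutator]
  · refine (quartet.quartet.bracket_eq_sum represents (x := MasslessSym.uTilde f) Finset.univ
      (fun μ => Complex.I * eta μ) (fun μ => .v μ (infraredTest.pd μ f)) (fun _ _ => rfl)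
      (inner_direction_snd sign quartet.regular _ f _ _ fun μ k => ?_)
      (inner_direction_snd sign quartet.regular _ (-infraredTest.bar f) _
        (fun μ => infraredTest.bar (infraredTest.pd μ f)) fun μ k => ?_) Ψ).trans ?_
    · have : (eta μ : ℂ) * eta μ = 1 := by exact_mod_cast eta_mul_eta μ
      rw [infraredTest.hat_pd]
      simp only [quartet, momentum_symbol]
      linear_combination (shellPoint 0 k μ * infraredTest.hat 0 k f * eta μ * eta μ : ℂ) *
        Complex.I_mul_I - (shellPoint 0 k μ * infraredTest.hat 0 k f : ℂ) * this
    · have : (eta μ : ℂ) * eta μ = 1 := by exact_mod_cast eta_mul_eta μ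
      rw [infraredTest.hat_bar_pd, map_neg]
      simp only [quartet, momentum_symbol, massless, oddSign, map_mul, Complex.conj_I,
        Complex.conj_ofReal]
      simp only [if_true]
      linear_combination -(shellPoint 0 k μ * infraredTest.hat 0 k (infraredTest.bar f) *
        eta μ * eta μ : ℂ) *
        Complex.I_mul_I + (shellPoint 0 k μ * infraredTest.hat 0 k (infraredTest.bar f) : ℂ) * this
    · congr 1
      rw [commutator, divV, smul_neg, neg_smul, neg_neg]
      simp only [v, LinearMap.smul_apply, LinearMap.sum_apply, Finset.smul_sum, smul_smul]

theorem isGaugeCharge_iff (Q : H →ₗ[ℂ] H) :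
    IsGaugeCharge Q ↔ quartet.quartet.IsCharge represents Q := by
  rw [quartet.quartet.isCharge_iff represents bracket_eq]
  refine ⟨fun h => ⟨h.vacuum, fun x => ?_⟩, fun ⟨h₀, h⟩ => ⟨h₀, fun μ f => ?_, fun f => ?_,
    fun f => ?_⟩⟩
  · rcases x with ⟨μ, f⟩ | f | f
    · exact Letters.comm_even_iff.mp (h.comm_v μ f)
    · exact Letters.comm_odd_iff.mp (h.comm_u f)
    · exact Letters.comm_odd_iff.mp (h.comm_uTilde f)
  · exact Letters.comm_even_iff.mpr (h (.v μ f))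
  · exact Letters.comm_odd_iff.mpr (h (.u f))
  · exact Letters.comm_odd_iff.mpr (h (.uTilde f))

/-! ### Gauge invariant fields -/

theorem equiv_v (μ : Fin 4) (f : infraredTest.Fun) (Ψ : H) : represents.equiv (v μ f Ψ) =
    letters.create (.inl (Pi.single μ f)) (represents.equiv Ψ) +
      letters.annihilate (.inl (Pi.single μ (infraredTest.bar f))) (represents.equiv Ψ) :=
  represents.equiv_op (MasslessSym.v μ f) Ψ

/-- Raising the index turns f_μ into the letter with components f^μ, and the annihilation part
carries the conjugate test functions. -/
theorem equiv_vSmeared (f : Fin 4 → infraredTest.Fun) (Ψ : H) :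
    represents.equiv (vSmeared f Ψ) =
      letters.create (.inl fun μ => (eta μ : ℂ) • f μ) (represents.equiv Ψ) +
        letters.annihilate (.inl fun μ => (eta μ : ℂ) • infraredTest.bar (f μ))
          (represents.equiv Ψ) := by
  have h₁ := letters.create_combination Finset.univ (fun μ => (eta μ : ℂ))
    (fun μ => .inl (Pi.single μ (f μ))) (.inl fun μ => (eta μ : ℂ) • f μ) (fun _ _ => rfl)
    (inner_inl_single sign quartet.regular _ _ f fun μ k => by simp)
  have h₂ := letters.annihilate_combination Finset.univ (fun μ => (eta μ : ℂ))
    (fun μ => .inl (Pi.single μ (infraredTest.bar (f μ))))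
    (.inl fun μ => (eta μ : ℂ) • infraredTest.bar (f μ)) (fun _ _ => rfl)
    (inner_inl_single sign quartet.regular _ _ (fun μ => infraredTest.bar (f μ))
      fun μ k => by simp)
  rw [h₁, h₂]
  simp only [vSmeared, LinearMap.sum_apply, LinearMap.smul_apply, map_sum, map_smul, equiv_v,
    smul_add, Finset.sum_add_distrib, Complex.conj_ofReal]

/-- The physical part of a transverse covector is its radiation part. -/
theorem exists_radiationPart (f : Fin 4 → infraredTest.Fun)
    (h : ∀ k, ∑ μ, (shellPoint 0 k μ : ℂ) * infraredTest.hat 0 k (f μ) = 0) :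
    (∀ t, letters.inner t (quartet.quartet.q.map (.inl fun μ => (eta μ : ℂ) • f μ)) = 0) ∧
    ∃ ψ, IsRadiationPart f ψ ∧
      (∀ t, letters.inner t (.inl fun μ => (eta μ : ℂ) • f μ) =
        letters.inner t (quartet.quartet.phys ψ) +
          letters.inner t (quartet.quartet.q.map
            (quartet.quartet.r.map (.inl fun μ => (eta μ : ℂ) • f μ)))) ∧
      ∀ φ, letters.inner (.inl fun μ => (eta μ : ℂ) • f μ) (quartet.quartet.phys φ) =
        photon.inner ψ φ := by
  have h' : ∀ k, (‖k‖ : ℂ) * infraredTest.hat 0 k (f 0) +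
      ∑ j : Fin 3, (k j : ℂ) * infraredTest.hat 0 k (f j.succ) = 0 := fun k => by
    have := h k
    rwa [Fin.sum_univ_succ, shellPoint, Fin.cons_zero, energy_zero] at this
  obtain ⟨h₁, ψ, h₂, h₃, h₄⟩ := quartet.exists_phys_of_transverse
    (fun μ => (eta μ : ℂ) • f μ) fun k => by
      refine (pairing_momentum _ k).trans ?_
      have := h' k
      simp only [eta, if_true, Fin.succ_ne_zero, if_false, map_smul, smul_eq_mul]
      simp only [Complex.ofReal_neg, Complex.ofReal_one, one_mul, neg_one_mul, mul_neg,
        Finset.sum_neg_distrib]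
      linear_combination -this
  refine ⟨h₁, ψ, fun k j => ?_, h₃, h₄⟩
  have e := h₂ j.succ k
  change infraredTest.hat 0 k (phys ψ j.succ) = _ - _ * ∑ μ, (sign μ : ℂ) *
    (conj ((dual μ).symbol k) * _) at e
  rw [hat_phys_succ, pairing_dual, show (quartet.e j.succ).symbol k = (k j : ℂ) from rfl] at e
  simp only [eta, if_true, Fin.succ_ne_zero, if_false, map_smul, smul_eq_mul] at e
  simp only [Complex.ofReal_neg, Complex.ofReal_one, one_mul, neg_one_mul, mul_neg,
    Finset.sum_neg_distrib] at e
  rw [← infraredTest.hat_apply, ← infraredTest.hat_apply]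
  by_cases hk : k = 0
  · subst hk
    simpa [hat_zero] using e
  have hk' : (‖k‖ : ℂ) ≠ 0 := by exact_mod_cast norm_ne_zero_iff.mpr hk
  -- Transversality replaces k·f by -|k| f₀; the two terms of the dual pairing then coincide and
  -- cancel the factor 1/2.
  have e' := eq_neg_of_add_eq_zero_right (h' k)
  rw [e'] at e
  push_cast
  have e'' := neg_eq_iff_eq_neg.mp e
  rw [e'']
  field_simp
  ring

end Massless

namespace Massive

/-! ### The massive quartet -/

/-- The signs of the scalar product; the index `none` belongs to the field `Φ`. -/
def sign : Option (Fin 4) → ℝ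
  | some μ => -eta μ
  | none => 1

/-- The gauge direction. -/
def gauge (m : ℝ) : Option (Fin 4) → ShellMultiplier allTest m
  | some μ => .momentum μ
  | none => .const (-(Complex.I * m))

/-- The direction conjugate to the gauge direction. -/
def dual (m : ℝ) : Option (Fin 4) → ShellMultiplier allTest m
  | some μ => (ShellMultiplier.const (-(2 * m ^ 2 : ℂ)⁻¹)).mul (.momentum μ)
  | none => .const (-(2 * m ^ 2 : ℂ)⁻¹ * (Complex.I * m))

variable (m : ℝ)

theorem gauge_some (μ : Fin 4) (k : Momentum) :
    (gauge m (some μ)).symbol k = shellPoint m k μ := rfl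

theorem gauge_none (k : Momentum) : (gauge m none).symbol k = -(Complex.I * m) := rfl

theorem dual_some (μ : Fin 4) (k : Momentum) :
    (dual m (some μ)).symbol k = -(2 * m ^ 2 : ℂ)⁻¹ * shellPoint m k μ := rfl

theorem dual_none (k : Momentum) :
    (dual m none).symbol k = -(2 * m ^ 2 : ℂ)⁻¹ * (Complex.I * m) := rfl

/-- The gauge direction (p, -im) is null since p² = m²: the scalar field supplies the missing fifth
component. -/
theorem pairing_gauge (z : Option (Fin 4) → ℂ) (k : Momentum) :
    ∑ i, (sign i : ℂ) * (conj ((gauge m i).symbol k) * z i) =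
      Complex.I * m * z none - ∑ μ, (eta μ : ℂ) * (shellPoint m k μ * z (some μ)) := by
  rw [Fintype.sum_option, sub_eq_add_neg, ← Finset.sum_neg_distrib]
  simp [sign, gauge_some, gauge_none]

theorem conj_inv : conj (-(2 * m ^ 2 : ℂ)⁻¹) = -(2 * m ^ 2 : ℂ)⁻¹ := by
  rw [← Complex.ofReal_pow, ← Complex.ofReal_ofNat, ← Complex.ofReal_mul, ← Complex.ofReal_inv,
    ← Complex.ofReal_neg, Complex.conj_ofReal]

theorem pairing_dual (z : Option (Fin 4) → ℂ) (k : Momentum) :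
    ∑ i, (sign i : ℂ) * (conj ((dual m i).symbol k) * z i) = (2 * m ^ 2 : ℂ)⁻¹ *
      (Complex.I * m * z none + ∑ μ, (eta μ : ℂ) * (shellPoint m k μ * z (some μ))) := by
  rw [Fintype.sum_option, mul_add, Finset.mul_sum]
  simp only [sign, dual_some, dual_none, map_mul, conj_inv, Complex.conj_I, Complex.conj_ofReal]
  congr 1
  · push_cast
    ring
  · refine Finset.sum_congr rfl fun μ _ => ?_
    push_cast
    ring

theorem sum_eta_shellPoint_complex (k : Momentum) :
    ∑ μ, (eta μ : ℂ) * (shellPoint m k μ * shellPoint m k μ) = (m : ℂ) ^ 2 := by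
  exact_mod_cast sum_eta_shellPoint m k

theorem sum_eta_shellPoint_mul (c : ℂ) (k : Momentum) :
    ∑ μ, (eta μ : ℂ) * (shellPoint m k μ * (c * shellPoint m k μ)) = c * (m : ℂ) ^ 2 := by
  rw [← sum_eta_shellPoint_complex m k, Finset.mul_sum]
  exact Finset.sum_congr rfl fun μ _ => by ring

/-- The test functions of a particle of spin one. -/
def phys (ψ : (spinOne m).Wave) : Option (Fin 4) → allTest.Fun
  | some μ => (eta μ : ℂ) • ψ.2.2.choose μ
  | none => 0

variable {m}

theorem hat_phys_none (ψ : (spinOne m).Wave) (k : Momentum) :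
    allTest.hat m k (phys m ψ none) = 0 := map_zero _

theorem hat_phys_some (ψ : (spinOne m).Wave) (k : Momentum) (μ : Fin 4) :
    allTest.hat m k (phys m ψ (some μ)) = eta μ * ψ.1 k μ := by
  rw [ψ.2.2.choose_spec k μ]
  exact map_smul (allTest.hat m k) _ _

theorem sum_gauge_phys (ψ : (spinOne m).Wave) (k : Momentum) :
    ∑ μ, (eta μ : ℂ) * (shellPoint m k μ * allTest.hat m k (phys m ψ (some μ))) = 0 := by
  rw [← ψ.2.1 k]
  refine Finset.sum_congr rfl fun μ _ => ?_
  have : (eta μ : ℂ) * eta μ = 1 := by exact_mod_cast eta_mul_eta μ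
  rw [hat_phys_some]
  linear_combination ((shellPoint m k μ : ℂ) * ψ.1 k μ) * this

theorem exists_spinOne (x : Fin 4 → allTest.Fun)
    (hx : ∀ k, ∑ μ, (shellPoint m k μ : ℂ) * allTest.hat m k (x μ) = 0) :
    ∃ ψ : (spinOne m).Wave, ∀ k μ, ψ.1 k μ = allTest.hat m k (x μ) :=
  ⟨⟨fun k μ => allTest.hat m k (x μ), hx, x, fun _ _ => allTest.hat_apply _ _ _⟩, fun _ _ => rfl⟩

/-- The pairings with e and l are, up to a nonzero factor, the difference and the sum of i m times
the Φ-component and the divergence, so both vanish separately. No point of the shell is exceptional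
because m > 0. -/
theorem exists_phys (hm : 0 < m) (x : Option (Fin 4) → allTest.Fun)
    (he : ∀ k, ∑ i, (sign i : ℂ) * (conj ((gauge m i).symbol k) * allTest.hat m k (x i)) = 0)
    (hl : ∀ k, ∑ i, (sign i : ℂ) * (conj ((dual m i).symbol k) * allTest.hat m k (x i)) = 0) :
    ∃ ψ, ∀ i k, allTest.hat m k (phys m ψ i) = allTest.hat m k (x i) := by
  have hm' : (m : ℂ) ≠ 0 := by exact_mod_cast hm.ne'
  have h : ∀ k, allTest.hat m k (x none) = 0 ∧
      ∑ μ, (eta μ : ℂ) * (shellPoint m k μ * allTest.hat m k (x (some μ))) = 0 := by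
    intro k
    have h₁ := he k
    have h₂ := hl k
    rw [pairing_gauge m (fun i => allTest.hat m k (x i))] at h₁
    rw [pairing_dual m (fun i => allTest.hat m k (x i))] at h₂
    have h₃ := (mul_eq_zero.mp h₂).resolve_left
      (inv_ne_zero (mul_ne_zero two_ne_zero (pow_ne_zero 2 hm')))
    constructor
    · refine (mul_eq_zero.mp ?_).resolve_left (mul_ne_zero Complex.I_ne_zero hm')
      linear_combination (1 / 2 : ℂ) * (h₃ + h₁)
    · linear_combination (1 / 2 : ℂ) * (h₃ - h₁)
  obtain ⟨ψ, hψ⟩ := exists_spinOne (m := m) (fun μ => (eta μ : ℂ) • x (some μ)) fun k => by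
    rw [← (h k).2]
    refine Finset.sum_congr rfl fun μ _ => ?_
    rw [map_smul, smul_eq_mul]
    ring
  refine ⟨ψ, fun i k => ?_⟩
  rcases i with _ | μ
  · rw [hat_phys_none, (h k).1]
  · have : (eta μ : ℂ) * eta μ = 1 := by exact_mod_cast eta_mul_eta μ
    rw [hat_phys_some, hψ, map_smul, smul_eq_mul, ← mul_assoc, this, one_mul]

/-- The massive quartet. -/
def quartet (hm : 0 < m) : ShellQuartet allTest m (Option (Fin 4)) sign (spinOne m) where
  regular := regular_allTest hm
  e := gauge m
  l := dual m
  e_e k := by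
    rw [pairing_gauge m (fun i => (gauge m i).symbol k)]
    simp only [gauge_some, gauge_none, sum_eta_shellPoint_complex]
    linear_combination (-(m : ℂ) ^ 2) * Complex.I_mul_I
  l_l k := by
    rw [pairing_dual m (fun i => (dual m i).symbol k)]
    simp only [dual_some, dual_none]
    rw [sum_eta_shellPoint_mul]
    linear_combination ((2 * m ^ 2 : ℂ)⁻¹ * (-(2 * m ^ 2 : ℂ)⁻¹) * (m : ℂ) ^ 2) * Complex.I_mul_I
  e_l k := by
    have hm' : (m : ℂ) ≠ 0 := by exact_mod_cast hm.ne'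
    refine Or.inr ?_
    rw [pairing_gauge m (fun i => (dual m i).symbol k)]
    simp only [dual_some, dual_none]
    rw [sum_eta_shellPoint_mul]
    have h2 : (2 * m ^ 2 : ℂ)⁻¹ * (2 * m ^ 2) = 1 :=
      inv_mul_cancel₀ (mul_ne_zero two_ne_zero (pow_ne_zero 2 hm'))
    linear_combination (-(2 * m ^ 2 : ℂ)⁻¹ * (m : ℂ) ^ 2) * Complex.I_mul_I + h2
  phys := phys m
  inner_phys ψ φ := by
    refine integral_congr_ae (Eventually.of_forall fun k => ?_)
    simp only [letterDensity, minkInner]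
    rw [Fintype.sum_option, ← Finset.sum_neg_distrib]
    simp only [hat_phys_none, hat_phys_some, mul_zero, zero_add]
    refine Finset.sum_congr rfl fun μ _ => ?_
    have : (eta μ : ℂ) * eta μ = 1 := by exact_mod_cast eta_mul_eta μ
    simp only [sign, map_mul, Complex.conj_ofReal]
    push_cast
    linear_combination (-(eta μ * (conj (ψ.1 k μ) * φ.1 k μ)) : ℂ) * this
  e_phys ψ k := by
    rw [pairing_gauge m (fun i => allTest.hat m k (phys m ψ i)), hat_phys_none, sum_gauge_phys]
    simp
  l_phys ψ k := by
    rw [pairing_dual m (fun i => allTest.hat m k (phys m ψ i)), hat_phys_none, sum_gauge_phys]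
    simp
  exists_phys := exists_phys hm

/-! ### The massive fields on the Fock space and their gauge charge -/

/-- The one-particle states created by the massive fields. -/
abbrev letters (m : ℝ) : Letters := shellLetters allTest m sign

/-- The state created by a field. -/
def letter : MassiveSym → (Option (Fin 4) → allTest.Fun) ⊕ (allTest.Fun × allTest.Fun)
  | .v μ f => .inl (Pi.single (some μ) f)
  | .u f => .inr (f, 0)
  | .uTilde f => .inr (0, f)
  | .Phi f => .inl (Pi.single none f)

/-- The field symbols of the Bose fields. -/
def boseSym : Option (Fin 4) → allTest.Fun → MassiveSym
  | some μ, f => .v μ f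
  | none, f => .Phi f

theorem letter_boseSym (i : Option (Fin 4)) (f : allTest.Fun) :
    letter (boseSym i f) = .inl (Pi.single i f) := by
  cases i <;> rfl

/-- The massive fields on the Fock space. -/
def represents (hm : 0 < m) : (letters m).Represents (massive m) where
  letter := letter
  odd_letter x := by rcases x with ⟨μ, f⟩ | f | f | f <;> rfl
  odd_adj x := by rcases x with ⟨μ, f⟩ | f | f | f <;> rfl
  twoPoint_eq x y := by
    rcases x with ⟨μ, f⟩ | f | f | f <;> rcases y with ⟨ν, g⟩ | g | g | g <;>
      simp only [massive, letter]
    · rw [inner_single_single, pauliVillarsPos_eq]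
      simp only [Option.some.injEq]
      split_ifs
      · rw [sign]
        push_cast
        linear_combination ((eta μ : ℂ) * ∫ k, conj (allTest.hat m k (allTest.bar f)) *
          allTest.hat m k g ∂(shellMeasure m)) * Complex.I_mul_I
      · rfl
    · rw [inner_inl_inr]
    · rw [inner_inl_inr]
    · rw [inner_single_single, if_neg (Option.some_ne_none μ)]
    · rw [inner_inr_inl]
    · rw [inner_inr_inr _ _ _ (.inl rfl)]
      simp
    · rw [inner_inr_inr _ _ _ (.inl rfl), pauliVillarsPos_eq]
      linear_combination (-∫ k, conj (allTest.hat m k (allTest.bar f)) *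
          allTest.hat m k g ∂(shellMeasure m)) * Complex.I_mul_I
    · rw [inner_inr_inl]
    · rw [inner_inr_inl]
    · rw [inner_inr_inr' _ _ _ (.inl rfl), pauliVillarsPos_eq]
      simp only [map_neg, neg_mul, integral_neg]
      linear_combination (∫ k, conj (allTest.hat m k (allTest.bar f)) *
          allTest.hat m k g ∂(shellMeasure m)) * Complex.I_mul_I
    · rw [inner_inr_inr _ _ _ (.inr rfl)]
      simp
    · rw [inner_inr_inl]
    · rw [inner_single_single, if_neg (Option.some_ne_none ν).symm]
    · rw [inner_inl_inr]
    · rw [inner_inl_inr]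
    · rw [inner_single_single, pauliVillarsPos_eq, if_pos rfl, sign]
      push_cast
      linear_combination (-∫ k, conj (allTest.hat m k (allTest.bar f)) *
          allTest.hat m k g ∂(shellMeasure m)) * Complex.I_mul_I
  span x := by
    rcases x with x | x
    · refine ⟨Option (Fin 4), Finset.univ, fun _ => 1, fun i => boseSym i (x i),
        fun i _ => by cases i <;> rfl, fun t => ?_⟩
      simp only [letter_boseSym]
      exact inner_inl_single sign (regular_allTest hm) (fun _ => 1) x x (by simp) t
    · refine ⟨Bool, Finset.univ, fun _ => 1, fun b => if b then .u x.1 else .uTilde x.2,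
        fun b _ => by cases b <;> rfl, fun t => ?_⟩
      refine (inner_inr_split sign (regular_allTest hm) x t).trans
        (Finset.sum_congr rfl fun b _ => ?_)
      cases b <;> rfl

variable (m) in
/-- The commutators of the gauge charge with the fields. -/
def commutator : MassiveSym → H m →ₗ[ℂ] H m
  | .v μ f => Complex.I • du m μ f
  | .u _ => 0
  | .uTilde f => -Complex.I • (divV m f + (m : ℂ) • Phi m f)
  | .Phi f => (Complex.I * (m : ℂ)) • u m f

variable (m) in
/-- The coefficients of the divergence of `v` and of `Φ` in the commutator with `ũ`. -/
def divCoeff : Option (Fin 4) → ℂ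
  | some μ => Complex.I * eta μ
  | none => -(Complex.I * m)

/-- The test functions of the divergence of `v` and of `Φ` in the commutator with `ũ`. -/
def divTest (f : allTest.Fun) : Option (Fin 4) → allTest.Fun
  | some μ => allTest.pd μ f
  | none => f

variable (hm : 0 < m)

/-- The Φ-component -im of the gauge direction accounts for both new terms: m Φ in the commutator
with ũ, and i m u in the one with Φ. -/
theorem bracket_eq (x : MassiveSym) (Ψ : H m) :
    (quartet hm).quartet.bracket (represents hm) x ((represents hm).equiv Ψ) =
      (represents hm).equiv (commutator m x Ψ) := by
  rcases x with ⟨μ, f⟩ | f | f | f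
  · refine ((quartet hm).quartet.bracket_eq_sum (represents hm) (x := MassiveSym.v μ f) Finset.univ
      (fun _ : Unit => -Complex.I) (fun _ => .u (allTest.pd μ f)) (fun _ _ => rfl)
      (inner_direction_single sign (quartet hm).regular _ (some μ) f _ _ fun k => ?_)
      (inner_direction_single sign (quartet hm).regular _ (some μ) (allTest.bar f)
        (allTest.bar (allTest.pd μ f)) _ fun k => ?_) Ψ).trans ?_
    · rw [allTest.hat_pd]
      simp only [quartet, gauge_some, Complex.conj_ofReal, sign]
      push_cast
      linear_combination (-(eta μ * shellPoint m k μ * allTest.hat m k f) : ℂ) *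
        Complex.I_mul_I
    · rw [allTest.hat_bar_pd]
      simp only [quartet, gauge_some, Complex.conj_ofReal, sign, massive, oddSign, map_neg,
        Complex.conj_I]
      push_cast
      linear_combination (-(eta μ * shellPoint m k μ *
        allTest.hat m k (allTest.bar f)) : ℂ) * Complex.I_mul_I
    · simp [commutator, du, u]
  · refine ((quartet hm).quartet.bracket_eq_sum (represents hm) (x := MassiveSym.u f) ∅
      (fun _ : Unit => 0) (fun _ => .u f) (by simp)
      (inner_direction_fst sign (quartet hm).regular _ f)
      (inner_direction_fst sign (quartet hm).regular _ (allTest.bar f)) Ψ).trans ?_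
    simp [commutator]
  · refine ((quartet hm).quartet.bracket_eq_sum (represents hm) (x := MassiveSym.uTilde f)
      Finset.univ (divCoeff m) (fun i => boseSym i (divTest f i))
      (fun i _ => by cases i <;> rfl) (fun t => ?_) (fun t => ?_) Ψ).trans ?_
    · refine (inner_direction_snd sign (quartet hm).regular _ f (divCoeff m) (divTest f)
        (fun i k => ?_) t).trans (Finset.sum_congr rfl fun i _ => by cases i <;> rfl)
      rcases i with _ | μ
      · simp only [quartet, gauge_none, divCoeff, divTest]
      have : (eta μ : ℂ) * eta μ = 1 := by exact_mod_cast eta_mul_eta μ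
      simp only [quartet, gauge_some, divCoeff, divTest]
      rw [allTest.hat_pd]
      linear_combination (shellPoint m k μ * allTest.hat m k f * eta μ * eta μ : ℂ) *
        Complex.I_mul_I - (shellPoint m k μ * allTest.hat m k f : ℂ) * this
    · refine (inner_direction_snd sign (quartet hm).regular _ (-allTest.bar f)
        (fun i => conj (divCoeff m i)) (fun i => allTest.bar (divTest f i))
        (fun i k => ?_) t).trans (Finset.sum_congr rfl fun i _ => ?_)
      · rw [map_neg]
        rcases i with _ | μ
        · simp [quartet, gauge_none, divCoeff, divTest]
        have : (eta μ : ℂ) * eta μ = 1 := by exact_mod_cast eta_mul_eta μ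
        simp only [quartet, gauge_some, divCoeff, divTest, map_mul, Complex.conj_I,
          Complex.conj_ofReal]
        rw [allTest.hat_bar_pd]
        linear_combination -(shellPoint m k μ * allTest.hat m k (allTest.bar f) *
          eta μ * eta μ : ℂ) *
          Complex.I_mul_I + (shellPoint m k μ * allTest.hat m k (allTest.bar f) : ℂ) * this
      · have : -(oddSign ((massive m).odd (.uTilde f)) * conj (divCoeff m i)) =
            conj (divCoeff m i) := by simp [massive, oddSign]
        rw [this]
        cases i <;> rfl
    · congr 1
      rw [commutator, divV, smul_add, smul_neg, neg_smul, neg_neg, Fintype.sum_option]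
      simp only [boseSym, divCoeff, divTest, v, Phi, LinearMap.add_apply, LinearMap.smul_apply,
        LinearMap.sum_apply, Finset.smul_sum, smul_smul]
      rw [add_comm, neg_mul]
  · refine ((quartet hm).quartet.bracket_eq_sum (represents hm) (x := MassiveSym.Phi f) Finset.univ
      (fun _ : Unit => Complex.I * m) (fun _ => .u f) (fun _ _ => rfl)
      (inner_direction_single sign (quartet hm).regular _ none f _ _ fun k => ?_)
      (inner_direction_single sign (quartet hm).regular _ none (allTest.bar f)
        (allTest.bar f) _ fun k => ?_) Ψ).trans ?_
    · simp [quartet, gauge_none, sign]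
    · simp [quartet, gauge_none, sign, massive, oddSign]
    · simp [commutator, u]

theorem isGaugeCharge_iff (Q : H m →ₗ[ℂ] H m) :
    IsGaugeCharge m Q ↔ (quartet hm).quartet.IsCharge (represents hm) Q := by
  rw [(quartet hm).quartet.isCharge_iff (represents hm) (bracket_eq hm)]
  refine ⟨fun h => ⟨h.vacuum, fun x => ?_⟩, fun ⟨h₀, h⟩ => ⟨h₀, fun μ f => ?_, fun f => ?_,
    fun f => ?_, fun f => ?_⟩⟩
  · rcases x with ⟨μ, f⟩ | f | f | f
    · exact Letters.comm_even_iff.mp (h.comm_v μ f)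
    · exact Letters.comm_odd_iff.mp (h.comm_u f)
    · exact Letters.comm_odd_iff.mp (h.comm_uTilde f)
    · exact Letters.comm_even_iff.mp (h.comm_Phi f)
  · exact Letters.comm_even_iff.mpr (h (.v μ f))
  · exact Letters.comm_odd_iff.mpr (h (.u f))
  · exact Letters.comm_odd_iff.mpr (h (.uTilde f))
  · exact Letters.comm_even_iff.mpr (h (.Phi f))

/-! ### Gauge invariant fields -/

/-- The state created by `∫ (f_μ v^μ + g Φ)`. -/
def fieldLetter (f : Fin 4 → allTest.Fun) (g : allTest.Fun) : Option (Fin 4) → allTest.Fun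
  | some μ => (eta μ : ℂ) • f μ
  | none => g

theorem equiv_v (μ : Fin 4) (f : allTest.Fun) (Ψ : H m) :
    (represents hm).equiv (v m μ f Ψ) =
    (letters m).create (.inl (Pi.single (some μ) f)) ((represents hm).equiv Ψ) +
      (letters m).annihilate (.inl (Pi.single (some μ) (allTest.bar f)))
        ((represents hm).equiv Ψ) :=
  (represents hm).equiv_op (MassiveSym.v μ f) Ψ

theorem equiv_Phi (f : allTest.Fun) (Ψ : H m) :
    (represents hm).equiv (Phi m f Ψ) =
    (letters m).create (.inl (Pi.single none f)) ((represents hm).equiv Ψ) +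
      (letters m).annihilate (.inl (Pi.single none (allTest.bar f)))
        ((represents hm).equiv Ψ) :=
  (represents hm).equiv_op (MassiveSym.Phi f) Ψ

include hm in
theorem inner_fieldLetter (f : Fin 4 → allTest.Fun) (g : allTest.Fun)
    (t : (Option (Fin 4) → allTest.Fun) ⊕ (allTest.Fun × allTest.Fun)) :
    (letters m).inner t (.inl (fieldLetter f g)) =
      ∑ i : Option (Fin 4), (Option.elim i 1 fun μ => (eta μ : ℂ)) *
        (letters m).inner t (.inl (Pi.single i (Option.elim i g f))) := by
  refine inner_inl_single sign (regular_allTest hm) _ _ _ (fun i k => ?_) t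
  cases i <;> simp [fieldLetter]

theorem equiv_field (f : Fin 4 → allTest.Fun) (g : allTest.Fun) (Ψ : H m) :
    (represents hm).equiv ((vSmeared m f + Phi m g) Ψ) =
      (letters m).create (.inl (fieldLetter f g)) ((represents hm).equiv Ψ) +
        (letters m).annihilate (.inl (fieldLetter (fun μ => allTest.bar (f μ)) (allTest.bar g)))
          ((represents hm).equiv Ψ) := by
  have h₁ := (letters m).create_combination Finset.univ _
    (fun i => .inl (Pi.single i (Option.elim i g f))) (.inl (fieldLetter f g))
    (fun _ _ => rfl) (inner_fieldLetter hm f g)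
  have h₂ := (letters m).annihilate_combination Finset.univ _
    (fun i => .inl (Pi.single i (Option.elim i (allTest.bar g) fun μ => allTest.bar (f μ))))
    (.inl (fieldLetter (fun μ => allTest.bar (f μ)) (allTest.bar g)))
    (fun _ _ => rfl) (inner_fieldLetter hm _ _)
  rw [h₁, h₂, Fintype.sum_option, Fintype.sum_option]
  simp only [vSmeared, LinearMap.add_apply, LinearMap.sum_apply, LinearMap.smul_apply, map_add,
    map_sum, map_smul, equiv_v, equiv_Phi, smul_add, Finset.sum_add_distrib, Complex.conj_ofReal,
    Option.elim, map_one, one_smul]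
  abel

/-- The physical part of a gauge invariant multiplet is its unitary part. -/
theorem exists_unitaryPart (f : Fin 4 → allTest.Fun) (g : allTest.Fun)
    (h : ∀ k, ∑ μ, (shellPoint m k μ : ℂ) * allTest.hat m k (f μ) =
      Complex.I * m * allTest.hat m k g) :
    (∀ t, (letters m).inner t ((quartet hm).quartet.q.map (.inl (fieldLetter f g))) = 0) ∧
    ∃ ψ, IsUnitaryPart m f g ψ ∧
      (∀ t, (letters m).inner t (.inl (fieldLetter f g)) =
        (letters m).inner t ((quartet hm).quartet.phys ψ) +
          (letters m).inner t ((quartet hm).quartet.q.map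
            ((quartet hm).quartet.r.map (.inl (fieldLetter f g))))) ∧
      ∀ φ, (letters m).inner (.inl (fieldLetter f g)) ((quartet hm).quartet.phys φ) =
        (spinOne m).inner ψ φ := by
  have hm' : (m : ℂ) ≠ 0 := by exact_mod_cast hm.ne'
  have h' : ∀ k, ∑ μ, (eta μ : ℂ) * (shellPoint m k μ *
      allTest.hat m k (fieldLetter f g (some μ))) = Complex.I * m * allTest.hat m k g := fun k => by
    rw [← h]
    refine Finset.sum_congr rfl fun μ _ => ?_
    have : (eta μ : ℂ) * eta μ = 1 := by exact_mod_cast eta_mul_eta μ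
    rw [fieldLetter, map_smul, smul_eq_mul]
    linear_combination ((shellPoint m k μ : ℂ) * allTest.hat m k (f μ)) * this
  obtain ⟨h₁, ψ, h₂, h₃, h₄⟩ := (quartet hm).exists_phys_of_transverse (fieldLetter f g) fun k =>
    (pairing_gauge m (fun i => allTest.hat m k (fieldLetter f g i)) k).trans (by
      rw [h', fieldLetter, sub_self])
  refine ⟨h₁, ψ, fun k μ => ?_, h₃, h₄⟩
  have e := h₂ (some μ) k
  change allTest.hat m k (phys m ψ (some μ)) = _ - _ * ∑ i, (sign i : ℂ) *
    (conj ((dual m i).symbol k) * _) at e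
  rw [hat_phys_some, pairing_dual m (fun i => allTest.hat m k (fieldLetter f g i)), h',
    show ((quartet hm).e (some μ)).symbol k = (shellPoint m k μ : ℂ) from rfl,
    fieldLetter, fieldLetter, map_smul, smul_eq_mul] at e
  rw [← allTest.hat_apply, map_add, map_smul, allTest.hat_pd, smul_eq_mul]
  have hη : (eta μ : ℂ) * eta μ = 1 := by exact_mod_cast eta_mul_eta μ
  have e₂ := congrArg ((eta μ : ℂ) * ·) e
  have h2 : (2 * m ^ 2 : ℂ)⁻¹ * (2 * m) = (m : ℂ)⁻¹ := by field_simp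
  -- For a gauge invariant multiplet the dual pairing is (2m²)⁻¹ · 2im ĝ = i ĝ/m. Subtracting it
  -- along p^μ and lowering the index adds the Fourier transform of ∂_μ g / m.
  linear_combination e₂ + (allTest.hat m k (f μ) - ψ.1 k μ) * hη -
    (eta μ * shellPoint m k μ * Complex.I * allTest.hat m k g : ℂ) * h2

end Massive

/-! ### Positivity of the one-particle scalar products -/

/-- The components of a photon as amplitudes. -/
def photonAmplitudes : photon.Amplitudes Momentum (Fin 3) where
  μ := shellMeasure 0
  e j k ψ := ψ.1 k j
  integrable j ψ φ := by
    obtain ⟨-, f, hf⟩ := ψ.2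
    obtain ⟨-, g, hg⟩ := φ.2
    simp only [hf, hg]
    exact integrable_posFT (regular_infraredTest 0) _ _
  inner_eq ψ φ := by
    change ∫ k, vecInner ψ.1 φ.1 k ∂_ = _
    simp only [vecInner]
    refine integral_finsetSum _ fun j _ => ?_
    obtain ⟨-, f, hf⟩ := ψ.2
    obtain ⟨-, g, hg⟩ := φ.2
    simp only [hf, hg]
    exact integrable_posFT (regular_infraredTest 0) _ _

theorem minkInner_eq (ψ φ : Momentum → Fin 4 → ℂ) (k : Momentum) : minkInner ψ φ k =
    -(conj (ψ k 0) * φ k 0) + ∑ j : Fin 3, conj (ψ k j.succ) * φ k j.succ := by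
  rw [minkInner, Fin.sum_univ_succ]
  simp [eta, add_comm]

/-! ### Rest-frame components of spin one wave functions -/

section SpinOne

variable {m : ℝ}

/-- The spatial components of the velocity, up to a bounded factor. -/
def boost (m : ℝ) (j : Fin 3) (k : Momentum) : ℝ := k j / (energy m k + m)

theorem energy_add_pos (hm : 0 < m) (k : Momentum) : 0 < energy m k + m :=
  add_pos_of_nonneg_of_pos (energy_nonneg m k) hm

theorem continuous_boost (hm : 0 < m) (j : Fin 3) : Continuous (boost m j) := by
  have := continuous_energy m
  exact Continuous.div (by fun_prop) (by fun_prop) fun k => (energy_add_pos hm k).ne'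

theorem abs_boost_le (hm : 0 < m) (j : Fin 3) (k : Momentum) : |boost m j k| ≤ 1 := by
  rw [boost, abs_div, abs_of_pos (energy_add_pos hm k), div_le_one (energy_add_pos hm k)]
  have h := PiLp.norm_apply_le k j
  rw [Real.norm_eq_abs] at h
  linarith [norm_le_energy m k]

/-- The components of a wave function of spin one in the rest frame. -/
def restFrame (m : ℝ) (ψ : Momentum → Fin 4 → ℂ) (j : Fin 3) (k : Momentum) : ℂ :=
  ψ k j.succ + boost m j k * ψ k 0

/-- On transverse covectors the Lorentz boost to the rest frame leaves three spatial components.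
After eliminating k·ψ = -ω ψ₀ they read ψ_j + k_j ψ₀/(ω + m), and the invariant product becomes the
Euclidean one. This exhibits its positivity. -/
theorem sum_restFrame (hm : 0 < m) {ψ φ : Momentum → Fin 4 → ℂ} (hψ : IsTransverse m ψ)
    (hφ : IsTransverse m φ) (k : Momentum) :
    ∑ j, conj (restFrame m ψ j k) * restFrame m φ j k = minkInner ψ φ k := by
  have h₁ := congrArg conj (hψ k)
  have h₂ := hφ k
  have hE : ((energy m k : ℝ) : ℂ) + m ≠ 0 := by
    exact_mod_cast (energy_add_pos hm k).ne'
  have hk : (energy m k : ℂ) ^ 2 = m ^ 2 + ∑ j : Fin 3, (k j : ℂ) ^ 2 := by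
    have := energy_sq m k
    rw [EuclideanSpace.real_norm_sq_eq] at this
    exact_mod_cast this
  rw [Fin.sum_univ_succ] at h₁ h₂
  simp only [shellPoint, Fin.cons_zero, Fin.cons_succ, Fin.sum_univ_three, map_add, map_mul,
    Complex.conj_ofReal, map_zero, Fin.reduceSucc] at h₁ h₂ hk
  rw [minkInner_eq]
  simp only [restFrame, boost, Fin.sum_univ_three, map_add, map_mul, Complex.conj_ofReal,
    Fin.reduceSucc]
  push_cast
  field_simp
  linear_combination (φ k 0 * (energy m k + m)) * h₁ + (conj (ψ k 0) * (energy m k + m)) * h₂ -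
    (conj (ψ k 0) * φ k 0) * hk

/-- The boost coefficients are continuous and bounded by 1, so integrability is inherited from
products of test functions. -/
theorem integrable_restFrame (hm : 0 < m) (ψ φ : (spinOne m).Wave) (j : Fin 3) :
    Integrable (fun k => conj (restFrame m ψ.1 j k) * restFrame m φ.1 j k) (shellMeasure m) := by
  obtain ⟨-, f, hf⟩ := ψ.2
  obtain ⟨-, g, hg⟩ := φ.2
  have hi : ∀ a b, Integrable (fun k => conj (ψ.1 k a) * φ.1 k b) (shellMeasure m) := by
    intro a b
    simp only [hf, hg]
    exact integrable_posFT (regular_allTest hm) _ _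
  have hb : ∀ {F : Momentum → ℂ}, Integrable F (shellMeasure m) →
      Integrable (fun k => (boost m j k : ℂ) * F k) (shellMeasure m) := fun hF =>
    hF.bdd_mul (c := 1)
      (Complex.continuous_ofReal.comp (continuous_boost hm j)).aestronglyMeasurable
      (Eventually.of_forall fun k => by
        simpa using abs_boost_le hm j k)
  have := ((hi j.succ j.succ).add (hb (hi j.succ 0))).add
    ((hb (hi 0 j.succ)).add (hb (hb (hi 0 0))))
  refine this.congr (Eventually.of_forall fun k => ?_)
  simp only [Pi.add_apply, restFrame, map_add, map_mul, Complex.conj_ofReal]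
  ring

/-- The components in the rest frame as amplitudes. -/
def spinOneAmplitudes (hm : 0 < m) : (spinOne m).Amplitudes Momentum (Fin 3) where
  μ := shellMeasure m
  e j k ψ := restFrame m ψ.1 j k
  integrable j ψ φ := integrable_restFrame hm ψ φ j
  inner_eq ψ φ := by
    change ∫ k, minkInner ψ.1 φ.1 k ∂_ = _
    rw [← integral_finsetSum _ fun j _ => integrable_restFrame hm ψ φ j]
    exact integral_congr_ae (Eventually.of_forall fun k =>
      (sum_restFrame hm ψ.2.1 φ.2.1 k).symm)

end SpinOne

/-! ### Smooth functions of compact support outside of the origin -/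

/-- Smooth functions with compact support in the complement of the origin. -/
structure IsTame (h : Momentum → ℂ) : Prop where
  contDiff : ContDiff ℝ (⊤ : ℕ∞) h
  hasCompactSupport : HasCompactSupport h
  eventually_zero : ∀ᶠ k in nhds 0, h k = 0

namespace IsTame

theorem add {g h : Momentum → ℂ} (hg : IsTame g) (hh : IsTame h) : IsTame fun k => g k + h k where
  contDiff := hg.contDiff.add hh.contDiff
  hasCompactSupport := hg.hasCompactSupport.add hh.hasCompactSupport
  eventually_zero := by
    filter_upwards [hg.eventually_zero, hh.eventually_zero] with k h₁ h₂
    rw [h₁, h₂, add_zero]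

/-- A multiplier singular at the origin, such as 1/|k|², is allowed because `h` vanishes in a
neighbourhood of it. -/
theorem mul {c h : Momentum → ℂ} (hc : ∀ k, k ≠ 0 → ContDiffAt ℝ (⊤ : ℕ∞) c k) (hh : IsTame h) :
    IsTame fun k => c k * h k where
  contDiff := by
    rw [contDiff_iff_contDiffAt]
    intro k
    by_cases hk : k = 0
    · subst hk
      refine (contDiffAt_const (c := (0 : ℂ))).congr_of_eventuallyEq ?_
      filter_upwards [hh.eventually_zero] with k h₁
      rw [h₁, mul_zero]
    · exact (hc k hk).mul hh.contDiff.contDiffAt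
  hasCompactSupport := hh.hasCompactSupport.mul_left
  eventually_zero := by
    filter_upwards [hh.eventually_zero] with k h₁
    rw [h₁, mul_zero]

theorem sum {ι : Type} (s : Finset ι) {h : ι → Momentum → ℂ} (hh : ∀ i ∈ s, IsTame (h i)) :
    IsTame fun k => ∑ i ∈ s, h i k where
  contDiff := ContDiff.sum fun i hi => (hh i hi).contDiff
  hasCompactSupport := by
    induction s using Finset.cons_induction with
    | empty => exact HasCompactSupport.zero
    | cons i s hi ih =>
      simp only [Finset.sum_cons]
      exact (hh i (by simp)).hasCompactSupport.add (ih fun j hj => hh j (by simp [hj]))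
  eventually_zero := by
    have : ∀ᶠ k in nhds (0 : Momentum), ∀ i ∈ s, h i k = 0 :=
      (Filter.eventually_all_finset s).mpr fun i hi => (hh i hi).eventually_zero
    filter_upwards [this] with k hk
    exact Finset.sum_eq_zero hk

/-- These functions are restrictions of Fourier transforms to the mass shell. -/
theorem exists_posFT {h : Momentum → ℂ} (hh : IsTame h) (m : ℝ) :
    ∃ f : infraredTest.Fun, ∀ k, posFT m f k = h k := by
  obtain ⟨R, hR⟩ := hh.hasCompactSupport.isCompact.isBounded.subset_closedBall (0 : Momentum)
  -- This bounds the frequency |ξ₀| on the part of the shell above the ball of radius R containing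
  -- the support of `h`.
  let E : ℝ := √(m ^ 2 + R ^ 2) / (2 * Real.pi)
  have hE : 0 ≤ E := by positivity
  let χ : ContDiffBump (0 : ℝ) := ⟨E + 1, E + 2, by linarith, by linarith⟩
  let L : Spacetime → Momentum := fun ξ => WithLp.toLp 2 fun j : Fin 3 => 2 * Real.pi * ξ j.succ
  have hL : ContDiff ℝ (⊤ : ℕ∞) L := by
    refine (contDiff_euclidean (𝕜 := ℝ)).mpr fun j => ?_
    change ContDiff ℝ _ fun ξ : Spacetime => 2 * Real.pi * ξ j.succ
    fun_prop
  -- The extension off the shell is constant in the energy variable up to a cutoff that equals 1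
  -- over the support of `h`. It vanishes near ξ = 0 because `h` vanishes near 0.
  let F : Spacetime → ℂ := fun ξ => (χ (ξ 0) : ℂ) * h (L ξ)
  have hF : ContDiff ℝ (⊤ : ℕ∞) F := by
    refine ContDiff.mul ?_ (hh.contDiff.comp hL)
    exact Complex.ofRealCLM.contDiff.comp (χ.contDiff.comp (by fun_prop))
  have hFc : HasCompactSupport F := by
    refine HasCompactSupport.intro (K := Metric.closedBall 0 (E + 2 + R))
      (isCompact_closedBall _ _) fun ξ hξ => ?_
    by_contra hne
    refine hξ ?_
    obtain ⟨h₁, h₂⟩ := mul_ne_zero_iff.mp hne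
    have h₃ : |ξ 0| ≤ E + 2 := by
      by_contra h'
      refine h₁ ?_
      have : χ (ξ 0) = 0 := χ.zero_of_le_dist (by
        rw [dist_zero_right, Real.norm_eq_abs]
        exact (not_le.mp h').le)
      rw [this, Complex.ofReal_zero]
    have h₄ : ‖L ξ‖ ≤ R := by
      simpa using hR (subset_tsupport _ h₂)
    have hR0 : 0 ≤ R := (norm_nonneg _).trans h₄
    have h₅ : ‖ξ‖ ^ 2 ≤ (E + 2 + R) ^ 2 := by
      have e₁ : ‖ξ‖ ^ 2 = |ξ 0| ^ 2 + ∑ j : Fin 3, ξ j.succ ^ 2 := by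
        rw [EuclideanSpace.real_norm_sq_eq, Fin.sum_univ_succ, sq_abs]
      have e₂ : ‖L ξ‖ ^ 2 = (2 * Real.pi) ^ 2 * ∑ j : Fin 3, ξ j.succ ^ 2 := by
        rw [EuclideanSpace.real_norm_sq_eq, Finset.mul_sum]
        exact Finset.sum_congr rfl fun j _ => mul_pow _ _ _
      have e₃ : 0 ≤ ∑ j : Fin 3, ξ j.succ ^ 2 := Finset.sum_nonneg fun _ _ => sq_nonneg _
      have e₄ : 1 ≤ (2 * Real.pi) ^ 2 := one_le_pow₀ (by nlinarith [Real.pi_gt_three])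
      have e₅ : ‖L ξ‖ ^ 2 ≤ R ^ 2 := by gcongr
      have e₆ : |ξ 0| ^ 2 ≤ (E + 2) ^ 2 := by gcongr
      have e₇ := le_mul_of_one_le_left e₃ e₄
      nlinarith
    rw [mem_closedBall_zero_iff]
    exact le_of_sq_le_sq h₅ (by positivity)
  refine ⟨⟨𝓕⁻ (hFc.toSchwartzMap hF), ?_⟩, fun k => ?_⟩
  · have hL0 : Tendsto L (nhds 0) (nhds 0) := by
      have := hL.continuous.tendsto 0
      rwa [show L 0 = 0 by ext j; simp [L]] at this
    change ∀ᶠ ξ in nhds (0 : Spacetime), _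
    filter_upwards [hL0.eventually hh.eventually_zero] with ξ hξ
    rw [FourierTransform.fourier_fourierInv_eq]
    change _ * h (L ξ) = 0
    rw [hξ, mul_zero]
  · rw [posFT_eq, FourierTransform.fourier_fourierInv_eq]
    change (χ (shellFreq m k 0) : ℂ) * h (L (shellFreq m k)) = h k
    have e : L (shellFreq m k) = k := by
      ext j
      have : (2 * Real.pi) ≠ 0 := by positivity
      simp only [L, shellFreq, eta, Fin.succ_ne_zero, if_false, shellPoint, Fin.cons_succ]
      field_simp
    rw [e]
    by_cases hk : h k = 0
    · rw [hk, mul_zero]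
    have hkR : ‖k‖ ≤ R := by simpa using hR (subset_tsupport _ hk)
    have : χ (shellFreq m k 0) = 1 := by
      refine χ.one_of_mem_closedBall ?_
      rw [mem_closedBall_zero_iff, Real.norm_eq_abs]
      simp only [shellFreq, eta, if_true, shellPoint, Fin.cons_zero, one_mul]
      rw [abs_div, abs_neg, abs_of_nonneg (energy_nonneg m k), abs_of_pos (by positivity)]
      refine le_trans ?_ (le_add_of_nonneg_right zero_le_one)
      change _ / _ ≤ E
      simp only [E, energy]
      gcongr
    rw [this, Complex.ofReal_one, one_mul]

end IsTame

/-! ### Approximation of square integrable functions -/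

/-- The density is bounded by that at ω = r on the region |k| > r. Finiteness on compacts is needed
for the approximation by smooth functions. -/
theorem shellMeasure_restrict_lt_top (m : ℝ) {r : ℝ} (hr : 0 < r) :
    IsFiniteMeasureOnCompacts ((shellMeasure m).restrict {k | r < ‖k‖}) where
  lt_top_of_isCompact {K} hK := by
    have hS : MeasurableSet {k : Momentum | r < ‖k‖} :=
      measurableSet_lt measurable_const measurable_norm
    rw [Measure.restrict_apply hK.measurableSet, shellMeasure,
      withDensity_apply _ (hK.measurableSet.inter hS)]
    refine lt_of_le_of_lt (setLIntegral_mono' (g := fun _ => ENNReal.ofReal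
      (((2 * Real.pi) ^ 3)⁻¹ / (2 * r))) (hK.measurableSet.inter hS) fun k hk => ?_) ?_
    · refine ENNReal.ofReal_le_ofReal ?_
      have h₁ : r < ‖k‖ := hk.2
      have := h₁.le.trans (norm_le_energy m k)
      gcongr
    · rw [setLIntegral_const]
      exact ENNReal.mul_lt_top ENNReal.ofReal_lt_top
        ((measure_mono Set.inter_subset_left).trans_lt hK.measure_lt_top)

theorem shellMeasure_absolutelyContinuous (m : ℝ) : shellMeasure m ≪ volume :=
  withDensity_absolutelyContinuous _ _

theorem eLpNorm_two_sq {μ : Measure Momentum} (f : Momentum → ℂ) :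
    eLpNorm f 2 μ ^ 2 = ∫⁻ k, ‖f k‖ₑ ^ 2 ∂μ := by
  have := eLpNorm_nnreal_pow_eq_lintegral (μ := μ) (f := f) (p := 2) two_ne_zero
  simpa using this

/-- Dominated convergence for shrinking balls: their intersection is the origin, a null set. -/
theorem exists_eLpNorm_indicator_ball_lt {m : ℝ} {ψ : Momentum → ℂ}
    (hψ : MemLp ψ 2 (shellMeasure m)) {ε : ENNReal} (hε : 0 < ε) : ∃ r > 0,
    eLpNorm ((Metric.ball (0 : Momentum) r).indicator ψ) 2 (shellMeasure m) < ε := by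
  have hlim : Tendsto (fun n : ℕ => ∫⁻ k, ‖(Metric.ball (0 : Momentum) (1 / (n + 1 : ℝ))).indicator
      ψ k‖ₑ ^ 2 ∂(shellMeasure m)) atTop (nhds (∫⁻ _, 0 ∂(shellMeasure m))) := by
    refine tendsto_lintegral_of_dominated_convergence' (fun k => ‖ψ k‖ₑ ^ 2) (fun n => ?_)
      (fun n => Eventually.of_forall fun k => ?_) ?_ ?_
    · exact ((hψ.1.indicator measurableSet_ball).enorm).pow_const _
    · have := enorm_indicator_le_enorm_self ψ k (s := Metric.ball (0 : Momentum) (1 / (n + 1 : ℝ)))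
      dsimp only
      gcongr
    · rw [← eLpNorm_two_sq]
      exact ENNReal.pow_ne_top hψ.2.ne
    · have h0 : ∀ᵐ k ∂(shellMeasure m), k ≠ 0 :=
        (shellMeasure_absolutelyContinuous m).ae_le (compl_mem_ae_iff.mpr (measure_singleton 0))
      filter_upwards [h0] with k hk
      refine tendsto_const_nhds.congr' ?_
      have h₁ := tendsto_one_div_add_atTop_nhds_zero_nat (𝕜 := ℝ)
      filter_upwards [h₁.eventually_lt_const (norm_pos_iff.mpr hk)] with n hn
      rw [Set.indicator_of_notMem (by simpa using hn.le)]
      simp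
  rw [lintegral_zero] at hlim
  obtain ⟨n, hn⟩ := (hlim.eventually_lt_const (ENNReal.pow_pos hε 2)).exists
  refine ⟨1 / (n + 1 : ℝ), by positivity, ?_⟩
  rw [← eLpNorm_two_sq] at hn
  by_contra h
  have h' := not_lt.mp h
  exact absurd hn (not_lt.mpr (by gcongr))

/-- A small ball around the origin is discarded at cost ε/2. The rest is approximated by a smooth
compactly supported function for the measure on |k| > r/2, which is then cut off near the origin
without increasing the error. -/
theorem exists_isTame_eLpNorm_sub_lt {m : ℝ} {ψ : Momentum → ℂ}
    (hψ : MemLp ψ 2 (shellMeasure m)) {ε : ℝ} (hε : 0 < ε) :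
    ∃ h, IsTame h ∧ eLpNorm (ψ - h) 2 (shellMeasure m) < ENNReal.ofReal ε := by
  obtain ⟨r, hr, hlt⟩ := exists_eLpNorm_indicator_ball_lt hψ
    (ENNReal.ofReal_pos.mpr (half_pos hε))
  have hS : MeasurableSet {k : Momentum | r / 2 < ‖k‖} :=
    measurableSet_lt measurable_const measurable_norm
  let ψ₁ := (Metric.ball (0 : Momentum) r)ᶜ.indicator ψ
  have hψ₁ : MemLp ψ₁ 2 (shellMeasure m) := hψ.indicator measurableSet_ball.compl
  have := shellMeasure_restrict_lt_top m (half_pos hr)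
  obtain ⟨g, hg₁, hg₂, hg₃⟩ := MemLp.exist_eLpNorm_sub_le (μ := (shellMeasure m).restrict
    {k | r / 2 < ‖k‖}) ENNReal.ofNat_ne_top one_le_two (hψ₁.restrict _) (half_pos hε)
  let χ : ContDiffBump (0 : Momentum) := ⟨r / 2, r, half_pos hr, half_lt_self hr⟩
  have hχ : ContDiff ℝ (⊤ : ℕ∞) fun k => ((1 - χ k : ℝ) : ℂ) :=
    Complex.ofRealCLM.contDiff.comp (contDiff_const.sub χ.contDiff)
  have hin : ∀ k : Momentum, ‖k‖ ≤ r / 2 → χ k = 1 := fun k hk =>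
    χ.one_of_mem_closedBall (by simpa using hk)
  have hout : ∀ k : Momentum, r ≤ ‖k‖ → χ k = 0 := fun k hk =>
    χ.zero_of_le_dist (by simpa using hk)
  refine ⟨fun k => ((1 - χ k : ℝ) : ℂ) * g k, ⟨hχ.mul hg₂, hg₁.mul_left, ?_⟩, ?_⟩
  · filter_upwards [Metric.closedBall_mem_nhds (0 : Momentum) (half_pos hr)] with k hk
    rw [hin k (by simpa using hk)]
    simp
  -- Inside the ball ψ₁ = 0, and outside of it the cutoff factor is 1.
  have hsplit : ψ - (fun k => ((1 - χ k : ℝ) : ℂ) * g k) =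
      (Metric.ball (0 : Momentum) r).indicator ψ +
        fun k => ((1 - χ k : ℝ) : ℂ) * (ψ₁ k - g k) := by
    funext k
    by_cases hk : ‖k‖ < r
    · simp [ψ₁, hk, sub_eq_add_neg]
    · simp [ψ₁, hk, hout k (not_lt.mp hk)]
  have hbound : eLpNorm (fun k => ((1 - χ k : ℝ) : ℂ) * (ψ₁ k - g k)) 2 (shellMeasure m) ≤
      ENNReal.ofReal (ε / 2) := by
    rw [← eLpNorm_indicator_eq_eLpNorm_restrict hS] at hg₃
    refine le_trans (eLpNorm_mono fun k => ?_) hg₃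
    by_cases hk : r / 2 < ‖k‖
    · rw [Set.indicator_of_mem (by exact hk), norm_mul, Complex.norm_real]
      refine mul_le_of_le_one_left (norm_nonneg _) ?_
      rw [Real.norm_eq_abs, abs_le]
      constructor <;> linarith [χ.nonneg (x := k), χ.le_one (x := k)]
    · rw [hin k (not_lt.mp hk)]
      simp
  rw [hsplit]
  refine (eLpNorm_add_le (hψ.1.indicator measurableSet_ball) ?_ one_le_two).trans_lt ?_
  · exact hχ.continuous.aestronglyMeasurable.mul (hψ₁.1.sub hg₂.continuous.aestronglyMeasurable)
  · rw [← add_halves ε, ENNReal.ofReal_add (half_pos hε).le (half_pos hε).le]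
    exact ENNReal.add_lt_add_of_lt_of_le (ne_top_of_le_ne_top ENNReal.ofReal_ne_top hbound) hlt hbound

theorem exists_isTame_lintegral_lt {m : ℝ} {ι : Type} [Fintype ι] [Nonempty ι]
    {z : ι → Momentum → ℂ} (hz : ∀ j, Measurable (z j))
    (hfin : ∫⁻ k, ∑ j, ‖z j k‖ₑ ^ 2 ∂(shellMeasure m) < ⊤) {ε : ENNReal} (hε : 0 < ε) :
    ∃ h : ι → Momentum → ℂ, (∀ j, IsTame (h j)) ∧
      ∫⁻ k, ∑ j, ‖z j k - h j k‖ₑ ^ 2 ∂(shellMeasure m) < ε := by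
  have hL : ∀ j, MemLp (z j) 2 (shellMeasure m) := by
    refine fun j => ⟨(hz j).aestronglyMeasurable, ?_⟩
    have h : eLpNorm (z j) 2 (shellMeasure m) ^ 2 < ⊤ := by
      rw [eLpNorm_two_sq]
      refine (lintegral_mono fun k => ?_).trans_lt hfin
      exact Finset.single_le_sum (f := fun j => ‖z j k‖ₑ ^ 2) (fun _ _ => zero_le)
        (Finset.mem_univ j)
    exact (ENNReal.pow_lt_top_iff.mp h).resolve_right two_ne_zero
  obtain ⟨c, hc0, hc⟩ := ENNReal.lt_iff_exists_nnreal_btwn.mp hε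
  have hc0' : (0 : ℝ) < c := by exact_mod_cast hc0
  have hn : (0 : ℝ) < Fintype.card ι := by exact_mod_cast Fintype.card_pos
  -- Each component receives an equal share of the squared error `c`.
  choose h hh hlt using fun j => exists_isTame_eLpNorm_sub_lt (hL j)
    (Real.sqrt_pos.mpr (div_pos hc0' hn))
  refine ⟨h, hh, lt_of_le_of_lt ?_ hc⟩
  rw [lintegral_finsetSum]
  · have : ∀ j, ∫⁻ k, ‖z j k - h j k‖ₑ ^ 2 ∂(shellMeasure m) ≤
        ENNReal.ofReal (c / Fintype.card ι) := by
      intro j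
      have e := eLpNorm_two_sq (μ := shellMeasure m) (z j - h j)
      simp only [Pi.sub_apply] at e
      rw [← e, ← Real.sq_sqrt (div_pos hc0' hn).le, ENNReal.ofReal_pow (Real.sqrt_nonneg _)]
      exact pow_le_pow_left₀ zero_le (hlt j).le 2
    refine (Finset.sum_le_sum fun j _ => this j).trans ?_
    rw [Finset.sum_const, Finset.card_univ, nsmul_eq_mul, ← ENNReal.ofReal_natCast,
      ← ENNReal.ofReal_mul hn.le, mul_div_cancel₀ _ hn.ne', ENNReal.ofReal_coe_nnreal]
  · exact fun j _ => (((hz j).sub (hh j).contDiff.continuous.measurable).enorm).pow_const _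

/-! ### Density of the one-particle spaces -/

theorem ofReal_re_sum_conj_mul {ι : Type} [Fintype ι] (z : ι → ℂ) :
    ENNReal.ofReal (∑ j, conj (z j) * z j).re = ∑ j, ‖z j‖ₑ ^ 2 := by
  have : ∀ j, (conj (z j) * z j).re = ‖z j‖ ^ 2 := by
    intro j
    rw [← Complex.normSq_eq_conj_mul_self, Complex.ofReal_re, Complex.normSq_eq_norm_sq]
  rw [Complex.re_sum, ENNReal.ofReal_sum_of_nonneg fun j _ => by rw [this]; positivity]
  refine Finset.sum_congr rfl fun j _ => ?_
  rw [this, ENNReal.ofReal_pow (norm_nonneg _), ofReal_norm]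

theorem contDiff_coord (j : Fin 3) : ContDiff ℝ (⊤ : ℕ∞) fun k : Momentum => ((k j : ℝ) : ℂ) :=
  Complex.ofRealCLM.contDiff.comp (by fun_prop)

theorem contDiffAt_norm_sq_inv {k : Momentum} (hk : k ≠ 0) :
    ContDiffAt ℝ (⊤ : ℕ∞) (fun k : Momentum => (((‖k‖ ^ 2)⁻¹ : ℝ) : ℂ)) k :=
  Complex.ofRealCLM.contDiff.contDiffAt.comp k
    ((contDiff_norm_sq ℝ).contDiffAt.inv (pow_ne_zero 2 (norm_ne_zero_iff.mpr hk)))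

/-- Removing the longitudinal part does not increase the norm. -/
theorem sum_transverse_le (k : Momentum) (x : Fin 3 → ℂ) :
    (∑ j, conj (x j - k j * (((‖k‖ ^ 2)⁻¹ : ℝ) * ∑ a, (k a : ℂ) * x a)) *
      (x j - k j * (((‖k‖ ^ 2)⁻¹ : ℝ) * ∑ a, (k a : ℂ) * x a))).re ≤
    (∑ j, conj (x j) * x j).re := by
  have h : ‖k‖ ^ 2 = ∑ j, k j ^ 2 := EuclideanSpace.real_norm_sq_eq k
  generalize hs : ∑ a, (k a : ℂ) * x a = s
  have key : ∑ j, conj (x j - k j * (((‖k‖ ^ 2)⁻¹ : ℝ) * s)) *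
      (x j - k j * (((‖k‖ ^ 2)⁻¹ : ℝ) * s)) =
      ∑ j, conj (x j) * x j - (((‖k‖ ^ 2)⁻¹ : ℝ) : ℂ) * (conj s * s) := by
    -- At k = 0 the subtracted term is zero, as is its coefficient by the convention for inverses.
    by_cases hk : k = 0
    · simp [hk]
    have hk' : (‖k‖ ^ 2)⁻¹ * ∑ j, k j ^ 2 = 1 := by
      rw [← h, inv_mul_cancel₀ (pow_ne_zero 2 (norm_ne_zero_iff.mpr hk))]
    generalize (‖k‖ ^ 2)⁻¹ = c at hk'
    have hc : (c : ℂ) * ∑ j, (k j : ℂ) ^ 2 = 1 := by exact_mod_cast hk'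
    have hs' := congrArg conj hs
    simp only [Fin.sum_univ_three, map_add, map_mul, map_sub, Complex.conj_ofReal] at hs hs' hc ⊢
    linear_combination (-(c * s)) * hs' - (c * conj s) * hs + (c * conj s * s) * hc
  rw [key, Complex.sub_re, sub_le_self_iff, ← Complex.normSq_eq_conj_mul_self,
    ← Complex.ofReal_mul, Complex.ofReal_re]
  exact mul_nonneg (by positivity) (Complex.normSq_nonneg s)

/-- The components are approximated by tame functions, and the approximant is projected pointwise
onto the vectors orthogonal to k. The projection fixes ψ and is a contraction, so the error does not
grow; tameness survives since the singularity at k = 0 is avoided. -/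
theorem photon_dense (ψ : Momentum → Fin 3 → ℂ) (hψ : Measurable ψ) (hh : HasHelicityOne ψ)
    (hfin : ∫⁻ k, ENNReal.ofReal (vecInner ψ ψ k).re ∂(shellMeasure 0) < ⊤)
    (ε : ENNReal) (hε : 0 < ε) : ∃ φ : photon.Wave,
      ∫⁻ k, ENNReal.ofReal (vecInner (ψ - φ.1) (ψ - φ.1) k).re ∂(shellMeasure 0) < ε := by
  simp only [vecInner, ofReal_re_sum_conj_mul] at hfin
  obtain ⟨h, ht, hlt⟩ := exists_isTame_lintegral_lt (z := fun j k => ψ k j)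
    (fun j => (measurable_pi_apply j).comp hψ) hfin hε
  have htame : ∀ j : Fin 3, IsTame fun k => h j k +
      -((k j : ℂ) * (((‖k‖ ^ 2)⁻¹ : ℝ) : ℂ)) * ∑ a, (k a : ℂ) * h a k := fun j =>
    (ht j).add (IsTame.mul
      (fun k hk => ((contDiff_coord j).contDiffAt.mul (contDiffAt_norm_sq_inv hk)).neg)
      (IsTame.sum _ fun a _ => IsTame.mul (fun k _ => (contDiff_coord a).contDiffAt) (ht a)))
  choose f hf using fun j => (htame j).exists_posFT 0
  obtain ⟨hψ₁, hψ₀⟩ := (hasHelicityOne_iff ψ).mp hh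
  obtain ⟨φ, hφ⟩ := exists_photon f fun k => by
    simp only [TestSpace.hat_apply, hf]
    by_cases hk : k = 0
    · simp [hk]
    have h₁ : ∑ j : Fin 3, (k j : ℂ) * k j = ((‖k‖ ^ 2 : ℝ) : ℂ) := by
      rw [EuclideanSpace.real_norm_sq_eq]
      push_cast
      exact Finset.sum_congr rfl fun j _ => (sq _).symm
    have h₂ : ((‖k‖ ^ 2 : ℝ) : ℂ) * (((‖k‖ ^ 2)⁻¹ : ℝ) : ℂ) = 1 := by
      rw [← Complex.ofReal_mul, mul_inv_cancel₀ (pow_ne_zero 2 (norm_ne_zero_iff.mpr hk)),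
        Complex.ofReal_one]
    rw [← h₁] at h₂
    simp only [Fin.sum_univ_three] at h₂ ⊢
    linear_combination (-((k 0 : ℂ) * h 0 k + k 1 * h 1 k + k 2 * h 2 k)) * h₂
  refine ⟨φ, lt_of_le_of_lt (lintegral_mono fun k => ?_) hlt⟩
  rw [← ofReal_re_sum_conj_mul]
  refine ENNReal.ofReal_le_ofReal ?_
  refine le_trans (le_of_eq ?_) (sum_transverse_le k fun j => ψ k j - h j k)
  simp only [vecInner]
  congr 1
  have e : ∀ j, (ψ - φ.1) k j = ψ k j - h j k -
      k j * (((‖k‖ ^ 2)⁻¹ : ℝ) * ∑ a, (k a : ℂ) * (ψ k a - h a k)) := by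
    intro j
    simp only [Pi.sub_apply, mul_sub, Finset.sum_sub_distrib, hψ₁ k]
    rw [hφ, TestSpace.hat_apply, hf]
    ring
  exact Finset.sum_congr rfl fun j _ => by rw [e]

section SpinOne

variable {m : ℝ} (hm : 0 < m)
include hm

theorem contDiff_energy : ContDiff ℝ (⊤ : ℕ∞) (energy m) := by
  unfold energy
  exact (contDiff_const.add (contDiff_norm_sq ℝ)).sqrt fun k => by positivity

theorem contDiff_boost (j : Fin 3) : ContDiff ℝ (⊤ : ℕ∞) fun k => ((boost m j k : ℝ) : ℂ) := by
  refine Complex.ofRealCLM.contDiff.comp ?_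
  refine ContDiff.div (by fun_prop) ((contDiff_energy hm).add contDiff_const) fun k =>
    (energy_add_pos hm k).ne'

/-- Passing to rest-frame components is isometric and removes the constraint, so arbitrary tame
components h_j may be chosen and transformed back. -/
theorem spinOne_dense (ψ : Momentum → Fin 4 → ℂ) (hψ : Measurable ψ) (htr : IsTransverse m ψ)
    (hfin : ∫⁻ k, ENNReal.ofReal (minkInner ψ ψ k).re ∂(shellMeasure m) < ⊤)
    (ε : ENNReal) (hε : 0 < ε) : ∃ φ : (spinOne m).Wave,
      ∫⁻ k, ENNReal.ofReal (minkInner (ψ - φ.1) (ψ - φ.1) k).re ∂(shellMeasure m) < ε := by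
  have hm' : (m : ℂ) ≠ 0 := by exact_mod_cast hm.ne'
  simp only [← sum_restFrame hm htr htr, ofReal_re_sum_conj_mul] at hfin
  obtain ⟨h, ht, hlt⟩ := exists_isTame_lintegral_lt (z := restFrame m ψ) (fun j => by
      have h₁ : Measurable fun k => ψ k j.succ := (measurable_pi_apply j.succ).comp hψ
      have h₂ : Measurable fun k => ψ k 0 := (measurable_pi_apply (0 : Fin 4)).comp hψ
      have h₃ := (continuous_boost hm j).measurable
      unfold restFrame
      fun_prop) hfin hε
  -- The inverse boost: transversality and |k|² = ω² - m² give k·h = -m ψ₀, which determines ψ₀, and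
  -- then ψ_j = h_j - k_j ψ₀/(ω + m).
  have h0 : IsTame fun k => -((m : ℂ)⁻¹) * ∑ a, (k a : ℂ) * h a k :=
    IsTame.mul (fun k _ => contDiffAt_const)
      (IsTame.sum _ fun a _ => IsTame.mul (fun k _ => (contDiff_coord a).contDiffAt) (ht a))
  have htame : ∀ μ : Fin 4, IsTame (Fin.cons (α := fun _ => Momentum → ℂ)
      (fun k => -((m : ℂ)⁻¹) * ∑ a, (k a : ℂ) * h a k)
      (fun j k => h j k + -(boost m j k : ℂ) * (-((m : ℂ)⁻¹) * ∑ a, (k a : ℂ) * h a k)) μ) := by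
    intro μ
    refine Fin.cases h0 (fun j => ?_) μ
    exact (ht j).add (IsTame.mul (fun k _ => (contDiff_boost hm j).contDiffAt.neg) h0)
  choose f hf using fun μ => (htame μ).exists_posFT m
  obtain ⟨φ, hφ⟩ := Massive.exists_spinOne (m := m) (fun μ => (⟨f μ, trivial⟩ : allTest.Fun))
    fun k => by
    have hE : ((energy m k : ℝ) : ℂ) + m ≠ 0 := by exact_mod_cast (energy_add_pos hm k).ne'
    have hk : (energy m k : ℂ) ^ 2 = m ^ 2 + ∑ j : Fin 3, (k j : ℂ) ^ 2 := by
      have := energy_sq m k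
      rw [EuclideanSpace.real_norm_sq_eq] at this
      exact_mod_cast this
    simp only [TestSpace.hat_apply, hf]
    rw [Fin.sum_univ_succ]
    simp only [Fin.cons_zero, Fin.cons_succ, shellPoint, boost, Fin.sum_univ_three] at hk ⊢
    push_cast
    field_simp
    linear_combination (-((k 0 : ℂ) * h 0 k + k 1 * h 1 k + k 2 * h 2 k)) * hk
  have hsub : IsTransverse m (ψ - φ.1) := fun k => by
    simp only [Pi.sub_apply, mul_sub, Finset.sum_sub_distrib, htr k, φ.2.1 k, sub_zero]
  refine ⟨φ, lt_of_le_of_lt (lintegral_mono fun k => le_of_eq ?_) hlt⟩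
  rw [← sum_restFrame hm hsub hsub, ofReal_re_sum_conj_mul]
  refine Finset.sum_congr rfl fun j _ => ?_
  have e₀ : φ.1 k 0 = -((m : ℂ)⁻¹) * ∑ a, (k a : ℂ) * h a k := by
    rw [hφ, TestSpace.hat_apply]
    exact hf 0 k
  have e₁ : φ.1 k j.succ = h j k + -(boost m j k : ℂ) * φ.1 k 0 := by
    rw [e₀, hφ, TestSpace.hat_apply]
    exact hf j.succ k
  congr 2
  simp only [restFrame, Pi.sub_apply]
  rw [e₁]
  ring

end SpinOne

end GaugeCharge

end

/-! ### The two cases assembled -/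

open GaugeCharge in
theorem mainTheorem10 :
    -- massless case
    ((∃! Q : Massless.H →ₗ[ℂ] Massless.H, Massless.IsGaugeCharge Q) ∧
      (∀ Q : Massless.H →ₗ[ℂ] Massless.H, Massless.IsGaugeCharge Q →
        Q ∘ₗ Q = 0 ∧
        (∀ Ψ ∈ LinearMap.ker Q,
          (massless.form Ψ Ψ).im = 0 ∧ 0 ≤ (massless.form Ψ Ψ).re ∧
          (massless.form Ψ Ψ = 0 ↔ Ψ ∈ LinearMap.range Q)) ∧
        ∃ Θ : Cohomology Q ≃ₗ[ℂ] photon.Fock,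
          (∀ Ψ Ψ' : LinearMap.ker Q,
            photon.form (Θ (cls Q Ψ)) (Θ (cls Q Ψ')) = massless.form Ψ Ψ') ∧
          (∃ h : massless.vacuum ∈ LinearMap.ker Q,
            Θ (cls Q ⟨massless.vacuum, h⟩) = photon.vacuum) ∧
          ∀ f : Fin 4 → infraredTest.Fun, VanishesOnShell 0 (infraredTest.div f) →
            ∃ ψ ψ' : photon.Wave, IsRadiationPart f ψ ∧
              IsRadiationPart (fun μ => infraredTest.bar (f μ)) ψ' ∧
              ∀ Ψ : LinearMap.ker Q, ∃ h : Massless.vSmeared f Ψ ∈ LinearMap.ker Q,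
                Θ (cls Q ⟨Massless.vSmeared f Ψ, h⟩) =
                  photon.create ψ (Θ (cls Q Ψ)) + photon.annihilate ψ' (Θ (cls Q Ψ))) ∧
      (∀ ψ : Momentum → Fin 3 → ℂ, Measurable ψ → HasHelicityOne ψ →
        ∫⁻ k, ENNReal.ofReal (vecInner ψ ψ k).re ∂(shellMeasure 0) < ⊤ →
        ∀ ε : ENNReal, 0 < ε → ∃ φ : photon.Wave,
          ∫⁻ k, ENNReal.ofReal (vecInner (ψ - φ.1) (ψ - φ.1) k).re ∂(shellMeasure 0) < ε)) ∧
    -- massive case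
    (∀ m : ℝ, 0 < m →
      (∃! Q : Massive.H m →ₗ[ℂ] Massive.H m, Massive.IsGaugeCharge m Q) ∧
      (∀ Q : Massive.H m →ₗ[ℂ] Massive.H m, Massive.IsGaugeCharge m Q →
        Q ∘ₗ Q = 0 ∧
        (∀ Ψ ∈ LinearMap.ker Q,
          ((massive m).form Ψ Ψ).im = 0 ∧ 0 ≤ ((massive m).form Ψ Ψ).re ∧
          ((massive m).form Ψ Ψ = 0 ↔ Ψ ∈ LinearMap.range Q)) ∧
        ∃ Θ : Cohomology Q ≃ₗ[ℂ] (spinOne m).Fock,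
          (∀ Ψ Ψ' : LinearMap.ker Q,
            (spinOne m).form (Θ (cls Q Ψ)) (Θ (cls Q Ψ')) = (massive m).form Ψ Ψ') ∧
          (∃ h : (massive m).vacuum ∈ LinearMap.ker Q,
            Θ (cls Q ⟨(massive m).vacuum, h⟩) = (spinOne m).vacuum) ∧
          ∀ (f : Fin 4 → allTest.Fun) (g : allTest.Fun),
            VanishesOnShell m ((allTest.div f - (m : ℂ) • g : allTest.Fun) : TestFun) →
            ∃ ψ ψ' : (spinOne m).Wave, IsUnitaryPart m f g ψ ∧
              IsUnitaryPart m (fun μ => allTest.bar (f μ)) (allTest.bar g) ψ' ∧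
              ∀ Ψ : LinearMap.ker Q,
                ∃ h : (Massive.vSmeared m f + Massive.Phi m g) Ψ ∈ LinearMap.ker Q,
                Θ (cls Q ⟨(Massive.vSmeared m f + Massive.Phi m g) Ψ, h⟩) =
                  (spinOne m).create ψ (Θ (cls Q Ψ)) +
                    (spinOne m).annihilate ψ' (Θ (cls Q Ψ))) ∧
      (∀ ψ : Momentum → Fin 4 → ℂ, Measurable ψ → IsTransverse m ψ →
        ∫⁻ k, ENNReal.ofReal (minkInner ψ ψ k).re ∂(shellMeasure m) < ⊤ →
        ∀ ε : ENNReal, 0 < ε → ∃ φ : (spinOne m).Wave,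
          ∫⁻ k, ENNReal.ofReal (minkInner (ψ - φ.1) (ψ - φ.1) k).re ∂(shellMeasure m) < ε)) := by
  refine ⟨⟨?_, fun Q hQ => ?_, photon_dense⟩, fun m hm => ⟨?_, fun Q hQ => ?_, spinOne_dense hm⟩⟩
  · refine ⟨Massless.quartet.quartet.fieldCharge Massless.represents, ?_, fun Q hQ => ?_⟩
    · exact (Massless.isGaugeCharge_iff _).mpr (Letters.Quartet.isCharge_fieldCharge _ _)
    · exact ((Massless.isGaugeCharge_iff Q).mp hQ).eq_fieldCharge
  · have h := (Massless.isGaugeCharge_iff Q).mp hQ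
    refine ⟨h.comp_self, h.positive photonAmplitudes, h.iso, h.form_iso, h.iso_vacuum,
      fun f hf => ?_⟩
    obtain ⟨hq, ψ, hψ, hs, -⟩ := Massless.exists_radiationPart f fun k => by
      have := infraredTest.hat_div f k (m := 0)
      rw [TestSpace.hat_apply, (hf k).1] at this
      simpa using this.symm
    -- The creation letter needs the condition on the upper half of the cone; the annihilation
    -- letter, built from conjugate test functions, needs it on the lower half.
    obtain ⟨hq', ψ', hψ', -, hs'⟩ := Massless.exists_radiationPart
      (fun μ => infraredTest.bar (f μ)) fun k => by
      have := infraredTest.hat_bar_div f k (m := 0)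
      rw [TestSpace.hat_bar, (hf k).2] at this
      simpa using this.symm
    exact ⟨ψ, ψ', hψ, hψ', h.iso_field (Massless.equiv_vSmeared f) rfl rfl hq hq' hs hs'⟩
  · refine ⟨(Massive.quartet hm).quartet.fieldCharge (Massive.represents hm), ?_, fun Q hQ => ?_⟩
    · exact (Massive.isGaugeCharge_iff hm _).mpr (Letters.Quartet.isCharge_fieldCharge _ _)
    · exact ((Massive.isGaugeCharge_iff hm Q).mp hQ).eq_fieldCharge
  · have h := (Massive.isGaugeCharge_iff hm Q).mp hQ
    refine ⟨h.comp_self, h.positive (spinOneAmplitudes hm), h.iso, h.form_iso, h.iso_vacuum,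
      fun f g hf => ?_⟩
    obtain ⟨hq, ψ, hψ, hs, -⟩ := Massive.exists_unitaryPart hm f g fun k => by
      have h₁ := allTest.hat_div f k (m := m)
      have h₂ : allTest.hat m k (allTest.div f - (m : ℂ) • g) = 0 := (hf k).1
      rw [map_sub, map_smul, smul_eq_mul, h₁] at h₂
      linear_combination Complex.I * h₂ +
        (∑ μ, (shellPoint m k μ : ℂ) * allTest.hat m k (f μ)) * Complex.I_mul_I
    obtain ⟨hq', ψ', hψ', -, hs'⟩ := Massive.exists_unitaryPart hm
      (fun μ => allTest.bar (f μ)) (allTest.bar g) fun k => by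
      -- Conjugating the condition on the lower sheet gives the same equation for the conjugate test
      -- functions on the upper sheet.
      have h₁ : negFT m ((allTest.div f + (-(m : ℂ)) • g : allTest.Fun) : TestFun) k = 0 := by
        rw [neg_smul, ← sub_eq_add_neg]
        exact (hf k).2
      have h₂ := (negFT_add m _ _ k).symm.trans h₁
      rw [allTest.negFT_div, Submodule.coe_smul, negFT_smul] at h₂
      have h₃ := congrArg conj h₂
      simp only [map_add, map_mul, map_sum, map_neg, map_zero, Complex.conj_ofReal,
        Complex.conj_I, ← allTest.hat_bar] at h₃
      linear_combination Complex.I * h₃ +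
        (∑ μ, (shellPoint m k μ : ℂ) * allTest.hat m k (allTest.bar (f μ))) * Complex.I_mul_I
    exact ⟨ψ, ψ', hψ, hψ', h.iso_field (Massive.equiv_field hm f g) rfl rfl hq hq' hs hs'⟩
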